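/- **Setting.** Let $X\subset\mathbb R^d$ be a finite set, $\mathcal D_X$ a probability distribution on $X$, and let $\Theta\subset\mathbb R^d$ be a convex set of positive Lebesgue measure. Let $R_1,R_2\ge 1$ with $\|\theta\|_2\le R_1$ for all $\theta\in\Theta$ and $\|x\|_2\le R_2$ for all $x\in X$, and let $\gamma\in(0,\tfrac12)$, $\varepsilon>0$. For $\theta\in\Theta$ let $h_\theta(x)=\min\{\max\{\sigma(\theta^\top x),\gamma\},1-\gamma\}$ with $\sigma(a)=1/(1+e^{-a})$, and let $H_\gamma=\{h_\theta:\theta\in\Theta\}$. For hypotheses $h,h'$ put $\|h-h'\|=\big(\mathbb E_{x\sim\mathcal D_X}(h(x)-h'(x))^2\big)^{1/2}$. For a hidden ground truth $h^*\in H_\gamma$, each query of a point $x\in X$ returns independently the label $1$ with probability $h^*(x)$ and $0$ otherwise; $\mathrm{err}(h)=\|h-h^*\|$. The optimal label complexity $m^*(X,\mathcal D_X,H,\varepsilon,\delta)$ is the least $n$ such that some (randomized, adaptive) algorithm that makes at most $n$ queries outputs, for every $h^*\in H$, a hypothesis $\hat h\in H$ with $\mathrm{err}(\hat h)<\varepsilon$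 with probability at least $1-\delta$. **Algorithm ClippedActive** with parameters $K,M$. A set of labelled queries $(x,y)$ updates a distribution on $\Theta$ by multiplying its density at $\theta$ by $\prod_{(x,y)}h_\theta(x)^{y}(1-h_\theta(x))^{1-y}$ and normalizing. Initially $\lambda$ is uniform on $\Theta$. In each phase $i=1,\dots,K$: let $\lambda^0$ be the current $\lambda$ and let $p_{(i,1)}$ be uniform on $\Theta$. For $j=1,\dots,M$: let $\hat\lambda=\frac12\lambda^0+\frac12\,\mathbb E_{\theta'\sim\lambda^0}\big[p_{(i,j)}(\,\cdot\mid\{\theta:\|h_\theta-h_{\theta'}\|\ge2\varepsilon\})\big]$; query twice a point $x_{(i,j)}$ that maximizes $r_{\hat\lambda}(x)=\mathbb E_{\theta\sim\hat\lambda}\,D_{\mathrm{KL}}\big(\bar h_{\hat\lambda}(x)\,\|\,h_\theta(x)\big)$ over $x\in X$, where $\bar h_{\hat\lambda}(x)=\mathbb E_{\theta\sim\hat\lambda}h_\theta(x)$, $D_{\mathrm{KL}}$ is the binary divergence, and ties are broken by an arbitrary fixed rule; update $p_{(i,j)}$ by the two labels to get $p_{(i,j+1)}$. At the end of the phase query every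 point of the set $\{x_{(i,1)},\dots,x_{(i,M)}\}$ twice again and update $\lambda$ by these new labels. After the last phase draw $\hat\theta$ from $\frac1K\sum_{i=1}^Kp_{(i,M+1)}$ and return $\hat h=h_{\hat\theta}$. **Lemma.** There are an absolute constant $C>0$ and a choice of $K$ and $M$ as functions of $(d,m,R_1,R_2,\gamma,\varepsilon)$ only, where $m=m^*(X,\mathcal D_X,H_\gamma,\varepsilon,0.01)$, such that in every such setting ClippedActive makes at most $$C\,d^2\,m^{20}\,\log^{26}\!\Big(\frac1\gamma\Big)\,\log^{2}\!\Big(\frac{d\,R_1R_2\,m}{\varepsilon}\Big)$$ queries (read as $0$ if $dm=0$), and for every ground truth $h^*\in H_\gamma$ it returns $\hat h\in H_\gamma$ with $\mathrm{err}(\hat h)\le8\varepsilon$ with probability greater than $0.8$. -/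

import Mathlib

open MeasureTheory ProbabilityTheory
open scoped ENNReal

noncomputable section

namespace ActiveLogistic

/-! ### Interactive algorithms with access to a label oracle -/

/-- A randomized interactive algorithm: it stops with a result, tosses a biased private coin
(`true` with probability `p`), or queries the label of a point, and it continues according to
the answer. Every run is finite. -/
inductive QueryAlg (X α : Type) : Type
  | ret (a : α) : QueryAlg X α
  | coin (p : unitInterval) (k : Bool → QueryAlg X α) : QueryAlg X α
  | query (x : X) (k : Bool → QueryAlg X α) : QueryAlg X α

namespace QueryAlg

/-- Sequential composition. -/
def bind {X α β : Type} : QueryAlg X α → (α → QueryAlg X β) → QueryAlg X β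
  | ret a, f => f a
  | coin p k, f => coin p fun b => bind (k b) f
  | query x k, f => query x fun y => bind (k y) f

instance {X : Type} : Monad (QueryAlg X) where
  pure := ret
  bind := bind

/-- Query one point and return its label (`true` is the label `1`). -/
def ask {X : Type} (x : X) : QueryAlg X Bool := query x ret

/-- The number of label queries in the worst case over all labels and all coins. -/
def numQueries {X α : Type} : QueryAlg X α → ℕ
  | ret _ => 0
  | coin _ k => max (numQueries (k true)) (numQueries (k false))
  | query _ k => 1 + max (numQueries (k true)) (numQueries (k false))

/-- Every result that the algorithm can stop with satisfies `P`. -/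
def AllResults {X α : Type} (P : α → Prop) : QueryAlg X α → Prop
  | ret a => P a
  | coin _ k => AllResults P (k true) ∧ AllResults P (k false)
  | query _ k => AllResults P (k true) ∧ AllResults P (k false)

/-- For an algorithm whose result is the probability distribution from which its final output is
drawn: the law of the final output when each query of `x` is answered, independently of
everything else, by the label `1` with probability `h x` and by `0` otherwise. -/
def outputLaw {X Ω : Type} [MeasurableSpace Ω] (h : X → ℝ) :
    QueryAlg X (Measure Ω) → Measure Ω
  | ret ν => ν
  | coin p k => ENNReal.ofReal (p : ℝ) • outputLaw h (k true)
      + ENNReal.ofReal (1 - (p : ℝ)) • outputLaw h (k false)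
  | query x k => ENNReal.ofReal (h x) • outputLaw h (k true)
      + ENNReal.ofReal (1 - h x) • outputLaw h (k false)

end QueryAlg

/-! ### Realizable active probabilistic classification -/

/-- The weighted `ℓ²`-distance `(𝔼_{x ∼ D} (h₁ x - h₂ x)²)^{1/2}` of two hypotheses. -/
def l2Dist {X : Type} [Fintype X] (D : PMF X) (h₁ h₂ : X → ℝ) : ℝ :=
  √(∑ x, (D x).toReal * (h₁ x - h₂ x) ^ 2)

/-- The error of the hypothesis `h` when the ground truth is `hstar`. -/
def err {X : Type} [Fintype X] (D : PMF X) (hstar h : X → ℝ) : ℝ := l2Dist D h hstar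

/-- The algorithm `A` outputs hypotheses of `H` and, for every ground truth in `H`, its output
has error less than `ε` with probability at least `1 - δ`. -/
def Solves {X : Type} [Fintype X] (A : QueryAlg X (Measure (X → ℝ))) (D : PMF X)
    (H : Set (X → ℝ)) (ε δ : ℝ) : Prop :=
  A.AllResults (fun ν => IsProbabilityMeasure ν ∧ ∀ᵐ h ∂ν, h ∈ H) ∧
    ∀ hstar ∈ H, ENNReal.ofReal (1 - δ) ≤ A.outputLaw hstar {h | err D hstar h < ε}

/-- The optimal label complexity `m*(X, D, H, ε, δ)`. For finite `X` and `ε, δ > 0` some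
algorithm solves the problem, so the infimum is a minimum. -/
def mStar {X : Type} [Fintype X] (D : PMF X) (H : Set (X → ℝ)) (ε δ : ℝ) : ℕ :=
  sInf {n | ∃ A : QueryAlg X (Measure (X → ℝ)), Solves A D H ε δ ∧ A.numQueries ≤ n}

/-! ### Clipped logistic hypotheses -/

/-- `ℝ^d` with its Euclidean norm. -/
abbrev Vec (d : ℕ) : Type := EuclideanSpace ℝ (Fin d)

def clip (z γ : ℝ) : ℝ := min (max z γ) (1 - γ)

/-- The clipped logistic hypothesis `x ↦ clip (σ (θᵀ x)) γ` on the dataset `X`. -/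
def clippedHyp {d : ℕ} (X : Finset (Vec d)) (γ : ℝ) (θ : Vec d) : X → ℝ :=
  fun x => clip (Real.sigmoid (inner ℝ θ (x : Vec d))) γ

/-- The clipped class `H_γ` with parameter space `Θ`. -/
def clippedClass {d : ℕ} (X : Finset (Vec d)) (Θ : Set (Vec d)) (γ : ℝ) : Set (X → ℝ) :=
  clippedHyp X γ '' Θ

/-! ### The algorithm -/

/-- A list of queried points with the labels that were obtained. -/
abbrev Sample (X : Type) : Type := List (X × Bool)

/-- The cross-entropy loss `y log (1 / h x) + (1 - y) log (1 / (1 - h x))`. -/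
def crossEntropy {X : Type} (h : X → ℝ) (x : X) (y : Bool) : ℝ :=
  if y then Real.log (1 / h x) else Real.log (1 / (1 - h x))

/-- The multiplicative weight `∏ exp (-ℓ_h (x, y))` that the labels in `S` give to `h`. -/
def weight {X : Type} (S : Sample X) (h : X → ℝ) : ℝ :=
  (S.map fun s => Real.exp (-crossEntropy h s.1 s.2)).prod

/-- The binary Kullback-Leibler divergence. -/
def binaryKL (p q : ℝ) : ℝ :=
  p * Real.log (p / q) + (1 - p) * Real.log ((1 - p) / (1 - q))

section Algorithm

variable {d : ℕ} {X : Finset (Vec d)} (D : PMF X) (Θ : Set (Vec d)) (γ ε : ℝ)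

/-- The distribution on the parameter space that is obtained from the uniform distribution on `Θ`
by multiplying the density with the weights given by `S` and normalizing. -/
def posterior (S : Sample X) : Measure (Vec d) :=
  let w : Vec d → ℝ≥0∞ := fun θ => ENNReal.ofReal (weight S (clippedHyp X γ θ))
  let U : Measure (Vec d) := ProbabilityTheory.cond volume Θ
  (∫⁻ θ, w θ ∂U)⁻¹ • U.withDensity w

/-- The parameters whose hypothesis has distance at least `ρ` from that of `θ'`. -/
def farFrom (ρ : ℝ) (θ' : Vec d) : Set (Vec d) :=
  {θ | ρ ≤ l2Dist D (clippedHyp X γ θ') (clippedHyp X γ θ)}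

/-- The law of the sampling procedure: draw `h₁` from `p`, draw `h₂` from `q` conditioned on
distance at least `ρ` from `h₁`, and return one of the two with probability `1/2` each.
(Where the condition has `q`-measure zero, `cond` is the zero measure.) -/
def samplingLaw (p q : Measure (Vec d)) (ρ : ℝ) : Measure (Vec d) :=
  (2 : ℝ≥0∞)⁻¹ • p +
    (2 : ℝ≥0∞)⁻¹ • p.bind fun θ' => ProbabilityTheory.cond q (farFrom D γ ρ θ')

/-- The informativeness `r_ν(x) = 𝔼_{h ∼ ν} KL(h̄_ν(x) ‖ h(x))`, with `h̄_ν(x) = 𝔼_{h ∼ ν} h(x)`. -/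
def informativeness (ν : Measure (Vec d)) (x : X) : ℝ :=
  ∫ θ, binaryKL (∫ θ', clippedHyp X γ θ' x ∂ν) (clippedHyp X γ θ x) ∂ν

variable (argmax : (X → ℝ) → X)

/-- The next point to query when `S` holds the labels that have updated `λ` in the earlier phases
and `P` the labels that have updated `p` in the current phase. -/
def nextQuery (S P : Sample X) : X :=
  argmax (informativeness γ
    (samplingLaw D γ (posterior Θ γ S) (posterior Θ γ P) (2 * ε)))

/-- The first `j` iterations of a phase that starts from `λ⁰ = posterior S`: each queries the most
informative point twice. Returns the labels obtained. -/
def iterations (S : Sample X) : ℕ → QueryAlg X (Sample X)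
  | 0 => pure []
  | j + 1 => do
    let P ← iterations S j
    let x := nextQuery D Θ γ ε argmax S P
    let y₁ ← QueryAlg.ask x
    let y₂ ← QueryAlg.ask x
    pure ((x, y₂) :: (x, y₁) :: P)

/-- Query every point of a list twice. -/
def queryTwice {X : Type} : List X → QueryAlg X (Sample X)
  | [] => pure []
  | x :: xs => do
    let y₁ ← QueryAlg.ask x
    let y₂ ← QueryAlg.ask x
    let Y ← queryTwice xs
    pure ((x, y₁) :: (x, y₂) :: Y)

open Classical in
/-- The first `i` phases, with `M` iterations each. Returns the labels that have updated `λ`, and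
for each phase the labels that determine its last distribution `p_{(i, M + 1)}`. -/
def phases (M : ℕ) : ℕ → QueryAlg X (Sample X × List (Sample X))
  | 0 => pure ([], [])
  | i + 1 => do
    let (S, Ps) ← phases M i
    let P ← iterations D Θ γ ε argmax S M
    let Y ← queryTwice (P.map Prod.fst).dedup
    pure (Y ++ S, P :: Ps)

/-- The algorithm with `K` phases of `M` iterations; the output is the hypothesis of a parameter
drawn from `(1 / K) ∑ i, p_{(i, M + 1)}`. -/
def clippedActive (K M : ℕ) : QueryAlg X (Measure (X → ℝ)) := do
  let (_, Ps) ← phases D Θ γ ε argmax M K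
  pure (((K : ℝ≥0∞)⁻¹ • (Ps.map (posterior Θ γ)).sum).map (clippedHyp X γ))

end Algorithm

end ActiveLogistic

end

open ActiveLogistic

/-! Progress is measured by `mass`, the likelihood ratio against the true parameter integrated over
a set. Under true labels it is a martingale (`labelMean_mass`), so its square root is a
supermartingale. Querying a point twice multiplies the expected root by the Bhattacharyya
coefficient `affinity`. Two labels are needed: the law of one label only sees the mean of the
hypotheses at the point, that of two also sees the second moment. Hence the affinity stays away from
1 as soon as the hypotheses deviate in mean square from the truth there, even if their mean is
correct (`sq_integral_sub_sq_le`).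

Every query finds such a deviation. Any fixed output is `ε`-close to a hypothesis drawn from the
sampling law with probability at most 1/2, because the two candidates are `2ε` apart. An algorithm
that solves the problem with `m` queries must therefore behave differently on the drawn hypothesis
and on the mean hypothesis, which forces some point to have variance of order `1/m²`
(`le_numQueries_mul`, `exists_separating_of_solves`). With `L = log (1/γ)`, the informativeness lies
between half the variance and `6L` times the root mean square deviation from any value, in
particular from the true one. So at its maximizer the root mean square deviation from the truth is
at least of order `1/(m² L)`, under `λ⁰` or on average under the conditioned `p`, and one of the two
affinities is at most `1 - κ` with `κ` of order `m⁻⁸ L⁻⁴` (`affinity_le_or`).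

A phase wins either way. If `λ⁰` has small affinity at a queried point, the repeated queries at the
end of the phase lower the expected half log-mass by `κ` (`expect_log_mass_le`). Near the true
parameter the mass never drops below `exp (-B)` (`hasMassBound`), so this pays for `B/(2κ)` phases
in expectation. Otherwise every iteration shrinks a geometric mean of far masses by the factor `1 -
κ` (`labelMean_stoppedPotential_le`), and a tiny geometric mean forces `p` to put little mass on
errors above `8ε` (`failure_le`). `expect_phases_le` adds both effects; with `K = M` of order `B/κ`
the average failure probability is at most 0.01.

If all hypotheses are within `8ε` of each other there is nothing to prove. That the infimum `mStar`
is attained follows from running the same algorithm at accuracy `ε/9`, with separation derived from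
the spread of the sampled hypotheses alone. -/

noncomputable section

/-! ### Runs of interactive algorithms: expectations, query counts, change of the label law. -/

namespace ActiveLogistic

/-- The mean of `g` at a label that is `1` with probability `s`. -/
def labelMean (s : ℝ) (g : Bool → ℝ) : ℝ := s * g true + (1 - s) * g false

lemma labelMean_mono {s : ℝ} (h0 : 0 ≤ s) (h1 : s ≤ 1) {f g : Bool → ℝ} (h : ∀ y, f y ≤ g y) :
    labelMean s f ≤ labelMean s g := by
  have := mul_le_mul_of_nonneg_left (h true) h0
  have := mul_le_mul_of_nonneg_left (h false) (sub_nonneg.2 h1)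
  unfold labelMean; linarith

lemma labelMean_const (s c : ℝ) : labelMean s (fun _ => c) = c := by unfold labelMean; ring

lemma labelMean_const_mul (s c : ℝ) (f : Bool → ℝ) :
    labelMean s (fun y => c * f y) = c * labelMean s f := by unfold labelMean; ring

lemma labelMean_add (s : ℝ) (f g : Bool → ℝ) :
    labelMean s (fun y => f y + g y) = labelMean s f + labelMean s g := by unfold labelMean; ring

lemma labelMean_nonneg {s : ℝ} (h0 : 0 ≤ s) (h1 : s ≤ 1) {f : Bool → ℝ} (h : ∀ y, 0 ≤ f y) :
    0 ≤ labelMean s f := by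
  have := labelMean_mono h0 h1 h
  rwa [labelMean_const] at this

/-- Jensen's inequality for the square root and a two-point distribution. -/
lemma labelMean_sqrt_le {s : ℝ} (h0 : 0 ≤ s) (h1 : s ≤ 1) {f : Bool → ℝ} (hf : ∀ y, 0 ≤ f y) :
    labelMean s (fun y => √(f y)) ≤ √(labelMean s f) := by
  have := Real.strictConcaveOn_sqrt.concaveOn.2 (hf true) (hf false) h0 (sub_nonneg.2 h1) (by ring)
  simpa [labelMean] using this

namespace QueryAlg

variable {X α β : Type}

/-- The expectation of `f` at the result when labels are drawn according to `h`. -/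
def expect (h : X → ℝ) : QueryAlg X α → (α → ℝ) → ℝ
  | ret a, f => f a
  | coin p k, f => labelMean p fun b => expect h (k b) f
  | query x k, f => labelMean (h x) fun y => expect h (k y) f

lemma bind_eq (A : QueryAlg X α) (f : α → QueryAlg X β) : A >>= f = bind A f := rfl

lemma expect_bind (h : X → ℝ) (A : QueryAlg X α) (k : α → QueryAlg X β) (f : β → ℝ) :
    expect h (A >>= k) f = expect h A fun a => expect h (k a) f := by
  rw [bind_eq]
  induction A with
  | ret a => rfl
  | coin p c ih => simp only [bind, expect, ih]
  | query x c ih => simp only [bind, expect, ih]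

lemma expect_pure (h : X → ℝ) (a : α) (f : α → ℝ) : expect h (pure a : QueryAlg X α) f = f a := rfl

lemma expect_ask (h : X → ℝ) (x : X) (f : Bool → ℝ) : expect h (ask x) f = labelMean (h x) f := rfl

lemma allResults_true (A : QueryAlg X α) {P : α → Prop} (h : ∀ a, P a) : A.AllResults P := by
  induction A with
  | ret a => exact h a
  | coin p c ih => exact ⟨ih _, ih _⟩
  | query x c ih => exact ⟨ih _, ih _⟩

lemma allResults_mono {A : QueryAlg X α} {P Q : α → Prop} (h : ∀ a, P a → Q a)
    (hA : A.AllResults P) : A.AllResults Q := by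
  induction A with
  | ret a => exact h a hA
  | coin p c ih => exact ⟨ih _ hA.1, ih _ hA.2⟩
  | query x c ih => exact ⟨ih _ hA.1, ih _ hA.2⟩

lemma AllResults.bind {A : QueryAlg X α} {k : α → QueryAlg X β} {P : α → Prop} {Q : β → Prop}
    (hA : A.AllResults P) (hk : ∀ a, P a → (k a).AllResults Q) : (A >>= k).AllResults Q := by
  rw [bind_eq]
  induction A with
  | ret a => exact hk a hA
  | coin p c ih => exact ⟨ih _ hA.1, ih _ hA.2⟩
  | query x c ih => exact ⟨ih _ hA.1, ih _ hA.2⟩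

lemma expect_mono {h : X → ℝ} (h0 : ∀ x, 0 ≤ h x) (h1 : ∀ x, h x ≤ 1) {A : QueryAlg X α}
    {f g : α → ℝ} (hfg : A.AllResults fun a => f a ≤ g a) : expect h A f ≤ expect h A g := by
  induction A with
  | ret a => exact hfg
  | coin p c ih => exact labelMean_mono p.2.1 p.2.2 fun b => ih _ (by cases b; exacts [hfg.2, hfg.1])
  | query x c ih =>
    exact labelMean_mono (h0 x) (h1 x) fun b => ih _ (by cases b; exacts [hfg.2, hfg.1])

lemma expect_const (h : X → ℝ) (A : QueryAlg X α) (c : ℝ) : expect h A (fun _ => c) = c := by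
  induction A with
  | ret a => rfl
  | coin p k ih => simp only [expect, ih, labelMean_const]
  | query x k ih => simp only [expect, ih, labelMean_const]

lemma expect_add (h : X → ℝ) (A : QueryAlg X α) (f g : α → ℝ) :
    expect h A (fun a => f a + g a) = expect h A f + expect h A g := by
  induction A with
  | ret a => rfl
  | coin p k ih => simp only [expect, ih, labelMean_add]
  | query x k ih => simp only [expect, ih, labelMean_add]

lemma expect_const_mul (h : X → ℝ) (A : QueryAlg X α) (c : ℝ) (f : α → ℝ) :
    expect h A (fun a => c * f a) = c * expect h A f := by
  induction A with
  | ret a => rfl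
  | coin p k ih => simp only [expect, ih, labelMean_const_mul]
  | query x k ih => simp only [expect, ih, labelMean_const_mul]

lemma numQueries_bind_le {A : QueryAlg X α} {k : α → QueryAlg X β} {n : ℕ}
    (hk : A.AllResults fun a => (k a).numQueries ≤ n) :
    (A >>= k).numQueries ≤ A.numQueries + n := by
  rw [bind_eq]
  induction A with
  | ret a => exact (show (k a).numQueries ≤ n from hk).trans (Nat.le_add_left n 0 |>.trans_eq (by simp [numQueries]))
  | coin p c ih =>
    have := ih _ hk.1
    have := ih _ hk.2
    simp only [QueryAlg.bind, numQueries]; omega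
  | query x c ih =>
    have := ih _ hk.1
    have := ih _ hk.2
    simp only [QueryAlg.bind, numQueries]; omega

section OutputLaw

variable {Ω : Type} [MeasurableSpace Ω]

/-- Only a lower bound `g` on the success probability at each result is available, and `g` may be
negative; hence an inequality through `ENNReal.ofReal`. -/
lemma expect_le_outputLaw {h : X → ℝ} (h0 : ∀ x, 0 ≤ h x) (h1 : ∀ x, h x ≤ 1)
    {A : QueryAlg X α} {F : α → Measure Ω} {g : α → ℝ} {E : Set Ω}
    (hA : A.AllResults fun a => ENNReal.ofReal (g a) ≤ F a E) :
    ENNReal.ofReal (expect h A g) ≤ outputLaw h (A >>= fun a => pure (F a)) E := by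
  have key : ∀ (s : ℝ) (u : Bool → ℝ) (v : Bool → Measure Ω), 0 ≤ s → s ≤ 1 →
      (∀ b, ENNReal.ofReal (u b) ≤ v b E) → ENNReal.ofReal (labelMean s u) ≤
        (ENNReal.ofReal s • v true + ENNReal.ofReal (1 - s) • v false) E := by
    intro s u v hs0 hs1 huv
    simp only [Measure.add_apply, Measure.smul_apply, smul_eq_mul, labelMean]
    refine ENNReal.ofReal_add_le.trans ?_
    rw [ENNReal.ofReal_mul hs0, ENNReal.ofReal_mul (sub_nonneg.2 hs1)]
    gcongr
    · exact huv _
    · exact huv _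
  rw [bind_eq]
  induction A with
  | ret a => exact hA
  | coin p c ih =>
    exact key p _ (fun b => outputLaw h ((c b).bind fun a => pure (F a))) p.2.1 p.2.2
      fun b => ih _ (by cases b; exacts [hA.2, hA.1])
  | query x c ih =>
    exact key _ _ (fun b => outputLaw h ((c b).bind fun a => pure (F a))) (h0 x) (h1 x)
      fun b => ih _ (by cases b; exacts [hA.2, hA.1])

lemma outputLaw_isProbabilityMeasure {h : X → ℝ} (h0 : ∀ x, 0 ≤ h x) (h1 : ∀ x, h x ≤ 1)
    {A : QueryAlg X (Measure Ω)} (hA : A.AllResults fun ν => IsProbabilityMeasure ν) :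
    IsProbabilityMeasure (outputLaw h A) := by
  have key : ∀ (s : ℝ) (v : Bool → Measure Ω), 0 ≤ s → s ≤ 1 →
      (∀ b, IsProbabilityMeasure (v b)) → IsProbabilityMeasure
        (ENNReal.ofReal s • v true + ENNReal.ofReal (1 - s) • v false) := by
    intro s v hs0 hs1 hv
    constructor
    simp only [Measure.add_apply, Measure.smul_apply, smul_eq_mul, measure_univ, mul_one]
    rw [← ENNReal.ofReal_add hs0 (sub_nonneg.2 hs1)]; simp
  induction A with
  | ret a => exact hA
  | coin p c ih =>
    exact key p (fun b => outputLaw h (c b)) p.2.1 p.2.2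
      fun b => ih _ (by cases b; exacts [hA.2, hA.1])
  | query x c ih =>
    exact key _ (fun b => outputLaw h (c b)) (h0 x) (h1 x)
      fun b => ih _ (by cases b; exacts [hA.2, hA.1])

/-- The expected total discrepancy of `h` and `h'` along a run with labels drawn from `h'`. -/
def discrepancy (h' h : X → ℝ) : QueryAlg X α → ℝ
  | ret _ => 0
  | coin p k => labelMean p fun b => discrepancy h' h (k b)
  | query x k => |h x - h' x| + labelMean (h' x) fun y => discrepancy h' h (k y)

/-- Replacing the label law at one query costs the total variation distance of the two label laws.
The discrepancy is accumulated along the run with labels from `h'`, so the points visited do not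
depend on `h` and `h` can later be averaged. -/
lemma outputLaw_le_add_discrepancy {h h' : X → ℝ} (h0 : ∀ x, 0 ≤ h x) (h1 : ∀ x, h x ≤ 1)
    (h0' : ∀ x, 0 ≤ h' x) (h1' : ∀ x, h' x ≤ 1)
    {A : QueryAlg X (Measure Ω)} (hA : A.AllResults fun ν => IsProbabilityMeasure ν) (E : Set Ω) :
    (outputLaw h A).real E ≤ (outputLaw h' A).real E + discrepancy h' h A := by
  have key : ∀ (s : ℝ) (v : Bool → Measure Ω), 0 ≤ s → s ≤ 1 →
      (∀ b, IsProbabilityMeasure (v b)) →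
        (ENNReal.ofReal s • v true + ENNReal.ofReal (1 - s) • v false).real E =
          labelMean s fun b => (v b).real E := by
    intro s v hs0 hs1 hv
    simp only [Measure.real, Measure.add_apply, Measure.smul_apply, smul_eq_mul, labelMean]
    rw [ENNReal.toReal_add (by finiteness) (by finiteness), ENNReal.toReal_mul, ENNReal.toReal_mul,
      ENNReal.toReal_ofReal hs0, ENNReal.toReal_ofReal (sub_nonneg.2 hs1)]
  induction A with
  | ret a => simp [outputLaw, discrepancy]
  | coin p c ih =>
    have hp : ∀ b, (c b).AllResults fun ν => IsProbabilityMeasure ν := by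
      intro b; cases b; exacts [hA.2, hA.1]
    rw [outputLaw, outputLaw,
      key p (fun b => outputLaw h (c b)) p.2.1 p.2.2
        fun b => outputLaw_isProbabilityMeasure h0 h1 (hp b),
      key p (fun b => outputLaw h' (c b)) p.2.1 p.2.2
        fun b => outputLaw_isProbabilityMeasure h0' h1' (hp b), discrepancy, ← labelMean_add]
    exact labelMean_mono p.2.1 p.2.2 fun b => ih b (hp b)
  | query x c ih =>
    have hp : ∀ b, (c b).AllResults fun ν => IsProbabilityMeasure ν := by
      intro b; cases b; exacts [hA.2, hA.1]
    have hb : ∀ b, IsProbabilityMeasure (outputLaw h (c b)) :=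
      fun b => outputLaw_isProbabilityMeasure h0 h1 (hp b)
    rw [outputLaw, outputLaw,
      key (h x) (fun b => outputLaw h (c b)) (h0 x) (h1 x) hb,
      key (h' x) (fun b => outputLaw h' (c b)) (h0' x) (h1' x)
        fun b => outputLaw_isProbabilityMeasure h0' h1' (hp b), discrepancy]
    have e1 : labelMean (h x) (fun b => (outputLaw h (c b)).real E) ≤
        labelMean (h' x) (fun b => (outputLaw h (c b)).real E) + |h x - h' x| := by
      set a := (outputLaw h (c true)).real E
      set b := (outputLaw h (c false)).real E
      have ha0 : 0 ≤ a := measureReal_nonneg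
      have hb0 : 0 ≤ b := measureReal_nonneg
      have ha1 : a ≤ 1 := measureReal_le_one
      have hb1 : b ≤ 1 := measureReal_le_one
      have e : (h x - h' x) * (a - b) ≤ |h x - h' x| := by
        calc _ ≤ |(h x - h' x) * (a - b)| := le_abs_self _
          _ = |h x - h' x| * |a - b| := abs_mul _ _
          _ ≤ |h x - h' x| * 1 := by
              gcongr; rw [abs_le]; constructor <;> linarith
          _ = _ := mul_one _
      simp only [labelMean]; linarith
    have e2 := labelMean_mono (h0' x) (h1' x) fun b => ih b (hp b)
    rw [labelMean_add] at e2
    linarith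

/-- Since the run follows `h'`, the average over `t` can be taken query by query; each query
contributes at most `τ`. -/
lemma integrable_integral_discrepancy_le {T : Type*} [MeasurableSpace T] {ν : Measure T}
    {h' : X → ℝ} (h0' : ∀ x, 0 ≤ h' x) (h1' : ∀ x, h' x ≤ 1) {f : T → X → ℝ} {τ : ℝ} (hτ : 0 ≤ τ)
    (hf : ∀ x, Integrable (fun t => |f t x - h' x|) ν)
    (hfτ : ∀ x, ∫ t, |f t x - h' x| ∂ν ≤ τ) (A : QueryAlg X α) :
    Integrable (fun t => discrepancy h' (f t) A) ν ∧
      ∫ t, discrepancy h' (f t) A ∂ν ≤ A.numQueries * τ := by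
  have key : ∀ (s : ℝ) (u : Bool → T → ℝ) (n : Bool → ℕ), 0 ≤ s → s ≤ 1 →
      (∀ b, Integrable (u b) ν ∧ ∫ t, u b t ∂ν ≤ n b * τ) →
      Integrable (fun t => labelMean s fun b => u b t) ν ∧
        ∫ t, labelMean s (fun b => u b t) ∂ν ≤ (max (n true) (n false) : ℕ) * τ := by
    intro s u n hs0 hs1 hu
    have i1 := ((hu true).1.const_mul s)
    have i2 := ((hu false).1.const_mul (1 - s))
    refine ⟨i1.add i2, ?_⟩
    simp only [labelMean]
    rw [integral_add i1 i2, integral_const_mul, integral_const_mul]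
    have e : ∀ b, ∫ t, u b t ∂ν ≤ (max (n true) (n false) : ℕ) * τ := by
      intro b
      refine (hu b).2.trans (mul_le_mul_of_nonneg_right ?_ hτ)
      cases b <;> simp
    have := labelMean_mono hs0 hs1 e
    rw [labelMean_const] at this
    exact this
  induction A with
  | ret a => simp [discrepancy, numQueries]
  | coin p c ih => exact key p _ (fun b => (c b).numQueries) p.2.1 p.2.2 ih
  | query x c ih =>
    obtain ⟨i1, i2⟩ := key (h' x) _ (fun b => (c b).numQueries) (h0' x) (h1' x) ih
    refine ⟨(hf x).add i1, ?_⟩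
    simp only [discrepancy]
    rw [integral_add (hf x) i1, numQueries, Nat.cast_add, Nat.cast_one, add_mul, one_mul]
    exact add_le_add (hfτ x) i2

end OutputLaw

end QueryAlg

end ActiveLogistic

end

/-! ### Two-label affinity, and binary divergence against squared deviation. -/

noncomputable section

namespace ActiveLogistic

/-- The probability of the label `y` when the label is `1` with probability `p`. -/
def labelProb (p : ℝ) (y : Bool) : ℝ := if y then p else 1 - p

lemma labelProb_nonneg {p : ℝ} (h0 : 0 ≤ p) (h1 : p ≤ 1) (y : Bool) : 0 ≤ labelProb p y := by
  cases y <;> simp [labelProb, h0, h1]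

lemma labelProb_le_one {p : ℝ} (h0 : 0 ≤ p) (h1 : p ≤ 1) (y : Bool) : labelProb p y ≤ 1 := by
  cases y <;> simp [labelProb, h0, h1]

lemma weighted_cauchy_schwarz {α β : ℝ} (hα : 0 ≤ α) (hβ : 0 ≤ β) (p q r t : ℝ) :
    (α * p * r + β * q * t) ^ 2 ≤ (α * p ^ 2 + β * q ^ 2) * (α * r ^ 2 + β * t ^ 2) := by
  have : 0 ≤ α * β * (p * t - q * r) ^ 2 := by positivity
  linarith [show (α * p ^ 2 + β * q ^ 2) * (α * r ^ 2 + β * t ^ 2) - (α * p * r + β * q * t) ^ 2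
    = α * β * (p * t - q * r) ^ 2 by ring]

/-- With weights `s²`, `2s(1-s)`, `(1-s)²`, the squares of `u, v, w` average to 1 and `u, v, w`
average to the affinity `B`, so the weighted squares of `u-1, v-1, w-1` sum to `2(1-B)`. The
left-hand base is a combination of `u²-1` and `v²-1`; splitting off `u-1` and `v-1` by
Cauchy–Schwarz leaves a factor of at most 16. -/
lemma affinity_algebra {s a b u v w : ℝ} (hs0 : 0 < s) (hs1 : s < 1) (hu : 0 ≤ u) (hv : 0 ≤ v)
    (hw : 0 ≤ w) (hb : b = s ^ 2 * u ^ 2) (ha : a = s ^ 2 * u ^ 2 + s * (1 - s) * v ^ 2)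
    (hsum : s ^ 2 * u ^ 2 + 2 * (s * (1 - s) * v ^ 2) + (1 - s) ^ 2 * w ^ 2 = 1) :
    (b - 2 * s * a + s ^ 2) ^ 2 ≤
      32 * (1 - (s * (s * u + (1 - s) * v) + (1 - s) * (s * v + (1 - s) * w))) := by
  have hs1' : 0 < 1 - s := sub_pos.2 hs1
  set B := s * (s * u + (1 - s) * v) + (1 - s) * (s * v + (1 - s) * w) with hB
  have d1 : s ^ 2 * (u - 1) ^ 2 + 2 * (s * (1 - s) * (v - 1) ^ 2) + (1 - s) ^ 2 * (w - 1) ^ 2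
      = 2 * (1 - B) := by rw [hB]; linear_combination hsum
  have d2 : s ^ 2 * (u + 1) ^ 2 + 2 * (s * (1 - s) * (v + 1) ^ 2) + (1 - s) ^ 2 * (w + 1) ^ 2
      = 2 * (1 + B) := by rw [hB]; linear_combination hsum
  have p1 : 0 ≤ s * (1 - s) := by positivity
  have f1 : s ^ 2 * (u - 1) ^ 2 + s * (1 - s) * (v - 1) ^ 2 ≤ 2 * (1 - B) := by
    have : 0 ≤ s * (1 - s) * (v - 1) ^ 2 := by positivity
    have : 0 ≤ (1 - s) ^ 2 * (w - 1) ^ 2 := by positivity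
    linarith
  have hB1 : B ≤ 1 := by
    have : 0 ≤ s ^ 2 * (u - 1) ^ 2 + s * (1 - s) * (v - 1) ^ 2 := by positivity
    linarith
  have f2 : s ^ 2 * ((1 - 2 * s) * (u + 1)) ^ 2 + s * (1 - s) * (-(2 * s) * (v + 1)) ^ 2
      ≤ 16 := by
    have g1 : 0 ≤ s ^ 2 * (u + 1) ^ 2 := by positivity
    have g2 : 0 ≤ s * (1 - s) * (v + 1) ^ 2 := by positivity
    have g3 : 0 ≤ (1 - s) ^ 2 * (w + 1) ^ 2 := by positivity
    have h1 : (1 - 2 * s) ^ 2 ≤ 4 := by nlinarith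
    have h2 : (2 * s) ^ 2 ≤ 4 := by nlinarith
    have := mul_le_mul_of_nonneg_right h1 g1
    have := mul_le_mul_of_nonneg_right h2 g2
    linarith
  have e : b - 2 * s * a + s ^ 2 = s ^ 2 * (u - 1) * ((1 - 2 * s) * (u + 1)) +
      s * (1 - s) * (v - 1) * (-(2 * s) * (v + 1)) := by
    rw [ha, hb]; ring
  rw [e]
  calc _ ≤ _ := weighted_cauchy_schwarz (sq_nonneg s) p1 _ _ _ _
    _ ≤ (2 * (1 - B)) * 16 := by
        apply mul_le_mul f1 f2 (by positivity) (by linarith)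
    _ = _ := by ring

section Integrals

variable {T : Type*} [MeasurableSpace T] {ν : Measure T}

lemma integrable_of_bounds [IsFiniteMeasure ν] {f : T → ℝ} (hf : Measurable f) {a b : ℝ}
    (ha : ∀ t, a ≤ f t) (hb : ∀ t, f t ≤ b) : Integrable f ν :=
  Integrable.of_bound hf.aestronglyMeasurable (max |a| |b|)
    (Filter.Eventually.of_forall fun t => abs_le_max_abs_abs (ha t) (hb t))

/-- The Bhattacharyya coefficient of two independent labels with probability `s`, and of two labels
whose common probability `f t` is drawn with `t` from `ν`. -/
def affinity (s : ℝ) (f : T → ℝ) (ν : Measure T) : ℝ :=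
  labelMean s fun y => labelMean s fun z =>
    √(∫ t, labelProb (f t) y / labelProb s y * (labelProb (f t) z / labelProb s z) ∂ν)

/-- The four label pairs have likelihood ratios determined by the first two moments of `f`, and the
deviation from `s` is a combination of the same moments. -/
lemma sq_integral_sub_sq_le [IsProbabilityMeasure ν] {s : ℝ} (hs0 : 0 < s) (hs1 : s < 1)
    {f : T → ℝ} (hf : Measurable f) (hf0 : ∀ t, 0 ≤ f t) (hf1 : ∀ t, f t ≤ 1) :
    (∫ t, (f t - s) ^ 2 ∂ν) ^ 2 ≤ 32 * (1 - affinity s f ν) := by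
  have hs1' : 0 < 1 - s := sub_pos.2 hs1
  have i1 : Integrable f ν := integrable_of_bounds hf hf0 hf1
  have i2 : Integrable (fun t => f t ^ 2) ν :=
    integrable_of_bounds (hf.pow_const 2) (fun t => sq_nonneg _)
      fun t => pow_le_one₀ (hf0 t) (hf1 t)
  set a := ∫ t, f t ∂ν with ha
  set b := ∫ t, f t ^ 2 ∂ν with hb
  have hba : b ≤ a := integral_mono i2 i1 fun t => by
    have := hf0 t; have := hf1 t; simp only; nlinarith
  have hb0 : 0 ≤ b := integral_nonneg fun t => sq_nonneg _
  have hab : 2 * a - b ≤ 1 := by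
    have : ∫ t, (2 * f t - f t ^ 2) ∂ν ≤ ∫ _, (1 : ℝ) ∂ν :=
      integral_mono ((i1.const_mul 2).sub i2) (integrable_const _) fun t => by
        simp only; nlinarith [sq_nonneg (f t - 1)]
    rw [integral_sub (i1.const_mul 2) i2, integral_const_mul] at this
    simpa using this
  have quad : ∀ c₀ c₁ c₂ : ℝ, ∫ t, (c₀ + c₁ * f t + c₂ * f t ^ 2) ∂ν = c₀ + c₁ * a + c₂ * b := by
    intro c₀ c₁ c₂
    have j1 : Integrable (fun t => c₀ + c₁ * f t) ν := (integrable_const _).add (i1.const_mul _)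
    rw [integral_add j1 (i2.const_mul _), integral_add (integrable_const _) (i1.const_mul _),
      integral_const_mul, integral_const_mul]
    simp [ha, hb]
  have e0 : ∫ t, (f t - s) ^ 2 ∂ν = b - 2 * s * a + s ^ 2 := by
    rw [show b - 2 * s * a + s ^ 2 = s ^ 2 + -(2 * s) * a + 1 * b by ring, ← quad]
    congr 1; ext t; ring
  have e1 : ∫ t, labelProb (f t) true / labelProb s true *
      (labelProb (f t) true / labelProb s true) ∂ν = b / s ^ 2 := by
    rw [hb, ← integral_div]; congr 1; ext t; simp [labelProb]; field_simp
  have e2 : ∫ t, labelProb (f t) true / labelProb s true *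
      (labelProb (f t) false / labelProb s false) ∂ν = (a - b) / (s * (1 - s)) := by
    rw [ha, hb, ← integral_sub i1 i2, ← integral_div]; congr 1; ext t; simp [labelProb]; field_simp
  have e3 : ∫ t, labelProb (f t) false / labelProb s false *
      (labelProb (f t) true / labelProb s true) ∂ν = (a - b) / (s * (1 - s)) := by
    rw [← e2]; congr 1; ext t; ring
  have e4 : ∫ t, labelProb (f t) false / labelProb s false *
      (labelProb (f t) false / labelProb s false) ∂ν = (1 - 2 * a + b) / (1 - s) ^ 2 := by
    rw [show 1 - 2 * a + b = 1 + -2 * a + 1 * b by ring, ← quad, ← integral_div]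
    congr 1; ext t; simp [labelProb]; field_simp; ring
  simp only [affinity, labelMean, e1, e2, e3, e4]
  rw [e0]
  have q1 := Real.sq_sqrt (show 0 ≤ b / s ^ 2 by positivity)
  have q2 := Real.sq_sqrt (show 0 ≤ (a - b) / (s * (1 - s)) from
    div_nonneg (sub_nonneg.2 hba) (by positivity))
  have q3 := Real.sq_sqrt (show 0 ≤ (1 - 2 * a + b) / (1 - s) ^ 2 from
    div_nonneg (by linarith) (by positivity))
  have n1 := Real.sqrt_nonneg (b / s ^ 2)
  have n2 := Real.sqrt_nonneg ((a - b) / (s * (1 - s)))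
  have n3 := Real.sqrt_nonneg ((1 - 2 * a + b) / (1 - s) ^ 2)
  set u := √(b / s ^ 2)
  set v := √((a - b) / (s * (1 - s)))
  set w := √((1 - 2 * a + b) / (1 - s) ^ 2)
  have hbu : b = s ^ 2 * u ^ 2 := by rw [q1]; field_simp
  have hav : a - b = s * (1 - s) * v ^ 2 := by rw [q2]; field_simp
  have hw : 1 - 2 * a + b = (1 - s) ^ 2 * w ^ 2 := by rw [q3]; field_simp
  clear_value a b u v w
  refine affinity_algebra hs0 hs1 n1 n2 n3 hbu (by linarith) (by linarith)

lemma sq_integral_le_integral_sq [IsProbabilityMeasure ν] {f : T → ℝ} (hf : Integrable f ν)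
    (hf2 : Integrable (fun t => f t ^ 2) ν) : (∫ t, f t ∂ν) ^ 2 ≤ ∫ t, f t ^ 2 ∂ν := by
  set a := ∫ t, f t ∂ν with ha
  have : ∫ t, (2 * a * f t - a ^ 2) ∂ν ≤ ∫ t, f t ^ 2 ∂ν :=
    integral_mono ((hf.const_mul _).sub (integrable_const _)) hf2 fun t => by
      simp only; nlinarith [sq_nonneg (f t - a)]
  rw [integral_sub (hf.const_mul _) (integrable_const _), integral_const_mul, ← ha] at this
  simp at this
  linarith

/-- Jensen for `exp`: the geometric mean is at most the arithmetic mean, applied to `√u`. The bounds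
on `u` only serve integrability. -/
lemma exp_integral_log_le [IsProbabilityMeasure ν] {u : T → ℝ} (hu : Measurable u) {c C : ℝ}
    (hc : 0 < c) (hcu : ∀ t, c ≤ u t) (huC : ∀ t, u t ≤ C) :
    Real.exp ((∫ t, Real.log (u t) ∂ν) / 2) ≤ ∫ t, √(u t) ∂ν := by
  have hpos : ∀ t, 0 < u t := fun t => hc.trans_le (hcu t)
  have il : Integrable (fun t => Real.log (u t) / 2) ν :=
    (integrable_of_bounds (Real.measurable_log.comp hu)
      (fun t => Real.log_le_log hc (hcu t)) fun t => Real.log_le_log (hpos t) (huC t)).div_const 2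
  have e : ∀ t, Real.exp (Real.log (u t) / 2) = √(u t) := fun t => by
    rw [Real.exp_half, Real.exp_log (hpos t)]
  have is : Integrable (fun t => √(u t)) ν :=
    integrable_of_bounds hu.sqrt (fun t => Real.sqrt_nonneg _) fun t => Real.sqrt_le_sqrt (huC t)
  have := convexOn_exp.map_integral_le Real.continuous_exp.continuousOn isClosed_univ (μ := ν)
    (f := fun t => Real.log (u t) / 2) (by simp) il
      (by simpa only [Function.comp_def, e] using is)
  simp only [e, integral_div] at this
  exact this

end Integrals

section BinaryKL

lemma binaryKL_one_sub (p q : ℝ) : binaryKL (1 - p) (1 - q) = binaryKL p q := by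
  simp only [binaryKL, sub_sub_cancel]; ring

/-- The divergence dominates the squared Hellinger distance, by `log t ≤ t - 1` at `t = √q/√p`, and
`(p-q)² = (√p+√q)²(√p-√q)² ≤ 4(√p-√q)²`, likewise for the complements. -/
lemma le_binaryKL {p q : ℝ} (hp0 : 0 < p) (hp1 : p < 1) (hq0 : 0 < q) (hq1 : q < 1) :
    (p - q) ^ 2 / 2 ≤ binaryKL p q := by
  have key : ∀ p q : ℝ, 0 < p → 0 < q → 2 * p - 2 * (√p * √q) ≤ p * Real.log (p / q) := by
    intro p q hp hq
    have hp' := Real.sqrt_pos.2 hp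
    have hq' := Real.sqrt_pos.2 hq
    have h1 := Real.log_le_sub_one_of_pos (div_pos hq' hp')
    have h2 : Real.log (p / q) = -2 * Real.log (√q / √p) := by
      rw [Real.log_div hp.ne' hq.ne', Real.log_div hq'.ne' hp'.ne', Real.log_sqrt hp.le,
        Real.log_sqrt hq.le]; ring
    rw [h2]
    have h3 : p * (√q / √p) = √p * √q := by
      nth_rw 1 [← Real.mul_self_sqrt hp.le]; field_simp
    nlinarith
  have k1 := key p q hp0 hq0
  have k2 := key (1 - p) (1 - q) (by linarith) (by linarith)
  have s1 := Real.sq_sqrt hp0.le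
  have s2 := Real.sq_sqrt hq0.le
  have s3 := Real.sq_sqrt (sub_pos.2 hp1).le
  have s4 := Real.sq_sqrt (sub_pos.2 hq1).le
  have b1 : √p ≤ 1 := Real.sqrt_le_one.2 hp1.le
  have b2 : √q ≤ 1 := Real.sqrt_le_one.2 hq1.le
  have b3 : √(1 - p) ≤ 1 := Real.sqrt_le_one.2 (by linarith)
  have b4 : √(1 - q) ≤ 1 := Real.sqrt_le_one.2 (by linarith)
  have c1 := Real.sqrt_nonneg p
  have c2 := Real.sqrt_nonneg q
  have c3 := Real.sqrt_nonneg (1 - p)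
  have c4 := Real.sqrt_nonneg (1 - q)
  have key2 : ∀ a b : ℝ, 0 ≤ a → 0 ≤ b → a ≤ 1 → b ≤ 1 → (a ^ 2 - b ^ 2) ^ 2 ≤ 4 * (a - b) ^ 2 := by
    intro a b ha hb ha1 hb1
    have : (a ^ 2 - b ^ 2) ^ 2 = (a + b) ^ 2 * (a - b) ^ 2 := by ring
    rw [this]
    exact mul_le_mul_of_nonneg_right (by nlinarith) (sq_nonneg _)
  have m1 := key2 _ _ c1 c2 b1 b2
  have m2 := key2 _ _ c3 c4 b3 b4
  rw [s1, s2] at m1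
  rw [s3, s4] at m2
  unfold binaryKL
  nlinarith

/-- Complementing both arguments reduces to `q ≤ p`, where the second summand is nonpositive. If `p
≤ 2q`, then `log t ≤ t - 1` gives `2(p-q)`; if `p ≥ 2q`, then `p ≤ 2(p-q)` and the logarithm is at
most `log (1/γ)`. -/
lemma binaryKL_le {γ p q : ℝ} (hγ : 0 < γ) (hγ2 : γ < 1 / 2) (hp : p ∈ Set.Icc γ (1 - γ))
    (hq : q ∈ Set.Icc γ (1 - γ)) : binaryKL p q ≤ 3 * Real.log (1 / γ) * |p - q| := by
  have hL : 2 / 3 ≤ Real.log (1 / γ) := by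
    have : Real.log 2 ≤ Real.log (1 / γ) :=
      Real.log_le_log (by norm_num) (by rw [le_div_iff₀ hγ]; linarith)
    linarith [Real.log_two_gt_d9]
  have key : ∀ p q : ℝ, p ∈ Set.Icc γ (1 - γ) → q ∈ Set.Icc γ (1 - γ) → q ≤ p →
      binaryKL p q ≤ 3 * Real.log (1 / γ) * |p - q| := by
    intro p q hp hq hqp
    have hp0 : 0 < p := hγ.trans_le hp.1
    have hq0 : 0 < q := hγ.trans_le hq.1
    have hp1 : 0 < 1 - p := by linarith [hp.2]
    have hq1 : 0 < 1 - q := by linarith [hq.2]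
    rw [abs_of_nonneg (sub_nonneg.2 hqp)]
    have h2 : (1 - p) * Real.log ((1 - p) / (1 - q)) ≤ 0 :=
      mul_nonpos_of_nonneg_of_nonpos hp1.le
        (Real.log_nonpos (by positivity) ((div_le_one hq1).2 (by linarith)))
    suffices h : p * Real.log (p / q) ≤ 3 * Real.log (1 / γ) * (p - q) by
      unfold binaryKL; linarith
    rcases le_total p (2 * q) with h | h
    · have h3 := Real.log_le_sub_one_of_pos (div_pos hp0 hq0)
      have h4 : p * (p / q - 1) ≤ 2 * (p - q) := by
        have : p * (p / q - 1) = (p / q) * (p - q) := by field_simp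
        rw [this]
        exact mul_le_mul_of_nonneg_right ((div_le_iff₀ hq0).2 h) (by linarith)
      have h5 := mul_le_mul_of_nonneg_left h3 hp0.le
      nlinarith
    · have h3 : Real.log (p / q) ≤ Real.log (1 / γ) :=
        Real.log_le_log (by positivity)
          (div_le_div₀ zero_le_one (by linarith [hp.2]) hγ hq.1)
      have := mul_le_mul_of_nonneg_left h3 hp0.le
      nlinarith
  rcases le_total q p with h | h
  · exact key p q hp hq h
  · have := key (1 - p) (1 - q) ⟨by linarith [hp.2], by linarith [hp.1]⟩
      ⟨by linarith [hq.2], by linarith [hq.1]⟩ (by linarith)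
    rw [binaryKL_one_sub] at this
    convert this using 2
    rw [← abs_neg]; congr 1; ring

variable {T : Type*} [MeasurableSpace T] {ν : Measure T} [IsProbabilityMeasure ν] {f : T → ℝ}
  {γ : ℝ}

lemma integral_mem_Icc (hf : Measurable f) {a b : ℝ} (hfm : ∀ t, f t ∈ Set.Icc a b) :
    ∫ t, f t ∂ν ∈ Set.Icc a b := by
  have i := integrable_of_bounds (ν := ν) hf (fun t => (hfm t).1) fun t => (hfm t).2
  constructor
  · simpa using integral_mono (integrable_const a) i fun t => (hfm t).1
  · simpa using integral_mono i (integrable_const b) fun t => (hfm t).2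

lemma integrable_binaryKL (hγ : 0 < γ) (hγ2 : γ < 1 / 2) (hf : Measurable f)
    (hfm : ∀ t, f t ∈ Set.Icc γ (1 - γ)) {p : ℝ} (hp : p ∈ Set.Icc γ (1 - γ)) :
    Integrable (fun t => binaryKL p (f t)) ν := by
  have hm : Measurable fun t => binaryKL p (f t) := by unfold binaryKL; fun_prop
  refine integrable_of_bounds hm (a := 0) (b := 3 * Real.log (1 / γ) * 1) (fun t => ?_) fun t => ?_
  · exact (by positivity : 0 ≤ (p - f t) ^ 2 / 2).trans (le_binaryKL (hγ.trans_le hp.1)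
      (by linarith [hp.2]) (hγ.trans_le (hfm t).1) (by linarith [(hfm t).2]))
  · refine (binaryKL_le hγ hγ2 hp (hfm t)).trans ?_
    have : 0 ≤ Real.log (1 / γ) := Real.log_nonneg (by rw [le_div_iff₀ hγ]; linarith)
    gcongr
    rw [abs_le]
    constructor <;> linarith [hp.1, hp.2, (hfm t).1, (hfm t).2]

lemma integral_sq_le_integral_binaryKL (hγ : 0 < γ) (hγ2 : γ < 1 / 2) (hf : Measurable f)
    (hfm : ∀ t, f t ∈ Set.Icc γ (1 - γ)) :
    (∫ t, (f t - ∫ t', f t' ∂ν) ^ 2 ∂ν) / 2 ≤ ∫ t, binaryKL (∫ t', f t' ∂ν) (f t) ∂ν := by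
  have hp := integral_mem_Icc (ν := ν) hf hfm
  set p := ∫ t', f t' ∂ν
  rw [← integral_div]
  refine integral_mono_of_nonneg (Filter.Eventually.of_forall fun t => by positivity)
    (integrable_binaryKL hγ hγ2 hf hfm hp) (Filter.Eventually.of_forall fun t => ?_)
  simp only
  rw [← neg_sub, neg_sq]
  exact le_binaryKL (hγ.trans_le hp.1)
      (by linarith [hp.2]) (hγ.trans_le (hfm t).1) (by linarith [(hfm t).2])

/-- The centre `s` is arbitrary, so it can be the true label probability. Both `f` and its mean are
within `v` of `s` in mean, which gives `3 log (1/γ)` times `2v`. -/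
lemma integral_binaryKL_le (hγ : 0 < γ) (hγ2 : γ < 1 / 2) (hf : Measurable f)
    (hfm : ∀ t, f t ∈ Set.Icc γ (1 - γ)) {s v : ℝ} (hv : 0 ≤ v)
    (h : ∫ t, (f t - s) ^ 2 ∂ν ≤ v ^ 2) :
    ∫ t, binaryKL (∫ t', f t' ∂ν) (f t) ∂ν ≤ 6 * Real.log (1 / γ) * v := by
  have hp := integral_mem_Icc (ν := ν) hf hfm
  have hL : 0 ≤ Real.log (1 / γ) := Real.log_nonneg (by rw [le_div_iff₀ hγ]; linarith)
  have i0 := integrable_of_bounds (ν := ν) hf (fun t => (hfm t).1) fun t => (hfm t).2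
  have i1 : Integrable (fun t => f t - s) ν := i0.sub (integrable_const _)
  have i2 : Integrable (fun t => |f t - s|) ν := i1.abs
  have i3 : Integrable (fun t => |f t - s| ^ 2) ν := by
    simp only [sq_abs]
    have hb : ∀ t, |f t - s| ≤ 1 + |s| := fun t => by
      refine (abs_sub _ _).trans ?_
      have : |f t| ≤ 1 := abs_le.2 ⟨by linarith [(hfm t).1], by linarith [(hfm t).2]⟩
      linarith
    exact integrable_of_bounds ((hf.sub_const s).pow_const 2) (fun t => sq_nonneg _)
      fun t => sq_le_sq' (abs_le.1 (hb t)).1 (abs_le.1 (hb t)).2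
  have h1 : ∫ t, |f t - s| ∂ν ≤ v := by
    have := sq_integral_le_integral_sq i2 i3
    simp only [sq_abs] at this
    exact (sq_le_sq₀ (integral_nonneg fun t => abs_nonneg _) hv).1 (this.trans h)
  have h2 : |(∫ t', f t' ∂ν) - s| ≤ v := by
    have : (∫ t', f t' ∂ν) - s = ∫ t', (f t' - s) ∂ν := by
      rw [integral_sub i0 (integrable_const _)]; simp
    rw [this]
    exact (abs_integral_le_integral_abs).trans h1
  set p := ∫ t', f t' ∂ν
  calc ∫ t, binaryKL p (f t) ∂ν ≤ ∫ t, 3 * Real.log (1 / γ) * (|f t - s| + v) ∂ν := by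
        refine integral_mono (integrable_binaryKL hγ hγ2 hf hfm hp)
          ((i2.add (integrable_const _)).const_mul _) fun t => ?_
        refine (binaryKL_le hγ hγ2 hp (hfm t)).trans ?_
        gcongr
        calc |p - f t| = |(p - s) - (f t - s)| := by ring_nf
          _ ≤ |p - s| + |f t - s| := abs_sub _ _
          _ ≤ _ := by linarith
    _ = 3 * Real.log (1 / γ) * ((∫ t, |f t - s| ∂ν) + v) := by
        rw [integral_const_mul, integral_add i2 (integrable_const _)]; simp
    _ ≤ _ := by nlinarith

end BinaryKL

end ActiveLogistic

end

/-! ### Regularity of the clipped hypotheses, the `ℓ²`-distance, weights, and the volume of small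
balls. -/

noncomputable section

namespace ActiveLogistic

section Clip

lemma clip_mem_Icc {γ : ℝ} (hγ2 : γ < 1 / 2) (z : ℝ) : clip z γ ∈ Set.Icc γ (1 - γ) :=
  ⟨le_min (le_max_right _ _) (by linarith), min_le_right _ _⟩

lemma one_sub_clip {γ : ℝ} (hγ2 : γ < 1 / 2) (z : ℝ) : 1 - clip z γ = clip (1 - z) γ := by
  unfold clip
  rcases le_total z γ with h | h <;> rcases le_total z (1 - γ) with h' | h' <;>
    simp [max_def, min_def] <;> split_ifs <;> linarith

lemma abs_clip_sub_clip_le (a b γ : ℝ) : |clip a γ - clip b γ| ≤ |a - b| := by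
  unfold clip
  have h1 := abs_min_sub_min_le_max (max a γ) (1 - γ) (max b γ) (1 - γ)
  have h2 := abs_max_sub_max_le_max a γ b γ
  rw [sub_self, abs_zero, max_eq_left (abs_nonneg (max a γ - max b γ))] at h1
  rw [sub_self, abs_zero, max_eq_left (abs_nonneg (a - b))] at h2
  exact h1.trans h2

lemma abs_sigmoid_sub_sigmoid_le (a b : ℝ) :
    |Real.sigmoid a - Real.sigmoid b| ≤ |a - b| / 4 := by
  have := (lipschitzWith_of_nnnorm_deriv_le (C := 1 / 4) differentiable_sigmoid fun x => by
    rw [← NNReal.coe_le_coe, coe_nnnorm, Real.deriv_sigmoid, Real.norm_eq_abs, abs_of_nonneg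
      (mul_nonneg (Real.sigmoid_nonneg x) (sub_nonneg.2 (Real.sigmoid_le_one x)))]
    push_cast
    nlinarith [sq_nonneg (Real.sigmoid x - 1 / 2)]).dist_le_mul a b
  simp only [Real.dist_eq] at this
  push_cast at this
  linarith

lemma exp_neg_mul_sigmoid_le (a b : ℝ) :
    Real.exp (-|a - b|) * Real.sigmoid a ≤ Real.sigmoid b := by
  rw [Real.sigmoid_def, Real.sigmoid_def, Real.exp_neg, ← mul_inv]
  apply inv_anti₀ (by positivity)
  have h1 : 1 ≤ Real.exp |a - b| := Real.one_le_exp (abs_nonneg _)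
  have h2 : Real.exp (-b) ≤ Real.exp |a - b| * Real.exp (-a) := by
    rw [← Real.exp_add]; exact Real.exp_le_exp.2 (by linarith [neg_abs_le (a - b), le_abs_self (a - b)])
  linarith

/-- The logarithm of the sigmoid is 1-Lipschitz, and taking a maximum or minimum with a positive
constant preserves this. Unlike a Lipschitz bound on the hypothesis itself, this controls likelihood
ratios without a factor `1/γ`. -/
lemma exp_neg_mul_clip_le {γ : ℝ} (hγ : 0 < γ) (hγ2 : γ < 1 / 2) (a b : ℝ) :
    Real.exp (-|a - b|) * clip (Real.sigmoid a) γ ≤ clip (Real.sigmoid b) γ := by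
  have h1 : Real.exp (-|a - b|) ≤ 1 := Real.exp_le_one_iff.2 (by simp)
  have h0 := (Real.exp_pos (-|a - b|)).le
  unfold clip
  refine le_min ?_ ?_
  · refine (mul_le_mul_of_nonneg_left (min_le_left _ _) h0).trans ?_
    rw [mul_max_of_nonneg _ _ h0]
    exact max_le_max (exp_neg_mul_sigmoid_le a b) (by nlinarith)
  · refine (mul_le_mul_of_nonneg_left (min_le_right _ _) h0).trans (by nlinarith)

lemma exp_neg_mul_labelProb_clip_le {γ : ℝ} (hγ : 0 < γ) (hγ2 : γ < 1 / 2) (a b : ℝ) (y : Bool) :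
    Real.exp (-|a - b|) * labelProb (clip (Real.sigmoid a) γ) y ≤
      labelProb (clip (Real.sigmoid b) γ) y := by
  cases y
  · simp only [labelProb, one_sub_clip hγ2, ← Real.sigmoid_neg, Bool.false_eq_true, if_false]
    have := exp_neg_mul_clip_le hγ hγ2 (-a) (-b)
    rwa [show |(-a) - (-b)| = |a - b| by rw [← abs_neg]; congr 1; ring] at this
  · exact exp_neg_mul_clip_le hγ hγ2 a b

end Clip

section L2Dist

variable {X : Type} [Fintype X] (D : PMF X)

lemma l2Dist_eq_norm (h₁ h₂ : X → ℝ) : l2Dist D h₁ h₂ =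
    ‖(WithLp.toLp 2 fun x => √(D x).toReal * (h₁ x - h₂ x) : EuclideanSpace ℝ X)‖ := by
  rw [EuclideanSpace.norm_eq, l2Dist]
  congr 1
  refine Finset.sum_congr rfl fun x _ => ?_
  simp [mul_pow, Real.sq_sqrt]

lemma l2Dist_comm (h₁ h₂ : X → ℝ) : l2Dist D h₁ h₂ = l2Dist D h₂ h₁ := by
  unfold l2Dist; congr 1; refine Finset.sum_congr rfl fun x _ => by ring

lemma l2Dist_triangle (h₁ h₂ h₃ : X → ℝ) : l2Dist D h₁ h₃ ≤ l2Dist D h₁ h₂ + l2Dist D h₂ h₃ := by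
  simp only [l2Dist_eq_norm]
  refine le_trans (le_of_eq ?_) (norm_add_le _ _)
  congr 1; ext x; simp; ring

lemma sum_toReal_pmf : ∑ x, (D x).toReal = 1 := by
  rw [← ENNReal.toReal_sum fun x _ => D.apply_ne_top x, ← tsum_fintype (L := .unconditional _),
    D.tsum_coe, ENNReal.toReal_one]

lemma l2Dist_le_of_forall_abs_le {h₁ h₂ : X → ℝ} {c : ℝ} (hc : 0 ≤ c)
    (h : ∀ x, |h₁ x - h₂ x| ≤ c) : l2Dist D h₁ h₂ ≤ c := by
  refine Real.sqrt_le_iff.2 ⟨hc, ?_⟩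
  calc _ ≤ ∑ x, (D x).toReal * c ^ 2 := by
        refine Finset.sum_le_sum fun x _ => mul_le_mul_of_nonneg_left ?_ ENNReal.toReal_nonneg
        rw [← sq_abs]
        exact pow_le_pow_left₀ (abs_nonneg _) (h x) 2
    _ = c ^ 2 := by rw [← Finset.sum_mul, sum_toReal_pmf, one_mul]

lemma sq_l2Dist (h₁ h₂ : X → ℝ) :
    l2Dist D h₁ h₂ ^ 2 = ∑ x, (D x).toReal * (h₁ x - h₂ x) ^ 2 :=
  Real.sq_sqrt (Finset.sum_nonneg fun x _ => by positivity)

lemma continuous_l2Dist : Continuous fun p : (X → ℝ) × (X → ℝ) => l2Dist D p.1 p.2 := by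
  unfold l2Dist; fun_prop

end L2Dist

section Weight

variable {X : Type}

lemma weight_nil (h : X → ℝ) : weight [] h = 1 := rfl

lemma weight_cons {h : X → ℝ} {x : X} (h0 : 0 < h x) (h1 : h x < 1) (y : Bool) (S : Sample X) :
    weight ((x, y) :: S) h = labelProb (h x) y * weight S h := by
  simp only [weight, List.map_cons, List.prod_cons]
  congr 1
  have : 0 < 1 - h x := sub_pos.2 h1
  cases y <;> simp [crossEntropy, labelProb, Real.exp_log, *]

lemma weight_perm {S S' : Sample X} (hS : S.Perm S') (h : X → ℝ) : weight S h = weight S' h :=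
  (hS.map _).prod_eq

lemma weight_pos (S : Sample X) (h : X → ℝ) : 0 < weight S h :=
  List.prod_pos (by simp only [List.mem_map]; rintro _ ⟨s, -, rfl⟩; exact Real.exp_pos _)

end Weight

section Setting

/-- The standing assumptions on the data and the parameters. -/
structure IsSetting {d : ℕ} (X : Finset (Vec d)) (Θ : Set (Vec d)) (R₁ R₂ γ : ℝ) : Prop where
  convex : Convex ℝ Θ
  volume_ne_zero : volume Θ ≠ 0
  one_le_left : 1 ≤ R₁
  norm_param_le : ∀ θ ∈ Θ, ‖θ‖ ≤ R₁
  one_le_right : 1 ≤ R₂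
  norm_data_le : ∀ x ∈ X, ‖x‖ ≤ R₂
  pos : 0 < γ
  lt_half : γ < 1 / 2

variable {d : ℕ} {X : Finset (Vec d)} {Θ : Set (Vec d)} {R₁ R₂ γ : ℝ}

lemma continuous_clippedHyp (x : X) : Continuous fun θ => clippedHyp X γ θ x := by
  unfold clippedHyp clip
  exact (((continuous_sigmoid.comp (by fun_prop)).max continuous_const).min continuous_const)

lemma continuous_clippedHyp_pi : Continuous fun θ => clippedHyp X γ θ :=
  continuous_pi continuous_clippedHyp

lemma measurable_clippedHyp (x : X) : Measurable fun θ => clippedHyp X γ θ x :=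
  (continuous_clippedHyp x).measurable

lemma measurable_weight (S : Sample X) : Measurable fun θ => weight S (clippedHyp X γ θ) := by
  induction S with
  | nil => exact measurable_const
  | cons s S ih =>
    have := measurable_clippedHyp (γ := γ) s.1
    have h : Measurable fun θ => Real.exp (-crossEntropy (clippedHyp X γ θ) s.1 s.2) := by
      unfold crossEntropy
      split_ifs <;> fun_prop
    exact h.mul ih

variable (hs : IsSetting X Θ R₁ R₂ γ)
include hs

namespace IsSetting

lemma hyp_mem_Icc (θ : Vec d) (x : X) : clippedHyp X γ θ x ∈ Set.Icc γ (1 - γ) :=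
  clip_mem_Icc hs.lt_half _

lemma hyp_pos (θ : Vec d) (x : X) : 0 < clippedHyp X γ θ x :=
  hs.pos.trans_le (hs.hyp_mem_Icc θ x).1

lemma hyp_lt_one (θ : Vec d) (x : X) : clippedHyp X γ θ x < 1 := by
  linarith [(hs.hyp_mem_Icc θ x).2, hs.pos]

lemma abs_inner_sub_le (θ a : Vec d) (x : X) :
    |inner ℝ a (x : Vec d) - inner ℝ θ (x : Vec d)| ≤ R₂ * ‖θ - a‖ := by
  rw [← inner_sub_left]
  refine (abs_real_inner_le_norm _ _).trans ?_
  rw [norm_sub_rev, mul_comm]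
  exact mul_le_mul_of_nonneg_right (hs.norm_data_le x x.2) (norm_nonneg _)

lemma l2Dist_hyp_le (D : PMF X) (θ a : Vec d) :
    l2Dist D (clippedHyp X γ θ) (clippedHyp X γ a) ≤ R₂ * ‖θ - a‖ / 4 := by
  have := hs.one_le_right
  refine l2Dist_le_of_forall_abs_le D (by positivity) fun x => ?_
  refine (abs_clip_sub_clip_le _ _ _).trans ((abs_sigmoid_sub_sigmoid_le _ _).trans ?_)
  have := hs.abs_inner_sub_le a θ x
  rw [norm_sub_rev] at this
  linarith

lemma exp_neg_mul_labelProb_le (θ a : Vec d) (x : X) (y : Bool) :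
    Real.exp (-(R₂ * ‖θ - a‖)) * labelProb (clippedHyp X γ a x) y ≤
      labelProb (clippedHyp X γ θ x) y := by
  refine le_trans ?_ (exp_neg_mul_labelProb_clip_le hs.pos hs.lt_half (inner ℝ a (x : Vec d)) _ y)
  exact mul_le_mul_of_nonneg_right
    (Real.exp_le_exp.2 (neg_le_neg (hs.abs_inner_sub_le θ a x)))
    (labelProb_nonneg (hs.hyp_pos a x).le (hs.hyp_lt_one a x).le y)

lemma weight_cons (θ : Vec d) (x : X) (y : Bool) (S : Sample X) :
    weight ((x, y) :: S) (clippedHyp X γ θ) =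
      labelProb (clippedHyp X γ θ x) y * weight S (clippedHyp X γ θ) :=
  ActiveLogistic.weight_cons (hs.hyp_pos θ x) (hs.hyp_lt_one θ x) y S

lemma exp_neg_mul_weight_le (θ a : Vec d) (S : Sample X) :
    Real.exp (-(S.length * (R₂ * ‖θ - a‖))) * weight S (clippedHyp X γ a) ≤
      weight S (clippedHyp X γ θ) := by
  induction S with
  | nil => simp [weight_nil]
  | cons s S ih =>
    obtain ⟨x, y⟩ := s
    rw [hs.weight_cons, hs.weight_cons, List.length_cons]
    have h := hs.exp_neg_mul_labelProb_le θ a x y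
    have := mul_le_mul h ih (mul_nonneg (Real.exp_pos _).le (weight_pos _ _).le)
      (labelProb_nonneg (hs.hyp_pos θ x).le (hs.hyp_lt_one θ x).le y)
    refine le_trans (le_of_eq ?_) this
    rw [show (-(((S.length + 1 : ℕ) : ℝ) * (R₂ * ‖θ - a‖))) =
      -(R₂ * ‖θ - a‖) + -(S.length * (R₂ * ‖θ - a‖)) by push_cast; ring, Real.exp_add]
    ring

lemma weight_mem_Icc (θ : Vec d) (S : Sample X) :
    weight S (clippedHyp X γ θ) ∈ Set.Icc (γ ^ S.length) 1 := by
  induction S with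
  | nil => simp [weight_nil]
  | cons s S ih =>
    obtain ⟨x, y⟩ := s
    rw [hs.weight_cons, List.length_cons, pow_succ']
    have h1 : γ ≤ labelProb (clippedHyp X γ θ x) y := by
      have := hs.hyp_mem_Icc θ x
      cases y <;> simp only [labelProb, if_true, Bool.false_eq_true, if_false] <;>
        linarith [this.1, this.2]
    have h2 := labelProb_le_one (hs.hyp_pos θ x).le (hs.hyp_lt_one θ x).le y
    have hγ := hs.pos
    exact ⟨mul_le_mul h1 ih.1 (by positivity) (hγ.le.trans h1),
      mul_le_one₀ h2 (weight_pos _ _).le ih.2⟩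

lemma volume_ne_top : volume Θ ≠ ∞ := by
  refine ne_top_of_le_ne_top (measure_closedBall_lt_top (x := (0 : Vec d)) (r := R₁)).ne
    (measure_mono fun θ hθ => ?_)
  simpa using hs.norm_param_le θ hθ

lemma isProbabilityMeasure_cond : IsProbabilityMeasure (ProbabilityTheory.cond volume Θ) :=
  cond_isProbabilityMeasure_of_finite hs.volume_ne_zero hs.volume_ne_top

lemma ae_mem : ∀ᵐ θ ∂(ProbabilityTheory.cond volume Θ), θ ∈ Θ := by
  refine Measure.ae_smul_measure ?_ _
  exact ae_restrict_mem₀ (hs.convex.nullMeasurableSet volume)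

lemma nonempty : Θ.Nonempty := by
  by_contra h
  rw [Set.not_nonempty_iff_eq_empty] at h
  exact hs.volume_ne_zero (by simp [h])

/-- Balls around points of the parameter space are not too small. -/
lemma pow_le_cond_closedBall {a : Vec d} (ha : a ∈ Θ) {η : ℝ} (h0 : 0 < η) (h1 : η ≤ 1) :
    ENNReal.ofReal (η ^ d) ≤
      ProbabilityTheory.cond volume Θ (Metric.closedBall a (2 * R₁ * η)) := by
  -- Shrinking `Θ` towards `a` by the factor `η` stays in `Θ` by convexity, lands in the ball
  -- because points of `Θ` are within `2R₁` of `a`, and scales the volume by `η ^ d`.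
  set s := AffineMap.homothety a η '' Θ with hs_def
  have hsub : s ⊆ Θ := by
    rintro _ ⟨θ, hθ, rfl⟩
    rw [AffineMap.homothety_eq_lineMap]
    exact hs.convex.lineMap_mem ha hθ ⟨h0.le, h1⟩
  have hball : s ⊆ Metric.closedBall a (2 * R₁ * η) := by
    rintro _ ⟨θ, hθ, rfl⟩
    rw [Metric.mem_closedBall, dist_eq_norm, AffineMap.homothety_apply]
    simp only [vsub_eq_sub, vadd_eq_add, add_sub_cancel_right, norm_smul, Real.norm_eq_abs,
      abs_of_pos h0]
    have : ‖θ - a‖ ≤ 2 * R₁ := (norm_sub_le _ _).trans (by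
      linarith [hs.norm_param_le θ hθ, hs.norm_param_le a ha])
    nlinarith
  refine le_trans ?_ (measure_mono hball)
  rw [ProbabilityTheory.cond, Measure.smul_apply, Measure.restrict_eq_self _ hsub, hs_def,
    Measure.addHaar_image_homothety, smul_eq_mul, finrank_euclideanSpace_fin, mul_left_comm,
    ENNReal.inv_mul_cancel hs.volume_ne_zero hs.volume_ne_top, mul_one, abs_of_pos (by positivity)]

end IsSetting

end Setting

end ActiveLogistic

end

/-! ### Likelihood ratios, masses and posteriors. -/

noncomputable section

namespace ActiveLogistic

variable {d : ℕ} {X : Finset (Vec d)}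

/-- The likelihood ratio of `θ` and `θs` on the sample `S`. -/
def ratio (γ : ℝ) (θs : Vec d) (S : Sample X) (θ : Vec d) : ℝ :=
  weight S (clippedHyp X γ θ) / weight S (clippedHyp X γ θs)

/-- The integral over `A` of the likelihood ratio against the uniform distribution on `Θ`. -/
def mass (Θ : Set (Vec d)) (γ : ℝ) (θs : Vec d) (S : Sample X) (A : Set (Vec d)) : ℝ :=
  ∫ θ in A, ratio γ θs S θ ∂(ProbabilityTheory.cond volume Θ)

variable {Θ : Set (Vec d)} {R₁ R₂ γ : ℝ} {θs : Vec d}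

lemma measurable_ratio (S : Sample X) : Measurable (ratio γ θs S) :=
  (measurable_weight S).div_const _

lemma ratio_pos (S : Sample X) (θ : Vec d) : 0 < ratio γ θs S θ :=
  div_pos (weight_pos _ _) (weight_pos _ _)

lemma mass_nonneg (S : Sample X) (A : Set (Vec d)) : 0 ≤ mass Θ γ θs S A :=
  integral_nonneg fun _ => (ratio_pos _ _).le

lemma mass_perm {S S' : Sample X} (h : S.Perm S') (A : Set (Vec d)) :
    mass Θ γ θs S A = mass Θ γ θs S' A := by
  unfold mass ratio
  simp only [weight_perm h]

/-- Dividing all weights by the weight of `θs` does not change the posterior, but makes the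
unnormalized masses martingales under the labels of `θs`. -/
lemma integral_posterior (θs : Vec d) (S : Sample X) (f : Vec d → ℝ) :
    ∫ θ, f θ ∂(posterior Θ γ S) =
      (∫ θ, ratio γ θs S θ * f θ ∂(ProbabilityTheory.cond volume Θ)) /
        mass Θ γ θs S Set.univ := by
  have hw : ∀ θ, ratio γ θs S θ = (weight S (clippedHyp X γ θs))⁻¹ * weight S (clippedHyp X γ θ) :=
    fun θ => by rw [ratio, div_eq_inv_mul]
  have hpos := weight_pos S (clippedHyp X γ θs)
  simp only [posterior, mass, Measure.restrict_univ, hw, mul_assoc, integral_const_mul]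
  rw [mul_div_mul_left _ _ (inv_ne_zero hpos.ne'), integral_smul_measure,
    integral_withDensity_eq_integral_toReal_smul (measurable_weight S).ennreal_ofReal
      (Filter.Eventually.of_forall fun θ => ENNReal.ofReal_lt_top),
    integral_eq_lintegral_of_nonneg_ae (f := fun θ => weight S (clippedHyp X γ θ))
      (Filter.Eventually.of_forall fun θ => (weight_pos _ _).le)
      (measurable_weight S).aestronglyMeasurable, ENNReal.toReal_inv, smul_eq_mul, div_eq_inv_mul]
  congr 2
  ext θ
  rw [ENNReal.toReal_ofReal (weight_pos _ _).le, smul_eq_mul]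

lemma setIntegral_posterior (θs : Vec d) (S : Sample X) (f : Vec d → ℝ) {A : Set (Vec d)}
    (hA : MeasurableSet A) :
    ∫ θ in A, f θ ∂(posterior Θ γ S) =
      (∫ θ in A, ratio γ θs S θ * f θ ∂(ProbabilityTheory.cond volume Θ)) /
        mass Θ γ θs S Set.univ := by
  rw [← integral_indicator hA, integral_posterior θs, ← integral_indicator hA]
  congr 2; ext θ
  by_cases h : θ ∈ A <;> simp [h]

lemma posterior_real (θs : Vec d) (S : Sample X) {A : Set (Vec d)} (hA : MeasurableSet A) :
    (posterior Θ γ S).real A = mass Θ γ θs S A / mass Θ γ θs S Set.univ := by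
  have := setIntegral_posterior (Θ := Θ) (γ := γ) θs S (fun _ => 1) hA
  simpa [mass] using this

variable (hs : IsSetting X Θ R₁ R₂ γ)
include hs

namespace IsSetting

lemma ratio_cons (S : Sample X) (x : X) (y : Bool) (θ : Vec d) :
    ratio γ θs ((x, y) :: S) θ = labelProb (clippedHyp X γ θ x) y /
      labelProb (clippedHyp X γ θs x) y * ratio γ θs S θ := by
  rw [ratio, ratio, hs.weight_cons, hs.weight_cons, mul_div_mul_comm]

lemma le_ratio (S : Sample X) (θ : Vec d) : γ ^ S.length ≤ ratio γ θs S θ := by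
  have := hs.pos
  rw [ratio, le_div_iff₀ (weight_pos _ _)]
  exact (mul_le_of_le_one_right (by positivity) (hs.weight_mem_Icc _ _).2).trans
    (hs.weight_mem_Icc _ _).1

lemma ratio_le (S : Sample X) (θ : Vec d) : ratio γ θs S θ ≤ (γ ^ S.length)⁻¹ := by
  have := hs.pos
  rw [ratio, div_eq_mul_inv, ← one_mul (γ ^ S.length)⁻¹]
  exact mul_le_mul (hs.weight_mem_Icc _ _).2
    (inv_anti₀ (by positivity) (hs.weight_mem_Icc _ _).1) (inv_nonneg.2 (weight_pos _ _).le) zero_le_one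

lemma integrable_ratio (S : Sample X) :
    Integrable (ratio γ θs S) (ProbabilityTheory.cond volume Θ) := by
  have := hs.isProbabilityMeasure_cond
  exact integrable_of_bounds (measurable_ratio S) (hs.le_ratio S) (hs.ratio_le S)

lemma mass_le (S : Sample X) (A : Set (Vec d)) : mass Θ γ θs S A ≤ (γ ^ S.length)⁻¹ := by
  have := hs.isProbabilityMeasure_cond
  have hγ := hs.pos
  calc mass Θ γ θs S A ≤ ∫ _ in A, (γ ^ S.length)⁻¹ ∂(ProbabilityTheory.cond volume Θ) :=
        integral_mono (hs.integrable_ratio S).integrableOn (integrable_const _) (hs.ratio_le S)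
    _ ≤ 1 * (γ ^ S.length)⁻¹ := by
        rw [setIntegral_const, smul_eq_mul]
        exact mul_le_mul_of_nonneg_right measureReal_le_one (by positivity)
    _ = _ := one_mul _

lemma le_mass (S : Sample X) {A B : Set (Vec d)} (hB : MeasurableSet B) (hBA : B ⊆ A) {c : ℝ}
    (hc : ∀ θ ∈ B, c ≤ ratio γ θs S θ) :
    c * (ProbabilityTheory.cond volume Θ).real B ≤ mass Θ γ θs S A := by
  have := hs.isProbabilityMeasure_cond
  calc c * (ProbabilityTheory.cond volume Θ).real B
      = ∫ _ in B, c ∂(ProbabilityTheory.cond volume Θ) := by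
        rw [setIntegral_const, smul_eq_mul, mul_comm]
    _ ≤ ∫ θ in B, ratio γ θs S θ ∂(ProbabilityTheory.cond volume Θ) :=
        setIntegral_mono_on (integrable_const _) (hs.integrable_ratio S).integrableOn hB hc
    _ ≤ _ := setIntegral_mono_set (hs.integrable_ratio S).integrableOn
        (Filter.Eventually.of_forall fun θ => (ratio_pos S θ).le) hBA.eventuallyLE

lemma mass_mono (S : Sample X) {A B : Set (Vec d)} (hBA : B ⊆ A) :
    mass Θ γ θs S B ≤ mass Θ γ θs S A :=
  setIntegral_mono_set (hs.integrable_ratio S).integrableOn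
        (Filter.Eventually.of_forall fun θ => (ratio_pos S θ).le) hBA.eventuallyLE

lemma mass_univ_pos (S : Sample X) : 0 < mass Θ γ θs S Set.univ := by
  have := hs.isProbabilityMeasure_cond
  have h := hs.le_mass (θs := θs) S MeasurableSet.univ (Set.subset_univ _) fun θ _ => hs.le_ratio S θ
  have hγ := hs.pos
  simp only [probReal_univ, mul_one] at h
  exact (by positivity : 0 < γ ^ S.length).trans_le h

lemma pow_le_real_closedBall {a : Vec d} (ha : a ∈ Θ) {η : ℝ} (h0 : 0 < η) (h1 : η ≤ 1) :
    η ^ d ≤ (ProbabilityTheory.cond volume Θ).real (Metric.closedBall a (2 * R₁ * η)) := by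
  have := hs.isProbabilityMeasure_cond
  rw [Measure.real, ← ENNReal.ofReal_le_iff_le_toReal (measure_ne_top _ _)]
  exact hs.pow_le_cond_closedBall ha h0 h1

/-- The true parameter keeps a density that is not too small. -/
lemma exp_mul_pow_le_mass (hθs : θs ∈ Θ) {η : ℝ} (h0 : 0 < η) (h1 : η ≤ 1) {n : ℕ}
    (hn : 2 * R₁ * R₂ * η * n ≤ 1) {S : Sample X} (hS : S.length ≤ n) {A : Set (Vec d)}
    (hA : Metric.closedBall θs (2 * R₁ * η) ⊆ A) :
    Real.exp (-1) * η ^ d ≤ mass Θ γ θs S A := by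
  have hR₁ := hs.one_le_left
  have hR₂ := hs.one_le_right
  refine le_trans (mul_le_mul_of_nonneg_left (hs.pow_le_real_closedBall hθs h0 h1)
    (Real.exp_pos _).le) (hs.le_mass S Metric.isClosed_closedBall.measurableSet hA fun θ hθ => ?_)
  rw [ratio, le_div_iff₀ (weight_pos _ _)]
  refine le_trans (mul_le_mul_of_nonneg_right (Real.exp_le_exp.2 ?_) (weight_pos _ _).le)
    (hs.exp_neg_mul_weight_le θ θs S)
  rw [Metric.mem_closedBall, dist_eq_norm] at hθ
  apply neg_le_neg
  calc (S.length : ℝ) * (R₂ * ‖θ - θs‖) ≤ n * (R₂ * (2 * R₁ * η)) := by gcongr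
    _ = 2 * R₁ * R₂ * η * n := by ring
    _ ≤ 1 := hn

/-- The true label probabilities cancel the denominators of the likelihood ratio, and the numerators
sum to 1. -/
lemma labelMean_mass (S : Sample X) (x : X) (A : Set (Vec d)) :
    labelMean (clippedHyp X γ θs x) (fun y => mass Θ γ θs ((x, y) :: S) A) =
      mass Θ γ θs S A := by
  have p1 := hs.hyp_pos θs x
  have p2 : 0 < 1 - clippedHyp X γ θs x := sub_pos.2 (hs.hyp_lt_one θs x)
  simp only [labelMean, mass]
  rw [← integral_const_mul, ← integral_const_mul, ← integral_add
    ((hs.integrable_ratio _).integrableOn.const_mul _)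
    ((hs.integrable_ratio _).integrableOn.const_mul _)]
  congr 1; ext θ
  simp only [hs.ratio_cons, labelProb, if_true, Bool.false_eq_true, if_false]
  field_simp
  ring

section Posterior

lemma isProbabilityMeasure_posterior (S : Sample X) : IsProbabilityMeasure (posterior Θ γ S) := by
  have := hs.isProbabilityMeasure_cond
  constructor
  simp only [posterior, Measure.smul_apply, withDensity_apply _ MeasurableSet.univ,
    Measure.restrict_univ, smul_eq_mul]
  have i : Integrable (fun θ => weight S (clippedHyp X γ θ)) (ProbabilityTheory.cond volume Θ) :=
    integrable_of_bounds (measurable_weight S) (fun θ => (hs.weight_mem_Icc θ S).1)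
      fun θ => (hs.weight_mem_Icc θ S).2
  rw [← ofReal_integral_eq_lintegral_ofReal i
    (Filter.Eventually.of_forall fun θ => (weight_pos _ _).le)]
  refine ENNReal.inv_mul_cancel ?_ ENNReal.ofReal_ne_top
  rw [ENNReal.ofReal_ne_zero_iff]
  have hγ := hs.pos
  have := integral_mono (integrable_const (γ ^ S.length)) i fun θ => (hs.weight_mem_Icc θ S).1
  simp only [integral_const, probReal_univ, one_smul] at this
  exact (by positivity : 0 < γ ^ S.length).trans_le this

lemma ae_mem_posterior (S : Sample X) : ∀ᵐ θ ∂(posterior Θ γ S), θ ∈ Θ := by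
  refine Measure.ae_smul_measure ?_ _
  exact (withDensity_absolutelyContinuous _ _).ae_le hs.ae_mem

lemma posterior_ne_zero (S : Sample X) {A : Set (Vec d)} (hA : MeasurableSet A)
    (h : 0 < mass Θ γ θs S A) : posterior Θ γ S A ≠ 0 := by
  have := posterior_real (Θ := Θ) (γ := γ) θs S hA
  intro h0
  rw [Measure.real, h0, ENNReal.toReal_zero] at this
  exact (div_pos h (hs.mass_univ_pos S)).ne this

lemma isProbabilityMeasure_cond_posterior (S : Sample X) {A : Set (Vec d)} (hA : MeasurableSet A)
    (h : 0 < mass Θ γ θs S A) :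
    IsProbabilityMeasure (ProbabilityTheory.cond (posterior Θ γ S) A) := by
  have := hs.isProbabilityMeasure_posterior S
  exact cond_isProbabilityMeasure_of_finite (hs.posterior_ne_zero S hA h) (measure_ne_top _ _)

lemma integral_cond_posterior (S : Sample X) (f : Vec d → ℝ) {A : Set (Vec d)}
    (hA : MeasurableSet A) :
    ∫ θ, f θ ∂(ProbabilityTheory.cond (posterior Θ γ S) A) =
      (∫ θ in A, ratio γ θs S θ * f θ ∂(ProbabilityTheory.cond volume Θ)) / mass Θ γ θs S A := by
  rw [ProbabilityTheory.cond, integral_smul_measure, setIntegral_posterior θs S f hA,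
    ENNReal.toReal_inv, ← Measure.real, posterior_real (Θ := Θ) (γ := γ) θs S hA, smul_eq_mul, inv_div]
  have := (hs.mass_univ_pos (θs := θs) S).ne'
  field_simp

/-- The mass ratio after two labels is the mean likelihood ratio of the pair under the posterior
conditioned on `A`. This identity links the potentials to the affinity. -/
lemma labelMean_sqrt_mass (P : Sample X) (x : X) {A : Set (Vec d)}
    (hA : MeasurableSet A) :
    labelMean (clippedHyp X γ θs x) (fun y => labelMean (clippedHyp X γ θs x) fun z =>
      √(mass Θ γ θs ((x, z) :: (x, y) :: P) A / mass Θ γ θs P A)) =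
        affinity (clippedHyp X γ θs x) (fun θ => clippedHyp X γ θ x)
          (ProbabilityTheory.cond (posterior Θ γ P) A) := by
  have key : ∀ y z, mass Θ γ θs ((x, z) :: (x, y) :: P) A / mass Θ γ θs P A =
      ∫ θ, labelProb (clippedHyp X γ θ x) y / labelProb (clippedHyp X γ θs x) y *
        (labelProb (clippedHyp X γ θ x) z / labelProb (clippedHyp X γ θs x) z)
          ∂(ProbabilityTheory.cond (posterior Θ γ P) A) := by
    intro y z
    rw [hs.integral_cond_posterior (θs := θs) P _ hA]
    congr 1
    unfold mass
    congr 1; ext θ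
    rw [hs.ratio_cons, hs.ratio_cons]; ring
  simp only [key, affinity]

end Posterior

end IsSetting

end ActiveLogistic

end

/-! ### The sampling law and pairs of far hypotheses. -/

noncomputable section

namespace ActiveLogistic

variable {d : ℕ} {X : Finset (Vec d)} {D : PMF X}

section Far

variable (D) (γ ρ : ℝ)

lemma measurableSet_far_prod :
    MeasurableSet {p : Vec d × Vec d | ρ ≤ l2Dist D (clippedHyp X γ p.1) (clippedHyp X γ p.2)} := by
  refine measurableSet_le measurable_const (Continuous.measurable ?_)
  exact (continuous_l2Dist D).comp
    ((continuous_clippedHyp_pi.comp continuous_fst).prodMk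
      (continuous_clippedHyp_pi.comp continuous_snd))

lemma measurableSet_farFrom (θ' : Vec d) : MeasurableSet (farFrom D γ ρ θ') :=
  measurable_prodMk_left (measurableSet_far_prod D γ ρ)

lemma measurable_cond_farFrom (q : Measure (Vec d)) [SFinite q] :
    Measurable fun θ' => ProbabilityTheory.cond q (farFrom D γ ρ θ') := by
  refine Measure.measurable_of_measurable_coe _ fun s hs => ?_
  have h1 : Measurable fun θ' => q (farFrom D γ ρ θ') :=
    measurable_measure_prodMk_left (measurableSet_far_prod D γ ρ)
  have h2 : Measurable fun θ' => q (farFrom D γ ρ θ' ∩ s) :=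
    measurable_measure_prodMk_left
      ((measurableSet_far_prod D γ ρ).inter (measurable_snd hs))
  simp only [cond_apply (measurableSet_farFrom D γ ρ _)]
  exact h1.inv.mul h2

end Far

variable {Θ : Set (Vec d)} {R₁ R₂ γ ε : ℝ} {θs : Vec d}

lemma measurable_mass_farFrom (hs : IsSetting X Θ R₁ R₂ γ) (P : Sample X) (ρ : ℝ) :
    Measurable fun θ' => mass Θ γ θs P (farFrom D γ ρ θ') := by
  have := hs.isProbabilityMeasure_cond
  have h : StronglyMeasurable fun p : Vec d × Vec d =>
      {p : Vec d × Vec d | ρ ≤ l2Dist D (clippedHyp X γ p.1) (clippedHyp X γ p.2)}.indicator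
        (fun p => ratio γ θs P p.2) p :=
    (((measurable_ratio P).comp measurable_snd).indicator
      (measurableSet_far_prod D γ ρ)).stronglyMeasurable
  have h2 := (h.integral_prod_right' (ν := ProbabilityTheory.cond volume Θ)).measurable
  convert h2 using 2 with θ'
  rw [mass, ← integral_indicator (measurableSet_farFrom D γ ρ θ')]
  rfl

/-- The hypotheses do not all lie within distance `8ε` of each other. -/
def IsSpread (D : PMF X) (Θ : Set (Vec d)) (γ ε : ℝ) : Prop :=
  ∃ a ∈ Θ, ∃ b ∈ Θ, 8 * ε < l2Dist D (clippedHyp X γ a) (clippedHyp X γ b)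

namespace IsSetting

lemma closedBall_subset (hs : IsSetting X Θ R₁ R₂ γ) {a : Vec d} {η : ℝ}
    (hη : R₁ * R₂ * η ≤ ε) {A : Set (Vec d)}
    (hA : ∀ θ, l2Dist D (clippedHyp X γ θ) (clippedHyp X γ a) ≤ ε → θ ∈ A) (hε : 0 < ε) :
    Metric.closedBall a (2 * R₁ * η) ⊆ A := by
  intro θ hθ
  have := hs.one_le_right
  refine hA θ ((hs.l2Dist_hyp_le D θ a).trans ?_)
  rw [Metric.mem_closedBall, dist_eq_norm] at hθ
  have := mul_le_mul_of_nonneg_left hθ (zero_le_one.trans hs.one_le_right)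
  nlinarith

variable (hs : IsSetting X Θ R₁ R₂ γ) (hε : 0 < ε)
include hs hε

lemma exists_le_real_farFrom (hsp : IsSpread D Θ γ ε) :
    ∃ c > 0, ∀ θ', c ≤ (ProbabilityTheory.cond volume Θ).real (farFrom D γ (2 * ε) θ') := by
  have := hs.isProbabilityMeasure_cond
  obtain ⟨a, ha, b, hb, hab⟩ := hsp
  have h1 := hs.one_le_left
  have h2 := hs.one_le_right
  set η := min 1 (ε / (R₁ * R₂))
  have hη : 0 < η := lt_min one_pos (by positivity)
  have hη' : R₁ * R₂ * η ≤ ε := by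
    rw [mul_comm, ← le_div_iff₀ (by positivity)]; exact min_le_right _ _
  refine ⟨η ^ d, by positivity, fun θ' => ?_⟩
  have key : ∀ a ∈ Θ, 4 * ε < l2Dist D (clippedHyp X γ a) (clippedHyp X γ θ') →
      η ^ d ≤ (ProbabilityTheory.cond volume Θ).real (farFrom D γ (2 * ε) θ') := by
    intro a ha h
    refine (hs.pow_le_real_closedBall ha hη (min_le_left _ _)).trans
      (measureReal_mono (hs.closedBall_subset (D := D) hη' (fun θ hθ => ?_) hε))
    have := l2Dist_triangle D (clippedHyp X γ a) (clippedHyp X γ θ) (clippedHyp X γ θ')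
    have c₁ := l2Dist_comm D (clippedHyp X γ a) (clippedHyp X γ θ)
    have c₂ := l2Dist_comm D (clippedHyp X γ θ) (clippedHyp X γ θ')
    simp only [farFrom, Set.mem_ofPred_eq]
    linarith
  have := l2Dist_triangle D (clippedHyp X γ a) (clippedHyp X γ θ') (clippedHyp X γ b)
  -- Since `a` and `b` are more than `8ε` apart, one of them is more than `4ε` from `θ'`, and then
  -- so is its `ε`-neighbourhood by more than `3ε`.
  rcases lt_or_ge (4 * ε) (l2Dist D (clippedHyp X γ a) (clippedHyp X γ θ')) with h | h
  · exact key a ha h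
  · exact key b hb (by rw [l2Dist_comm]; linarith)

lemma exists_le_mass_farFrom (hsp : IsSpread D Θ γ ε) (P : Sample X) :
    ∃ c > 0, ∀ θ', c ≤ mass Θ γ θs P (farFrom D γ (2 * ε) θ') := by
  obtain ⟨c, hc, h⟩ := hs.exists_le_real_farFrom hε hsp
  have hγ := hs.pos
  refine ⟨γ ^ P.length * c, by positivity, fun θ' => ?_⟩
  exact (mul_le_mul_of_nonneg_left (h θ') (by positivity)).trans
    (hs.le_mass P (measurableSet_farFrom D γ _ θ') subset_rfl fun θ _ => hs.le_ratio P θ)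

lemma mass_farFrom_pos (hsp : IsSpread D Θ γ ε) (P : Sample X) (θ' : Vec d) :
    0 < mass Θ γ θs P (farFrom D γ (2 * ε) θ') := by
  obtain ⟨c, hc, h⟩ := hs.exists_le_mass_farFrom (θs := θs) hε hsp P
  exact hc.trans_le (h θ')

lemma isProbabilityMeasure_cond_farFrom (hsp : IsSpread D Θ γ ε) (P : Sample X) (θ' : Vec d) :
    IsProbabilityMeasure (ProbabilityTheory.cond (posterior Θ γ P) (farFrom D γ (2 * ε) θ')) :=
  hs.isProbabilityMeasure_cond_posterior P (measurableSet_farFrom D γ _ θ')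
    (hs.mass_farFrom_pos (θs := θ') hε hsp P θ')

lemma isProbabilityMeasure_bind (hsp : IsSpread D Θ γ ε) (S P : Sample X) :
    IsProbabilityMeasure ((posterior Θ γ S).bind fun θ' =>
      ProbabilityTheory.cond (posterior Θ γ P) (farFrom D γ (2 * ε) θ')) := by
  have := hs.isProbabilityMeasure_posterior S
  have := hs.isProbabilityMeasure_posterior P
  have := hs.isProbabilityMeasure_cond_farFrom hε hsp P
  constructor
  rw [Measure.bind_apply MeasurableSet.univ (measurable_cond_farFrom D γ _ _).aemeasurable]
  simp

lemma isProbabilityMeasure_samplingLaw (hsp : IsSpread D Θ γ ε) (S P : Sample X) :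
    IsProbabilityMeasure
      (samplingLaw D γ (posterior Θ γ S) (posterior Θ γ P) (2 * ε)) := by
  have := hs.isProbabilityMeasure_posterior S
  have := hs.isProbabilityMeasure_bind hε hsp S P
  constructor
  rw [samplingLaw, Measure.add_apply, Measure.smul_apply, Measure.smul_apply, measure_univ,
    measure_univ, smul_eq_mul, mul_one, ENNReal.inv_two_add_inv_two]

lemma integral_samplingLaw (hsp : IsSpread D Θ γ ε) (S P : Sample X) {f : Vec d → ℝ}
    (hf : Measurable f) {a b : ℝ} (ha : ∀ t, a ≤ f t) (hb : ∀ t, f t ≤ b) :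
    ∫ θ, f θ ∂(samplingLaw D γ (posterior Θ γ S) (posterior Θ γ P) (2 * ε)) =
      (∫ θ, f θ ∂(posterior Θ γ S)) / 2 + (∫ θ', ∫ θ, f θ ∂(ProbabilityTheory.cond
        (posterior Θ γ P) (farFrom D γ (2 * ε) θ')) ∂(posterior Θ γ S)) / 2 := by
  have := hs.isProbabilityMeasure_posterior S
  have := hs.isProbabilityMeasure_posterior P
  have := hs.isProbabilityMeasure_bind hε hsp S P
  let κ : Kernel (Vec d) (Vec d) :=
    ⟨fun θ' => ProbabilityTheory.cond (posterior Θ γ P) (farFrom D γ (2 * ε) θ'),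
      measurable_cond_farFrom D γ _ _⟩
  have hκ : (posterior Θ γ S).bind (fun θ' => ProbabilityTheory.cond (posterior Θ γ P)
      (farFrom D γ (2 * ε) θ')) = (κ ∘ₖ Kernel.const Unit (posterior Θ γ S)) () :=
    Measure.comp_eq_comp_const_apply (κ := κ)
  have i := integrable_of_bounds (ν := (posterior Θ γ S).bind fun θ' =>
    ProbabilityTheory.cond (posterior Θ γ P) (farFrom D γ (2 * ε) θ')) hf ha hb
  rw [samplingLaw, integral_add_measure
    ((integrable_of_bounds hf ha hb).smul_measure (by simp)) (i.smul_measure (by simp)),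
    integral_smul_measure, integral_smul_measure, hκ, Kernel.integral_comp (hκ ▸ i)]
  simp only [Kernel.const_apply, ENNReal.toReal_inv, ENNReal.toReal_ofNat, smul_eq_mul]
  simp only [κ, Kernel.coe_mk]
  ring

/-- Two hypotheses of the sampling procedure are never both close to the same function. -/
lemma samplingLaw_real_le (hsp : IsSpread D Θ γ ε) (S P : Sample X) (g : X → ℝ) :
    (samplingLaw D γ (posterior Θ γ S) (posterior Θ γ P) (2 * ε)).real
      {θ | l2Dist D g (clippedHyp X γ θ) < ε} ≤ 1 / 2 := by
  have := hs.isProbabilityMeasure_posterior S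
  have := hs.isProbabilityMeasure_posterior P
  have hc := hs.isProbabilityMeasure_cond_farFrom hε hsp P
  set B := {θ | l2Dist D g (clippedHyp X γ θ) < ε} with hB
  have hBm : MeasurableSet B := by
    refine measurableSet_lt (Continuous.measurable ?_) measurable_const
    exact (continuous_l2Dist D).comp (continuous_const.prodMk continuous_clippedHyp_pi)
  have e := hs.integral_samplingLaw hε hsp S P (f := B.indicator fun _ => 1)
    (measurable_const.indicator hBm) (a := 0) (b := 1)
    (fun t => Set.indicator_nonneg (fun _ _ => zero_le_one) t)
    fun t => Set.indicator_le_self' (fun _ _ => zero_le_one) t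
  simp only [integral_indicator_const (1 : ℝ) hBm, smul_eq_mul,
    mul_one] at e
  rw [e]
  have hm : Measurable fun θ' => (ProbabilityTheory.cond (posterior Θ γ P)
      (farFrom D γ (2 * ε) θ')).real B :=
    ((Measure.measurable_coe hBm).comp (measurable_cond_farFrom D γ _ _)).ennreal_toReal
  have i1 : Integrable (fun θ' => (ProbabilityTheory.cond (posterior Θ γ P)
      (farFrom D γ (2 * ε) θ')).real B) (posterior Θ γ S) :=
    integrable_of_bounds hm (fun _ => measureReal_nonneg) fun _ => measureReal_le_one
  have i2 : Integrable (B.indicator fun _ => (1 : ℝ)) (posterior Θ γ S) :=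
    (integrable_const _).indicator hBm
  -- Pointwise, the two terms add to at most 1: if the first draw is in `B`, every point `2ε` away
  -- from it is outside `B`.
  have : ∫ θ', (B.indicator (fun _ => (1 : ℝ)) θ' + (ProbabilityTheory.cond (posterior Θ γ P)
      (farFrom D γ (2 * ε) θ')).real B) ∂(posterior Θ γ S) ≤ ∫ _, (1 : ℝ) ∂(posterior Θ γ S) := by
    refine integral_mono (i2.add i1) (integrable_const _) fun θ' => ?_
    by_cases h : θ' ∈ B
    · have : farFrom D γ (2 * ε) θ' ∩ B = ∅ := by
        ext θ
        simp only [Set.mem_inter_iff, Set.mem_empty_iff_false, iff_false, not_and]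
        intro h1 h2
        have := l2Dist_triangle D (clippedHyp X γ θ') g (clippedHyp X γ θ)
        rw [l2Dist_comm D _ g] at this
        simp only [farFrom, hB, Set.mem_ofPred_eq] at h h1 h2
        linarith
      simp [h, Measure.real, cond_apply (measurableSet_farFrom D γ _ θ'), this]
    · simp [h, measureReal_le_one]
  rw [integral_add i2 i1, integral_indicator_const _ hBm] at this
  simp at this
  linarith

end IsSetting

end ActiveLogistic

end

/-! ### Every query makes progress for one of the two distributions. -/

noncomputable section

namespace ActiveLogistic

variable {d : ℕ} {X : Finset (Vec d)} {D : PMF X} {Θ : Set (Vec d)} {R₁ R₂ γ ε : ℝ}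

lemma log_inv_pos {γ : ℝ} (h0 : 0 < γ) (h1 : γ < 1 / 2) : 0 < Real.log (1 / γ) :=
  Real.log_pos (by rw [lt_div_iff₀ h0]; linarith)

lemma affinity_nonneg {T : Type*} [MeasurableSpace T] {ν : Measure T} {s : ℝ} (hs0 : 0 ≤ s)
    (hs1 : s ≤ 1) (f : T → ℝ) : 0 ≤ affinity s f ν :=
  labelMean_nonneg hs0 hs1 fun _ => labelMean_nonneg hs0 hs1 fun _ => Real.sqrt_nonneg _

/-- The progress that one informative query makes. -/
def progress (γ τ : ℝ) : ℝ := (τ / (12 * Real.log (1 / γ))) ^ 4 / 32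

/-- The affinity at `x` with the true labels under the distribution `p` of the parameter, given
that its hypothesis is far from that of `θ'`. -/
def farAffinity (D : PMF X) (Θ : Set (Vec d)) (γ ε : ℝ) (θs : Vec d) (P : Sample X) (x : X)
    (θ' : Vec d) : ℝ :=
  affinity (clippedHyp X γ θs x) (fun θ => clippedHyp X γ θ x)
    (ProbabilityTheory.cond (posterior Θ γ P) (farFrom D γ (2 * ε) θ'))

namespace IsSetting

variable (hs : IsSetting X Θ R₁ R₂ γ) (hε : 0 < ε)
include hs

lemma affinity_le_one (θs : Vec d) (x : X) (ν : Measure (Vec d)) [IsProbabilityMeasure ν] :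
    affinity (clippedHyp X γ θs x) (fun θ => clippedHyp X γ θ x) ν ≤ 1 := by
  have := (sq_nonneg _).trans (sq_integral_sub_sq_le (ν := ν) (hs.hyp_pos θs x)
    (hs.hyp_lt_one θs x) (measurable_clippedHyp x) (fun θ => (hs.hyp_pos θ x).le)
    fun θ => (hs.hyp_lt_one θ x).le)
  linarith

/-- Rewriting the affinity by masses for the four label pairs avoids integrating against the varying
conditional measure. -/
lemma measurable_farAffinity (θs : Vec d) (P : Sample X) (x : X) :
    Measurable (farAffinity D Θ γ ε θs P x) := by
  have h : ∀ Q : Sample X, Measurable fun θ' => mass Θ γ θs Q (farFrom D γ (2 * ε) θ') :=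
    fun Q => measurable_mass_farFrom hs Q _
  unfold farAffinity
  simp only [← hs.labelMean_sqrt_mass P x (measurableSet_farFrom D γ (2 * ε) _), labelMean]
  have := h P
  have h1 := h ((x, true) :: (x, true) :: P)
  have h2 := h ((x, true) :: (x, false) :: P)
  have h3 := h ((x, false) :: (x, true) :: P)
  have h4 := h ((x, false) :: (x, false) :: P)
  fun_prop

include hε

lemma farAffinity_mem_Icc (hsp : IsSpread D Θ γ ε) (θs : Vec d) (P : Sample X) (x : X)
    (θ' : Vec d) : farAffinity D Θ γ ε θs P x θ' ∈ Set.Icc 0 1 := by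
  have := hs.isProbabilityMeasure_cond_farFrom hε hsp P θ'
  exact ⟨affinity_nonneg (hs.hyp_pos θs x).le (hs.hyp_lt_one θs x).le _,
    hs.affinity_le_one θs x _⟩

/-- If some point separates the two hypotheses of the sampling procedure, then the next query makes
progress for one of the two distributions. -/
lemma affinity_le_or (hsp : IsSpread D Θ γ ε) {argmax : (X → ℝ) → X}
    (hargmax : ∀ (r : X → ℝ) (x : X), r x ≤ r (argmax r)) (θs : Vec d) (S P : Sample X) {τ : ℝ}
    (hτ : 0 < τ) {x₀ : X}
    (hx₀ : τ ≤ ∫ θ, (clippedHyp X γ θ x₀ - ∫ θ', clippedHyp X γ θ' x₀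
      ∂(samplingLaw D γ (posterior Θ γ S) (posterior Θ γ P) (2 * ε))) ^ 2
      ∂(samplingLaw D γ (posterior Θ γ S) (posterior Θ γ P) (2 * ε))) :
    affinity (clippedHyp X γ θs (nextQuery D Θ γ ε argmax S P))
        (fun θ => clippedHyp X γ θ (nextQuery D Θ γ ε argmax S P)) (posterior Θ γ S)
        ≤ 1 - progress γ τ ∨
      ∫ θ', farAffinity D Θ γ ε θs P (nextQuery D Θ γ ε argmax S P) θ' ∂(posterior Θ γ S)
        ≤ 1 - progress γ τ := by
  set x := nextQuery D Θ γ ε argmax S P with hx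
  set lam := samplingLaw D γ (posterior Θ γ S) (posterior Θ γ P) (2 * ε) with hlam
  have := hs.isProbabilityMeasure_posterior S
  have : IsProbabilityMeasure lam := hs.isProbabilityMeasure_samplingLaw hε hsp S P
  have hc := hs.isProbabilityMeasure_cond_farFrom hε hsp P
  have hL := log_inv_pos hs.pos hs.lt_half
  set L := Real.log (1 / γ) with hLdef
  set s := clippedHyp X γ θs x
  have hs0 : 0 < s := hs.hyp_pos θs x
  have hs1 : s < 1 := hs.hyp_lt_one θs x
  have hm := measurable_clippedHyp (γ := γ) x
  have hm0 : ∀ θ, 0 ≤ clippedHyp X γ θ x := fun θ => (hs.hyp_pos θ x).le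
  have hm1 : ∀ θ, clippedHyp X γ θ x ≤ 1 := fun θ => (hs.hyp_lt_one θ x).le
  by_contra! hcon
  obtain ⟨h1, h2⟩ := hcon
  -- Chosen so that `6Lv = τ/2`. If both affinities exceeded `1 - v⁴/32`, the deviation from the
  -- truth at the maximizer would be below `v`, and its informativeness below the value `τ/2` that
  -- `x₀` guarantees.
  set v := τ / (12 * L) with hv
  have hv0 : 0 < v := by positivity
  have hprog : 32 * progress γ τ = v ^ 4 := by rw [progress]; ring
  have sqlt : ∀ e : ℝ, e ^ 2 < v ^ 4 → e < v ^ 2 := fun e he => by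
    by_contra! h
    have := pow_le_pow_left₀ (sq_nonneg v) h 2
    rw [← pow_mul] at this
    exact not_lt.2 this he
  have e1 : ∫ θ, (clippedHyp X γ θ x - s) ^ 2 ∂(posterior Θ γ S) < v ^ 2 := by
    apply sqlt
    have := sq_integral_sub_sq_le (ν := posterior Θ γ S) hs0 hs1 hm hm0 hm1
    linarith
  set g : Vec d → ℝ := fun θ' => ∫ θ, (clippedHyp X γ θ x - s) ^ 2
    ∂(ProbabilityTheory.cond (posterior Θ γ P) (farFrom D γ (2 * ε) θ')) with hg
  have hgm : Measurable g := by
    let κ : Kernel (Vec d) (Vec d) :=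
      ⟨fun θ' => ProbabilityTheory.cond (posterior Θ γ P) (farFrom D γ (2 * ε) θ'), by
        have := hs.isProbabilityMeasure_posterior P
        exact measurable_cond_farFrom D γ _ _⟩
    have : IsMarkovKernel κ := ⟨hc⟩
    have hh : StronglyMeasurable fun p : Vec d × Vec d => (clippedHyp X γ p.2 x - s) ^ 2 :=
      (((hm.comp measurable_snd).sub_const s).pow_const 2).stronglyMeasurable
    exact (hh.integral_kernel_prod_right' (κ := κ)).measurable
  have hsq0 : ∀ θ, 0 ≤ (clippedHyp X γ θ x - s) ^ 2 := fun θ => sq_nonneg _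
  have hsq1 : ∀ θ, (clippedHyp X γ θ x - s) ^ 2 ≤ 1 := fun θ => by
    rw [sq_le_one_iff_abs_le_one, abs_le]
    constructor <;> linarith [hm0 θ, hm1 θ]
  have hsqm : Measurable fun θ => (clippedHyp X γ θ x - s) ^ 2 := (hm.sub_const s).pow_const 2
  have hg0 : ∀ θ', 0 ≤ g θ' := fun θ' => integral_nonneg hsq0
  have hg1 : ∀ θ', g θ' ≤ 1 := fun θ' =>
    (integral_mem_Icc hsqm (a := 0) (b := 1) fun t => ⟨hsq0 t, hsq1 t⟩).2
  -- The affinity bound controls the square of each conditional deviation; Jensen moves the square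
  -- outside the average over `θ'`.
  have e2 : ∫ θ', g θ' ∂(posterior Θ γ S) < v ^ 2 := by
    apply sqlt
    have ig := integrable_of_bounds (ν := posterior Θ γ S) hgm hg0 hg1
    have ig2 : Integrable (fun θ' => g θ' ^ 2) (posterior Θ γ S) :=
      integrable_of_bounds (hgm.pow_const 2) (fun t => sq_nonneg _)
        fun t => pow_le_one₀ (hg0 t) (hg1 t)
    have ia : Integrable (farAffinity D Θ γ ε θs P x) (posterior Θ γ S) :=
      integrable_of_bounds (hs.measurable_farAffinity θs P x)
        (fun t => (hs.farAffinity_mem_Icc hε hsp θs P x t).1)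
        fun t => (hs.farAffinity_mem_Icc hε hsp θs P x t).2
    refine (sq_integral_le_integral_sq ig ig2).trans_lt ?_
    have : ∫ θ', g θ' ^ 2 ∂(posterior Θ γ S) ≤
        ∫ θ', 32 * (1 - farAffinity D Θ γ ε θs P x θ') ∂(posterior Θ γ S) :=
      integral_mono ig2 (((integrable_const _).sub ia).const_mul _) fun θ' =>
        sq_integral_sub_sq_le hs0 hs1 hm hm0 hm1
    rw [integral_const_mul, integral_sub (integrable_const _) ia] at this
    simp only [integral_const, probReal_univ, smul_eq_mul, mul_one] at this
    linarith
  have e3 : ∫ θ, (clippedHyp X γ θ x - s) ^ 2 ∂lam < v ^ 2 := by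
    rw [hlam, hs.integral_samplingLaw hε hsp S P hsqm hsq0 hsq1]
    linarith
  set e := ∫ θ, (clippedHyp X γ θ x - s) ^ 2 ∂lam
  have he0 : 0 ≤ e := integral_nonneg hsq0
  have h3 : informativeness γ lam x ≤ 6 * L * √e :=
    integral_binaryKL_le hs.pos hs.lt_half hm (fun θ => hs.hyp_mem_Icc θ x) (Real.sqrt_nonneg e)
      (Real.sq_sqrt he0).ge
  have h4 : τ / 2 ≤ informativeness γ lam x₀ :=
    (by linarith : τ / 2 ≤ _ / 2).trans (integral_sq_le_integral_binaryKL hs.pos hs.lt_half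
      (measurable_clippedHyp x₀) fun θ => hs.hyp_mem_Icc θ x₀)
  have h5 : informativeness γ lam x₀ ≤ informativeness γ lam x := hargmax _ x₀
  have h6 : √e < v := (Real.sqrt_lt' hv0).2 e3
  have h7 : 6 * L * v = τ / 2 := by rw [hv]; field_simp; norm_num
  have h8 : 6 * L * √e < 6 * L * v := by gcongr
  linarith

end IsSetting

end ActiveLogistic

end

/-! ### The potentials inside a phase and across phases. -/

noncomputable section

namespace ActiveLogistic

variable {d : ℕ} {X : Finset (Vec d)} {D : PMF X} {Θ : Set (Vec d)} {R₁ R₂ γ ε : ℝ} {θs : Vec d}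

/-- Some point of the sample `P` has small affinity under the distribution with labels `S`. -/
def IsExposed (Θ : Set (Vec d)) (γ : ℝ) (θs : Vec d) (κ : ℝ) (S P : Sample X) : Prop :=
  ∃ x ∈ P.map Prod.fst, affinity (clippedHyp X γ θs x) (fun θ => clippedHyp X γ θ x)
    (posterior Θ γ S) ≤ 1 - κ

/-- The root of the geometric mean over `θ'` of the mass of the hypotheses far from `θ'`. -/
def farPotential (D : PMF X) (Θ : Set (Vec d)) (γ ε : ℝ) (θs : Vec d) (S P : Sample X) : ℝ :=
  Real.exp ((∫ θ', Real.log (mass Θ γ θs P (farFrom D γ (2 * ε) θ')) ∂(posterior Θ γ S)) / 2)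

open Classical in
/-- The far potential, until some point is exposed. -/
def stoppedPotential (D : PMF X) (Θ : Set (Vec d)) (γ ε : ℝ) (θs : Vec d) (κ : ℝ)
    (S P : Sample X) : ℝ :=
  if IsExposed Θ γ θs κ S P then 0 else farPotential D Θ γ ε θs S P

/-- The probability under the distribution with labels `P` of an error above `8ε`. -/
def failure (D : PMF X) (Θ : Set (Vec d)) (γ ε : ℝ) (θs : Vec d) (P : Sample X) : ℝ :=
  (posterior Θ γ P).real {θ | 8 * ε < l2Dist D (clippedHyp X γ θs) (clippedHyp X γ θ)}

/-- At each query, one of the two distributions makes progress `κ`. -/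
def HasProgress (D : PMF X) (Θ : Set (Vec d)) (γ ε : ℝ) (argmax : (X → ℝ) → X) (θs : Vec d)
    (κ : ℝ) : Prop :=
  ∀ S P : Sample X,
    affinity (clippedHyp X γ θs (nextQuery D Θ γ ε argmax S P))
        (fun θ => clippedHyp X γ θ (nextQuery D Θ γ ε argmax S P)) (posterior Θ γ S) ≤ 1 - κ ∨
      ∫ θ', farAffinity D Θ γ ε θs P (nextQuery D Θ γ ε argmax S P) θ' ∂(posterior Θ γ S) ≤ 1 - κ

/-- For samples of size at most `n`, neighbourhoods of the true hypothesis have mass at least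
`exp (-B)`. -/
def HasMassBound (D : PMF X) (Θ : Set (Vec d)) (γ ε : ℝ) (θs : Vec d) (n : ℕ) (B : ℝ) : Prop :=
  ∀ (S : Sample X) (A : Set (Vec d)), S.length ≤ n →
    (∀ θ, l2Dist D (clippedHyp X γ θ) (clippedHyp X γ θs) ≤ ε → θ ∈ A) →
      Real.exp (-B) ≤ mass Θ γ θs S A

lemma measurableSet_failure :
    MeasurableSet {θ | 8 * ε < l2Dist D (clippedHyp X γ θs) (clippedHyp X γ θ)} :=
  measurableSet_lt measurable_const (Continuous.measurable
    ((continuous_l2Dist D).comp (continuous_const.prodMk continuous_clippedHyp_pi)))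

lemma failure_eq (P : Sample X) : failure D Θ γ ε θs P =
    mass Θ γ θs P {θ | 8 * ε < l2Dist D (clippedHyp X γ θs) (clippedHyp X γ θ)} /
      mass Θ γ θs P Set.univ :=
  posterior_real θs P measurableSet_failure

namespace IsSetting

variable (hs : IsSetting X Θ R₁ R₂ γ)
include hs

lemma expect_mono {α : Type} {A : QueryAlg X α} {f g : α → ℝ}
    (h : A.AllResults fun a => f a ≤ g a) :
    A.expect (clippedHyp X γ θs) f ≤ A.expect (clippedHyp X γ θs) g :=
  QueryAlg.expect_mono (fun x => (hs.hyp_pos θs x).le) (fun x => (hs.hyp_lt_one θs x).le) h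

lemma labelMean_mono {x : X} {f g : Bool → ℝ} (h : ∀ y, f y ≤ g y) :
    labelMean (clippedHyp X γ θs x) f ≤ labelMean (clippedHyp X γ θs x) g :=
  ActiveLogistic.labelMean_mono (hs.hyp_pos θs x).le (hs.hyp_lt_one θs x).le h

section Phase

variable (hε : 0 < ε) (hsp : IsSpread D Θ γ ε)
include hε hsp

lemma integrable_log_mass (S P : Sample X) :
    Integrable (fun θ' => Real.log (mass Θ γ θs P (farFrom D γ (2 * ε) θ')))
      (posterior Θ γ S) := by
  have := hs.isProbabilityMeasure_posterior S
  obtain ⟨c, hc, h⟩ := hs.exists_le_mass_farFrom (θs := θs) hε hsp P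
  exact integrable_of_bounds (Real.measurable_log.comp (measurable_mass_farFrom hs P _))
    (fun t => Real.log_le_log hc (h t))
    fun t => Real.log_le_log (hc.trans_le (h t)) (hs.mass_le P _)

/-- A geometric mean is multiplicative, so the update factor separates from the old potential; only
this factor is then bounded by an arithmetic mean, whose label average is an affinity. -/
lemma farPotential_le (S P : Sample X) (x : X) (y z : Bool) :
    farPotential D Θ γ ε θs S ((x, z) :: (x, y) :: P) ≤ farPotential D Θ γ ε θs S P *
      ∫ θ', √(mass Θ γ θs ((x, z) :: (x, y) :: P) (farFrom D γ (2 * ε) θ') /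
        mass Θ γ θs P (farFrom D γ (2 * ε) θ')) ∂(posterior Θ γ S) := by
  have := hs.isProbabilityMeasure_posterior S
  set Q := (x, z) :: (x, y) :: P
  obtain ⟨c, hc, h⟩ := hs.exists_le_mass_farFrom (θs := θs) hε hsp P
  obtain ⟨c', hc', h'⟩ := hs.exists_le_mass_farFrom (θs := θs) hε hsp Q
  have hγ := hs.pos
  have key := exp_integral_log_le (ν := posterior Θ γ S)
    (u := fun θ' => mass Θ γ θs Q (farFrom D γ (2 * ε) θ') /
      mass Θ γ θs P (farFrom D γ (2 * ε) θ'))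
    ((measurable_mass_farFrom hs Q _).div (measurable_mass_farFrom hs P _))
    (c := c' / (γ ^ P.length)⁻¹) (C := (γ ^ Q.length)⁻¹ / c) (by positivity)
    (fun t => div_le_div₀ (mass_nonneg _ _) (h' t) (hc.trans_le (h t)) (hs.mass_le P _))
    (fun t => div_le_div₀ (by positivity) (hs.mass_le Q _) hc (h t))
  refine le_trans (le_of_eq ?_) (mul_le_mul_of_nonneg_left key (Real.exp_pos _).le)
  rw [farPotential, farPotential, ← Real.exp_add]
  congr 1
  have e : ∀ θ', Real.log (mass Θ γ θs Q (farFrom D γ (2 * ε) θ') /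
      mass Θ γ θs P (farFrom D γ (2 * ε) θ')) = Real.log (mass Θ γ θs Q
        (farFrom D γ (2 * ε) θ')) - Real.log (mass Θ γ θs P (farFrom D γ (2 * ε) θ')) :=
    fun θ' => Real.log_div (hc'.trans_le (h' θ')).ne' (hc.trans_le (h θ')).ne'
  simp only [e]
  rw [integral_sub (hs.integrable_log_mass hε hsp S Q) (hs.integrable_log_mass hε hsp S P)]
  ring

lemma labelMean_farPotential_le (S P : Sample X) (x : X) :
    labelMean (clippedHyp X γ θs x) (fun y => labelMean (clippedHyp X γ θs x) fun z =>
      farPotential D Θ γ ε θs S ((x, z) :: (x, y) :: P)) ≤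
    farPotential D Θ γ ε θs S P * ∫ θ', farAffinity D Θ γ ε θs P x θ' ∂(posterior Θ γ S) := by
  have := hs.isProbabilityMeasure_posterior S
  obtain ⟨c, hc, h⟩ := hs.exists_le_mass_farFrom (θs := θs) hε hsp P
  have hγ := hs.pos
  refine (hs.labelMean_mono fun y => hs.labelMean_mono fun z =>
    hs.farPotential_le hε hsp S P x y z).trans (le_of_eq ?_)
  simp only [labelMean_const_mul]
  congr 1
  have i : ∀ Q : Sample X, Integrable (fun θ' => √(mass Θ γ θs Q (farFrom D γ (2 * ε) θ') /
      mass Θ γ θs P (farFrom D γ (2 * ε) θ'))) (posterior Θ γ S) := fun Q =>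
    integrable_of_bounds ((measurable_mass_farFrom hs Q _).div
      (measurable_mass_farFrom hs P _)).sqrt (a := 0) (b := √((γ ^ Q.length)⁻¹ / c))
      (fun t => Real.sqrt_nonneg _)
      (fun t => Real.sqrt_le_sqrt (div_le_div₀ (by positivity) (hs.mass_le Q _) hc (h t)))
  have im : ∀ f : Bool → Vec d → ℝ, (∀ y, Integrable (f y) (posterior Θ γ S)) →
      Integrable (fun θ' => labelMean (clippedHyp X γ θs x) fun y => f y θ') (posterior Θ γ S) ∧
      labelMean (clippedHyp X γ θs x) (fun y => ∫ θ', f y θ' ∂(posterior Θ γ S)) =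
        ∫ θ', labelMean (clippedHyp X γ θs x) (fun y => f y θ') ∂(posterior Θ γ S) := by
    intro f hf
    refine ⟨((hf true).const_mul _).add ((hf false).const_mul _), ?_⟩
    simp only [labelMean]
    rw [integral_add ((hf true).const_mul _) ((hf false).const_mul _), integral_const_mul,
      integral_const_mul]
  simp only [farAffinity, ← hs.labelMean_sqrt_mass P x (measurableSet_farFrom D γ (2 * ε) _)]
  simp only [fun y => (im (fun z θ' => √(mass Θ γ θs ((x, z) :: (x, y) :: P)
    (farFrom D γ (2 * ε) θ') / mass Θ γ θs P (farFrom D γ (2 * ε) θ'))) fun z => i _).2]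
  exact (im _ fun y => (im _ fun z => i _).1).2

/-- Exposure is decided by the queried points, not their labels, and persists within a phase because
`S` is fixed. While nothing is exposed, the progress must come from the far affinity. -/
lemma labelMean_stoppedPotential_le {argmax : (X → ℝ) → X} {κ : ℝ}
    (hp : HasProgress D Θ γ ε argmax θs κ) (S P : Sample X) :
    labelMean (clippedHyp X γ θs (nextQuery D Θ γ ε argmax S P)) (fun y =>
      labelMean (clippedHyp X γ θs (nextQuery D Θ γ ε argmax S P)) fun z =>
        stoppedPotential D Θ γ ε θs κ S ((nextQuery D Θ γ ε argmax S P, z) ::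
          (nextQuery D Θ γ ε argmax S P, y) :: P)) ≤
      (1 - κ) * stoppedPotential D Θ γ ε θs κ S P := by
  have := hs.isProbabilityMeasure_posterior S
  have hp' := hp S P
  set x := nextQuery D Θ γ ε argmax S P
  have hκ : 0 ≤ 1 - κ := by
    rcases hp' with h | h
    · exact (affinity_nonneg (hs.hyp_pos θs x).le (hs.hyp_lt_one θs x).le _).trans h
    · exact (integral_nonneg fun θ' => (hs.farAffinity_mem_Icc hε hsp θs P x θ').1).trans h
  have hF : ∀ Q, 0 ≤ stoppedPotential D Θ γ ε θs κ S Q := fun Q => by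
    unfold stoppedPotential; split_ifs; exacts [le_rfl, (Real.exp_pos _).le]
  -- If one extension is not exposed, neither an earlier point nor the new point `x` is.
  by_cases hex : ∀ y z, IsExposed Θ γ θs κ S ((x, z) :: (x, y) :: P)
  · have h0 : ∀ y z, stoppedPotential D Θ γ ε θs κ S ((x, z) :: (x, y) :: P) = 0 :=
      fun y z => if_pos (hex y z)
    simp only [h0, labelMean_const]
    exact mul_nonneg hκ (hF P)
  · push Not at hex
    obtain ⟨y₀, z₀, hyz⟩ := hex
    have hP : ¬ IsExposed Θ γ θs κ S P := fun ⟨x', hx', h⟩ => hyz ⟨x', by simp at hx' ⊢; tauto, h⟩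
    have hx : ¬ affinity (clippedHyp X γ θs x) (fun θ => clippedHyp X γ θ x)
      (posterior Θ γ S) ≤ 1 - κ := fun h => hyz ⟨x, by simp, h⟩
    have hle : ∀ Q, stoppedPotential D Θ γ ε θs κ S Q ≤ farPotential D Θ γ ε θs S Q := fun Q => by
      unfold stoppedPotential; split_ifs; exacts [(Real.exp_pos _).le, le_rfl]
    calc _ ≤ _ := hs.labelMean_mono fun y => hs.labelMean_mono fun z => hle _
      _ ≤ _ := hs.labelMean_farPotential_le hε hsp S P x
      _ ≤ farPotential D Θ γ ε θs S P * (1 - κ) :=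
        mul_le_mul_of_nonneg_left (hp'.resolve_left hx) (Real.exp_pos _).le
      _ = _ := by rw [stoppedPotential, if_neg hP, mul_comm]

lemma expect_iterations_le {argmax : (X → ℝ) → X} {κ : ℝ} (hκ : κ ≤ 1)
    (hp : HasProgress D Θ γ ε argmax θs κ) (S : Sample X) (j : ℕ) :
    (iterations D Θ γ ε argmax S j).expect (clippedHyp X γ θs)
      (stoppedPotential D Θ γ ε θs κ S) ≤ (1 - κ) ^ j := by
  have := hs.isProbabilityMeasure_posterior S
  induction j with
  | zero =>
    rw [iterations, QueryAlg.expect_pure, pow_zero, stoppedPotential, if_neg (by simp [IsExposed])]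
    refine Real.exp_le_one_iff.2 (div_nonpos_of_nonpos_of_nonneg
      (integral_nonpos fun θ' => Real.log_nonpos (mass_nonneg _ _) ?_) zero_le_two)
    simpa using hs.mass_le (θs := θs) ([] : Sample X) (farFrom D γ (2 * ε) θ')
  | succ j ih =>
    rw [iterations, QueryAlg.expect_bind, pow_succ']
    refine le_trans (hs.expect_mono (QueryAlg.allResults_true _ fun P => ?_))
      ((QueryAlg.expect_const_mul _ _ (1 - κ) _).trans_le
        (mul_le_mul_of_nonneg_left ih (sub_nonneg.2 hκ)))
    simp only [QueryAlg.expect_bind, QueryAlg.expect_ask, QueryAlg.expect_pure]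
    exact hs.labelMean_stoppedPotential_le hε hsp hp S P

-- The far set of every `θ'` is heavy if the failure set is: when `θ'` is at least `3ε` from the
-- truth it contains the `ε`-neighbourhood of the truth, otherwise it contains all hypotheses of
-- error above `8ε`. So a small geometric mean forces a small failure mass.
open Classical in
lemma failure_le {n : ℕ} {B : ℝ} (hB : 0 < B) (hm : HasMassBound D Θ γ ε θs n B) (κ : ℝ)
    (S : Sample X) {P : Sample X} (hP : P.length ≤ n) :
    failure D Θ γ ε θs P ≤ (if IsExposed Θ γ θs κ S P then 1 else 0) +
      Real.exp B * stoppedPotential D Θ γ ε θs κ S P + Real.exp (-B) := by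
  have := hs.isProbabilityMeasure_posterior S
  have := hs.isProbabilityMeasure_posterior P
  have h1 : failure D Θ γ ε θs P ≤ 1 := measureReal_le_one
  have hexp := Real.exp_pos (-B)
  by_cases hex : IsExposed Θ γ θs κ S P
  · simp only [hex, stoppedPotential, if_true]; linarith
  simp only [hex, stoppedPotential, if_false, zero_add]
  -- If the potential is at least `exp (-B)`, the middle term is at least 1 and the bound is
  -- trivial.
  by_cases hW : Real.exp (-B) ≤ farPotential D Θ γ ε θs S P
  · have := mul_le_mul_of_nonneg_left hW (Real.exp_pos B).le
    rw [← Real.exp_add, add_neg_cancel, Real.exp_zero] at this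
    linarith
  push Not at hW
  rw [farPotential, Real.exp_lt_exp] at hW
  suffices h : failure D Θ γ ε θs P ≤ Real.exp (-B) by
    have : 0 ≤ Real.exp B * farPotential D Θ γ ε θs S P :=
      mul_nonneg (Real.exp_pos _).le (Real.exp_pos _).le
    linarith
  rw [failure_eq]
  have hN := hm P Set.univ hP fun _ _ => Set.mem_univ _
  set o := mass Θ γ θs P {θ | 8 * ε < l2Dist D (clippedHyp X γ θs) (clippedHyp X γ θ)}
  -- One factor `exp (-B)` is lost to the normalization of the posterior, whose total mass may be as
  -- small as that.
  suffices h : o ≤ Real.exp (-B) * Real.exp (-B) by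
    rw [div_le_iff₀ (hexp.trans_le hN)]
    exact h.trans (mul_le_mul_of_nonneg_left hN hexp.le)
  by_contra! ho
  rw [← Real.exp_add] at ho
  have ho' : -B + -B < Real.log o := (Real.lt_log_iff_exp_lt ((Real.exp_pos _).trans ho)).2 ho
  have key : ∀ θ', min (-B) (Real.log o) ≤
      Real.log (mass Θ γ θs P (farFrom D γ (2 * ε) θ')) := by
    intro θ'
    rcases le_or_gt (3 * ε) (l2Dist D (clippedHyp X γ θ') (clippedHyp X γ θs)) with h | h
    · refine (min_le_left _ _).trans ?_
      rw [Real.le_log_iff_exp_le (hs.mass_farFrom_pos hε hsp P θ')]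
      refine hm P _ hP fun θ hθ => ?_
      have := l2Dist_triangle D (clippedHyp X γ θ') (clippedHyp X γ θ) (clippedHyp X γ θs)
      simp only [farFrom, Set.mem_ofPred_eq]
      linarith
    · refine (min_le_right _ _).trans (Real.log_le_log ((Real.exp_pos _).trans ho)
        (hs.mass_mono P fun θ hθ => ?_))
      have := l2Dist_triangle D (clippedHyp X γ θs) (clippedHyp X γ θ') (clippedHyp X γ θ)
      rw [l2Dist_comm D _ (clippedHyp X γ θ')] at this
      simp only [farFrom, Set.mem_ofPred_eq] at hθ ⊢
      linarith
  have hint := integral_mono (μ := posterior Θ γ S) (integrable_const _)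
    (hs.integrable_log_mass hε hsp S P) key
  simp only [integral_const, probReal_univ, one_smul] at hint
  have : -B + -B < min (-B) (Real.log o) := lt_min (by linarith) ho'
  linarith

end Phase

section QueryTwice

lemma labelMean_sqrt_mass_cons_le (S : Sample X) (x : X) (A : Set (Vec d)) :
    labelMean (clippedHyp X γ θs x) (fun y => √(mass Θ γ θs ((x, y) :: S) A)) ≤
      √(mass Θ γ θs S A) := by
  rw [← hs.labelMean_mass S x A]
  exact labelMean_sqrt_le (hs.hyp_pos θs x).le (hs.hyp_lt_one θs x).le fun y => mass_nonneg _ _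

lemma expect_queryTwice_le (A : Set (Vec d)) (L : List X) (S : Sample X) :
    (QueryAlg.expect (clippedHyp X γ θs) (queryTwice L) fun Y => √(mass Θ γ θs (Y ++ S) A)) ≤
      √(mass Θ γ θs S A) := by
  induction L generalizing S with
  | nil => exact le_rfl
  | cons x L ih =>
    simp only [queryTwice, QueryAlg.expect_bind, QueryAlg.expect_ask, QueryAlg.expect_pure]
    refine le_trans (hs.labelMean_mono fun y => ?_) (hs.labelMean_sqrt_mass_cons_le S x A)
    refine le_trans (hs.labelMean_mono fun z => ?_)
      (hs.labelMean_sqrt_mass_cons_le ((x, y) :: S) x A)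
    refine le_trans (le_of_eq ?_) (ih ((x, z) :: (x, y) :: S))
    congr 1; ext Y
    rw [mass_perm]
    simp only [List.cons_append]
    exact (List.Perm.swap _ _ _).trans
      ((List.perm_middle.symm.cons _).trans List.perm_middle.symm)

/-- One exposed point suffices: the labels of all other points can be averaged out by Jensen, as the
mass does not depend on the order of the labels. -/
lemma expect_queryTwice_le_of_mem (A : Set (Vec d)) {L : List X} {x : X} (hx : x ∈ L)
    (S : Sample X) :
    (QueryAlg.expect (clippedHyp X γ θs) (queryTwice L) fun Y => √(mass Θ γ θs (Y ++ S) A)) ≤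
      labelMean (clippedHyp X γ θs x) fun y => labelMean (clippedHyp X γ θs x) fun z =>
        √(mass Θ γ θs ((x, z) :: (x, y) :: S) A) := by
  induction L generalizing S with
  | nil => simp at hx
  | cons w L ih =>
    simp only [queryTwice, QueryAlg.expect_bind, QueryAlg.expect_ask, QueryAlg.expect_pure]
    have hperm : ∀ (Y : Sample X) (y z : Bool), mass Θ γ θs ((w, y) :: (w, z) :: Y ++ S) A =
        mass Θ γ θs (Y ++ ((w, z) :: (w, y) :: S)) A := fun Y y z => by
      rw [mass_perm]
      simp only [List.cons_append]
      exact (List.Perm.swap _ _ _).trans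
        ((List.perm_middle.symm.cons _).trans List.perm_middle.symm)
    simp only [hperm]
    rcases List.mem_cons.1 hx with rfl | hx
    · exact hs.labelMean_mono fun y => hs.labelMean_mono fun z => hs.expect_queryTwice_le A L _
    · refine le_trans (hs.labelMean_mono fun y => hs.labelMean_mono fun z => ih hx _) ?_
      have hswap : ∀ y z y' z', mass Θ γ θs ((x, z') :: (x, y') :: (w, z) :: (w, y) :: S) A =
          mass Θ γ θs ((w, z) :: (w, y) :: (x, z') :: (x, y') :: S) A := fun y z y' z' => by
        rw [mass_perm]
        exact List.perm_append_comm_assoc [(x, z'), (x, y')] [(w, z), (w, y)] S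
      simp only [hswap]
      have e : ∀ (s t : ℝ) (g : Bool → Bool → Bool → Bool → ℝ),
          labelMean s (fun y => labelMean s fun z => labelMean t fun y' => labelMean t fun z' =>
            g y z y' z') =
          labelMean t (fun y' => labelMean t fun z' => labelMean s fun y => labelMean s fun z =>
            g y z y' z') := fun s t g => by simp only [labelMean]; ring
      rw [e]
      refine hs.labelMean_mono fun y' => hs.labelMean_mono fun z' => ?_
      exact le_trans (hs.labelMean_mono fun y => hs.labelMean_sqrt_mass_cons_le _ w A)
        (hs.labelMean_sqrt_mass_cons_le _ w A)

open Classical in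
/-- The expected logarithm of the mass decreases when a list with an exposed point is queried. -/
lemma expect_log_mass_le {κ : ℝ} (S P : Sample X) {L : List X}
    (hL : ∀ x ∈ P.map Prod.fst, x ∈ L) :
    (QueryAlg.expect (clippedHyp X γ θs) (queryTwice L) fun Y =>
      Real.log (mass Θ γ θs (Y ++ S) Set.univ) / 2) ≤
      Real.log (mass Θ γ θs S Set.univ) / 2 - (if IsExposed Θ γ θs κ S P then κ else 0) := by
  set N := mass Θ γ θs S Set.univ with hN
  have hN0 : 0 < N := hs.mass_univ_pos S
  have hsq : 0 < √N := Real.sqrt_pos.2 hN0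
  -- This is `log t ≤ t - 1` at the ratio `t` of the square roots of the new and the old mass.
  have h1 : (QueryAlg.expect (clippedHyp X γ θs) (queryTwice L) fun Y =>
      Real.log (mass Θ γ θs (Y ++ S) Set.univ) / 2) ≤ (Real.log N / 2 - 1) + (√N)⁻¹ *
        (QueryAlg.expect (clippedHyp X γ θs) (queryTwice L) fun Y =>
          √(mass Θ γ θs (Y ++ S) Set.univ)) := by
    rw [← QueryAlg.expect_const_mul,
      ← QueryAlg.expect_const (clippedHyp X γ θs) (queryTwice L) (Real.log N / 2 - 1),
      ← QueryAlg.expect_add]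
    refine hs.expect_mono (QueryAlg.allResults_true _ fun Y => ?_)
    have hY := hs.mass_univ_pos (θs := θs) (Y ++ S)
    have := Real.log_le_sub_one_of_pos (div_pos (Real.sqrt_pos.2 hY) hsq)
    rw [Real.log_div (Real.sqrt_pos.2 hY).ne' hsq.ne', Real.log_sqrt hY.le, Real.log_sqrt hN0.le,
      div_eq_inv_mul (√_) (√N)] at this
    linarith
  refine h1.trans ?_
  by_cases hex : IsExposed Θ γ θs κ S P
  · rw [if_pos hex]
    obtain ⟨x, hx, haff⟩ := hex
    have h2 := hs.expect_queryTwice_le_of_mem (θs := θs) (Θ := Θ) Set.univ (hL x hx) S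
    have h3 := hs.labelMean_sqrt_mass (θs := θs) S x MeasurableSet.univ
    have := hs.isProbabilityMeasure_posterior S
    rw [cond_univ, ← hN] at h3
    simp only [Real.sqrt_div' _ hN0.le, div_eq_inv_mul _ (√N), labelMean_const_mul] at h3
    have h4 := mul_le_mul_of_nonneg_left h2 (inv_pos.2 hsq).le
    linarith
  · rw [if_neg hex]
    have h2 := hs.expect_queryTwice_le (θs := θs) (Θ := Θ) Set.univ L S
    have h4 := mul_le_mul_of_nonneg_left h2 (inv_pos.2 hsq).le
    rw [← hN, inv_mul_cancel₀ hsq.ne'] at h4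
    linarith

end QueryTwice

end IsSetting

end ActiveLogistic

end

/-! ### Query counts and the sum over phases. -/

noncomputable section

namespace ActiveLogistic

variable {d : ℕ} {X : Finset (Vec d)} {D : PMF X} {Θ : Set (Vec d)} {R₁ R₂ γ ε : ℝ} {θs : Vec d}
  {argmax : (X → ℝ) → X}

section Size

lemma numQueries_ask {X : Type} (x : X) : (QueryAlg.ask x).numQueries = 1 := by
  simp [QueryAlg.ask, QueryAlg.numQueries]

lemma numQueries_ask_ask_le {X α : Type} {x x' : X} {k : Bool → Bool → QueryAlg X α} {n : ℕ}
    (hk : ∀ y z, (k y z).numQueries ≤ n) :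
    (QueryAlg.ask x >>= fun y => QueryAlg.ask x' >>= fun z => k y z).numQueries ≤ 2 + n := by
  refine (QueryAlg.numQueries_bind_le (QueryAlg.allResults_true _ fun y =>
    QueryAlg.numQueries_bind_le (QueryAlg.allResults_true _ fun z => hk y z))).trans ?_
  rw [numQueries_ask, numQueries_ask]; omega

lemma iterations_length (S : Sample X) (j : ℕ) :
    (iterations D Θ γ ε argmax S j).AllResults fun P => P.length = 2 * j := by
  induction j with
  | zero => exact (rfl : ([] : Sample X).length = 0)
  | succ j ih =>
    refine ih.bind fun P hP => ?_
    refine (QueryAlg.allResults_true (P := fun _ => True) _ fun _ => trivial).bind fun y _ => ?_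
    refine (QueryAlg.allResults_true (P := fun _ => True) _ fun _ => trivial).bind fun z _ => ?_
    change List.length (_ :: _ :: P) = _
    simp [hP]; ring

lemma iterations_numQueries (S : Sample X) (j : ℕ) :
    (iterations D Θ γ ε argmax S j).numQueries ≤ 2 * j := by
  induction j with
  | zero => exact le_rfl
  | succ j ih =>
    refine (QueryAlg.numQueries_bind_le (n := 2) (QueryAlg.allResults_true _ fun P => ?_)).trans
      (by omega)
    exact numQueries_ask_ask_le (n := 0) fun y z => le_rfl

lemma queryTwice_length {X : Type} (L : List X) :
    (queryTwice L).AllResults fun Y => Y.length = 2 * L.length := by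
  induction L with
  | nil => exact (rfl : ([] : Sample X).length = 0)
  | cons x L ih =>
    refine (QueryAlg.allResults_true (P := fun _ => True) _ fun _ => trivial).bind fun y _ => ?_
    refine (QueryAlg.allResults_true (P := fun _ => True) _ fun _ => trivial).bind fun z _ => ?_
    refine ih.bind fun Y hY => ?_
    change List.length (_ :: _ :: Y) = _
    simp [hY]; ring

lemma queryTwice_numQueries {X : Type} (L : List X) :
    (queryTwice L).numQueries ≤ 2 * L.length := by
  induction L with
  | nil => exact le_rfl
  | cons x L ih =>
    refine (numQueries_ask_ask_le (n := 2 * L.length) fun y z => ?_).trans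
      (by simp only [List.length_cons]; omega)
    refine (QueryAlg.numQueries_bind_le (n := 0)
      (QueryAlg.allResults_true _ fun Y => le_rfl)).trans (by omega)

lemma phases_length (M i : ℕ) :
    (phases D Θ γ ε argmax M i).AllResults fun p => p.1.length ≤ 4 * M * i ∧ p.2.length = i := by
  classical
  induction i with
  | zero => exact ⟨le_rfl, rfl⟩
  | succ i ih =>
    refine ih.bind fun p hp => ?_
    obtain ⟨S, Ps⟩ := p
    refine (iterations_length S M).bind fun P hP => ?_
    refine (queryTwice_length _).bind fun Y hY => ?_
    refine ⟨?_, ?_⟩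
    · have := (List.dedup_sublist (P.map Prod.fst)).length_le
      simp only [List.length_map] at this
      have h2 : (Y ++ S).length ≤ 4 * M * (i + 1) := by
        rw [List.length_append, hY]
        have := hp.1
        simp only at this
        rw [mul_add]
        refine add_comm (4 * M * i) _ ▸ Nat.add_le_add ?_ this
        refine (Nat.mul_le_mul_left 2 ((List.dedup_sublist _).length_le)).trans ?_
        rw [List.length_map, hP]; omega
      exact h2
    · change (P :: Ps).length = i + 1
      rw [List.length_cons, hp.2]

/-- A phase asks `2M` labels while iterating. Bounding the number of distinct points crudely by the
`2M` recorded labels gives `4M` more. -/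
lemma phases_numQueries (M i : ℕ) :
    (phases D Θ γ ε argmax M i).numQueries ≤ 6 * M * i := by
  induction i with
  | zero => exact le_rfl
  | succ i ih =>
    refine (QueryAlg.numQueries_bind_le (n := 6 * M) (QueryAlg.allResults_true _ fun p => ?_)).trans
      (by rw [mul_add]; omega)
    obtain ⟨S, Ps⟩ := p
    change (QueryAlg.numQueries (_ >>= _)) ≤ _
    refine (QueryAlg.numQueries_bind_le (n := 4 * M) ?_).trans
      (by have := iterations_numQueries (D := D) (Θ := Θ) (γ := γ) (ε := ε) (argmax := argmax) S M
          omega)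
    refine QueryAlg.allResults_mono (fun P hP => ?_) (iterations_length S M)
    refine (QueryAlg.numQueries_bind_le (n := 0)
      (QueryAlg.allResults_true _ fun Y => le_rfl)).trans ?_
    refine (queryTwice_numQueries _).trans ?_
    refine (Nat.mul_le_mul_left 2 ((List.dedup_sublist _).length_le)).trans ?_
    rw [List.length_map, hP]; omega

lemma clippedActive_numQueries (K M : ℕ) :
    (clippedActive D Θ γ ε argmax K M).numQueries ≤ 6 * M * K := by
  refine (QueryAlg.numQueries_bind_le (n := 0) (QueryAlg.allResults_true _ fun p => ?_)).trans
    (phases_numQueries M K)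
  exact le_rfl

end Size

namespace IsSetting

variable (hs : IsSetting X Θ R₁ R₂ γ)
include hs

/-- An exposed phase may fail with probability up to 1, but then the half log-mass drops by `κ` in
expectation, and the weight `κ⁻¹` makes this pay for the failure. Other phases cost at most `c` in
expectation. -/
lemma expect_phases_le (hε : 0 < ε) (hsp : IsSpread D Θ γ ε) {κ : ℝ} (hκ0 : 0 < κ) (hκ : κ ≤ 1)
    (hp : HasProgress D Θ γ ε argmax θs κ) {n : ℕ} {B : ℝ} (hB : 0 < B)
    (hm : HasMassBound D Θ γ ε θs n B) {M : ℕ} (hM : 2 * M ≤ n) (i : ℕ) :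
    (phases D Θ γ ε argmax M i).expect (clippedHyp X γ θs) (fun p =>
      (p.2.map (failure D Θ γ ε θs)).sum + κ⁻¹ * (Real.log (mass Θ γ θs p.1 Set.univ) / 2)) ≤
      i * (Real.exp B * (1 - κ) ^ M + Real.exp (-B)) := by
  classical
  have := hs.isProbabilityMeasure_cond
  set c := Real.exp B * (1 - κ) ^ M + Real.exp (-B) with hc
  induction i with
  | zero => simp [phases, QueryAlg.expect_pure, mass, ratio, weight_nil]
  | succ i ih =>
    rw [phases, QueryAlg.expect_bind]
    have key : ∀ p : Sample X × List (Sample X),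
        QueryAlg.expect (clippedHyp X γ θs) (do
          let P ← iterations D Θ γ ε argmax p.1 M
          let Y ← queryTwice (P.map Prod.fst).dedup
          pure (Y ++ p.1, P :: p.2)) (fun p => (p.2.map (failure D Θ γ ε θs)).sum +
            κ⁻¹ * (Real.log (mass Θ γ θs p.1 Set.univ) / 2)) ≤
        ((p.2.map (failure D Θ γ ε θs)).sum +
          κ⁻¹ * (Real.log (mass Θ γ θs p.1 Set.univ) / 2)) + c := by
      rintro ⟨S, Ps⟩
      simp only [QueryAlg.expect_bind, QueryAlg.expect_pure, List.map_cons, List.sum_cons]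
      set T := (Ps.map (failure D Θ γ ε θs)).sum
      set N := Real.log (mass Θ γ θs S Set.univ) / 2
      have e : (iterations D Θ γ ε argmax S M).AllResults fun P =>
          (QueryAlg.expect (clippedHyp X γ θs) (queryTwice (P.map Prod.fst).dedup) fun Y =>
            failure D Θ γ ε θs P + T + κ⁻¹ *
              (Real.log (mass Θ γ θs (Y ++ S) Set.univ) / 2)) ≤
          (T + κ⁻¹ * N + Real.exp (-B)) + Real.exp B * stoppedPotential D Θ γ ε θs κ S P := by
        refine QueryAlg.allResults_mono (fun P hP => ?_) (iterations_length S M)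
        rw [QueryAlg.expect_add, QueryAlg.expect_const, QueryAlg.expect_const_mul]
        have h1 := hs.failure_le hε hsp hB hm κ S (P := P) (by omega)
        have h2 := hs.expect_log_mass_le (θs := θs) (Θ := Θ) (κ := κ) S P
          (L := (P.map Prod.fst).dedup) fun x hx => List.mem_dedup.2 hx
        have h3 := mul_le_mul_of_nonneg_left h2 (inv_pos.2 hκ0).le
        rw [mul_sub, mul_ite, inv_mul_cancel₀ hκ0.ne', mul_zero] at h3
        change _ ≤ κ⁻¹ * N - _ at h3
        split_ifs at h1 h3 <;> linarith
      refine (hs.expect_mono e).trans ?_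
      rw [QueryAlg.expect_add, QueryAlg.expect_const, QueryAlg.expect_const_mul]
      have := mul_le_mul_of_nonneg_left
        (hs.expect_iterations_le (argmax := argmax) hε hsp hκ hp S M) (Real.exp_pos B).le
      rw [hc]; linarith
    refine (hs.expect_mono (QueryAlg.allResults_true _ fun p => key p)).trans ?_
    rw [QueryAlg.expect_add, QueryAlg.expect_const]
    push_cast
    linarith

/-- The expected total failure probability of the phases. -/
lemma expect_sum_failure_le (hε : 0 < ε) (hsp : IsSpread D Θ γ ε) {κ : ℝ} (hκ0 : 0 < κ)
    (hκ : κ ≤ 1) (hp : HasProgress D Θ γ ε argmax θs κ) {K M : ℕ} (hK : 1 ≤ K) {B : ℝ} (hB : 0 < B)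
    (hm : HasMassBound D Θ γ ε θs (4 * M * K) B) :
    (phases D Θ γ ε argmax M K).expect (clippedHyp X γ θs) (fun p =>
      (p.2.map (failure D Θ γ ε θs)).sum) ≤
      K * (Real.exp B * (1 - κ) ^ M + Real.exp (-B)) + B / (2 * κ) := by
  have hM : 2 * M ≤ 4 * M * K := by nlinarith
  have h1 := hs.expect_phases_le hε hsp hκ0 hκ hp hB hm hM K
  have h2 : (phases D Θ γ ε argmax M K).expect (clippedHyp X γ θs) (fun p =>
      (p.2.map (failure D Θ γ ε θs)).sum + -(B / (2 * κ))) ≤ _ :=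
    (hs.expect_mono (QueryAlg.allResults_mono (fun p hp' => ?_) (phases_length M K))).trans h1
  · rw [QueryAlg.expect_add, QueryAlg.expect_const] at h2
    linarith
  -- The log-mass starts at 0 and never falls below `-B`, so the amortized payment is at most `B /
  -- (2κ)`.
  · have h3 := hm p.1 Set.univ hp'.1 fun _ _ => Set.mem_univ _
    rw [← Real.le_log_iff_exp_le (hs.mass_univ_pos p.1)] at h3
    have : -(B / (2 * κ)) = κ⁻¹ * (-B / 2) := by field_simp
    rw [this]
    have := mul_le_mul_of_nonneg_left (div_le_div_of_nonneg_right h3 zero_le_two)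
      (inv_pos.2 hκ0).le
    linarith

lemma one_sub_failure_le (P : Sample X) :
    ENNReal.ofReal (1 - failure D Θ γ ε θs P) ≤ posterior Θ γ P
      (clippedHyp X γ ⁻¹' {h | h ∈ clippedClass X Θ γ ∧ err D (clippedHyp X γ θs) h ≤ 8 * ε}) := by
  have := hs.isProbabilityMeasure_posterior P
  set F := {θ | 8 * ε < l2Dist D (clippedHyp X γ θs) (clippedHyp X γ θ)} with hF
  have hFm : MeasurableSet F := measurableSet_failure
  have h1 : 1 - failure D Θ γ ε θs P = (posterior Θ γ P).real Fᶜ := by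
    rw [probReal_compl_eq_one_sub hFm]; rfl
  rw [h1, Measure.real, ENNReal.ofReal_toReal (measure_ne_top _ _)]
  refine measure_mono_ae ?_
  filter_upwards [hs.ae_mem_posterior P] with θ hθ hθF
  refine ⟨⟨θ, hθ, rfl⟩, ?_⟩
  rw [err, l2Dist_comm]
  exact not_lt.1 hθF

/-- The success probability of the algorithm. -/
lemma le_outputLaw_clippedActive {K M : ℕ} (hK : 1 ≤ K) {δ : ℝ}
    (hδ : (phases D Θ γ ε argmax M K).expect (clippedHyp X γ θs) (fun p =>
      (p.2.map (failure D Θ γ ε θs)).sum) ≤ K * δ) :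
    ENNReal.ofReal (1 - δ) ≤
      (clippedActive D Θ γ ε argmax K M).outputLaw (clippedHyp X γ θs)
        {h | h ∈ clippedClass X Θ γ ∧ err D (clippedHyp X γ θs) h ≤ 8 * ε} := by
  set E := {h | h ∈ clippedClass X Θ γ ∧ err D (clippedHyp X γ θs) h ≤ 8 * ε} with hE
  have hK' : (0 : ℝ) < K := by exact_mod_cast hK
  have hsum : ∀ Ps : List (Sample X), ENNReal.ofReal (Ps.length -
      (Ps.map (failure D Θ γ ε θs)).sum) ≤
        (Ps.map (posterior Θ γ)).sum (clippedHyp X γ ⁻¹' E) := by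
    intro Ps
    induction Ps with
    | nil => simp
    | cons P Ps ih =>
      simp only [List.length_cons, List.map_cons, List.sum_cons, Measure.add_apply]
      refine le_trans (le_of_eq ?_) (ENNReal.ofReal_add_le.trans
        (add_le_add (hs.one_sub_failure_le P) ih))
      congr 1; push_cast; ring
  have key : (phases D Θ γ ε argmax M K).AllResults fun p =>
      ENNReal.ofReal (1 + -(K : ℝ)⁻¹ * (p.2.map (failure D Θ γ ε θs)).sum) ≤
        (((K : ℝ≥0∞)⁻¹ • (p.2.map (posterior Θ γ)).sum).map (clippedHyp X γ)) E := by
    refine QueryAlg.allResults_mono (fun p hp => ?_) (phases_length M K)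
    -- The inequality holds for arbitrary sets, so the success event, which involves membership in
    -- the class, needs no measurability.
    refine le_trans ?_ (Measure.le_map_apply
      (continuous_clippedHyp_pi (γ := γ)).measurable.aemeasurable E)
    rw [Measure.smul_apply, smul_eq_mul]
    refine le_trans (le_of_eq ?_) (mul_le_mul_right (hsum p.2) _)
    rw [hp.2, ← ENNReal.ofReal_natCast K, ← ENNReal.ofReal_inv_of_pos hK',
      ← ENNReal.ofReal_mul (inv_nonneg.2 hK'.le)]
    congr 1
    field_simp
    ring
  refine le_trans (ENNReal.ofReal_le_ofReal ?_) (QueryAlg.expect_le_outputLaw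
    (fun x => (hs.hyp_pos θs x).le) (fun x => (hs.hyp_lt_one θs x).le) key)
  rw [QueryAlg.expect_add, QueryAlg.expect_const, QueryAlg.expect_const_mul]
  have := mul_le_mul_of_nonneg_left hδ (inv_nonneg.2 hK'.le)
  rw [inv_mul_cancel_left₀ hK'.ne'] at this
  linarith

end IsSetting

end ActiveLogistic

end

/-! ### Numerical choice of the budget. -/

noncomputable section

namespace ActiveLogistic

variable {d : ℕ} {X : Finset (Vec d)} {D : PMF X} {Θ : Set (Vec d)} {R₁ R₂ γ ε : ℝ} {θs : Vec d}
  {argmax : (X → ℝ) → X}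

/-- The number of phases and of iterations, before rounding. -/
def budget (d m : ℕ) (R₁ R₂ γ ε : ℝ) : ℝ :=
  16 * 10 ^ 12 * (d * m ^ 8 * Real.log (1 / γ) ^ 5 * Real.log (d * R₁ * R₂ * m / ε))

lemma le_log_inv {γ : ℝ} (h0 : 0 < γ) (h1 : γ < 1 / 2) : 0.69 ≤ Real.log (1 / γ) := by
  have : Real.log 2 ≤ Real.log (1 / γ) :=
    Real.log_le_log (by norm_num) (by rw [le_div_iff₀ h0]; linarith)
  linarith [Real.log_two_gt_d9]

lemma le_log_size {d m R₁ R₂ ε : ℝ} (hd : 1 ≤ d) (hm : 1 ≤ m) (hε : 0 < ε)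
    (hR : 2 * ε ≤ R₁ * R₂) : 0.69 ≤ Real.log (d * R₁ * R₂ * m / ε) := by
  have : Real.log 2 ≤ Real.log (d * R₁ * R₂ * m / ε) := by
    refine Real.log_le_log (by norm_num) ?_
    rw [le_div_iff₀ hε]
    have : 1 * (2 * ε) ≤ (d * m) * (R₁ * R₂) := by
      gcongr
      nlinarith
    linarith
  linarith [Real.log_two_gt_d9]

/-- The mass bound depends on the sample size, of order `Q²`, and `Q` in turn on the mass bound. The
dependence is logarithmic, so the loop closes with a constant; here `u` stands for `R₁R₂/ε`. -/
lemma log_mul_sq_le {d m u L Λ Q : ℝ} (hd : 1 ≤ d) (hm : 1 ≤ m) (hu : 2 ≤ u) (hL : 0.69 ≤ L)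
    (hΛ : 0.69 ≤ Λ) (hΛ' : Λ = Real.log (d * u * m))
    (hQ : Q = 16 * 10 ^ 12 * (d * m ^ 8 * L ^ 5 * Λ)) :
    1 + d * Real.log (32 * u * Q ^ 2) ≤ 400 * d * L * Λ := by
  have hd0 : 0 < d := by linarith
  have hm0 : 0 < m := by linarith
  have hu0 : 0 < u := by linarith
  have hL0 : 0 < L := by linarith
  have hΛ0 : 0 < Λ := by linarith
  have ld : 0 ≤ Real.log d := Real.log_nonneg hd
  have lm : 0 ≤ Real.log m := Real.log_nonneg hm
  have lu : 0 ≤ Real.log u := Real.log_nonneg (by linarith)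
  have eΛ : Λ = Real.log d + Real.log u + Real.log m := by
    rw [hΛ', Real.log_mul (by positivity) hm0.ne', Real.log_mul hd0.ne' hu0.ne']
  have lL : Real.log L ≤ L := (Real.log_le_sub_one_of_pos hL0).trans (by linarith)
  have lΛ : Real.log Λ ≤ Λ := (Real.log_le_sub_one_of_pos hΛ0).trans (by linarith)
  have lc : Real.log (32 * (16 * 10 ^ 12) ^ 2) ≤ 65 := by
    have h1 : Real.log (32 * (16 * 10 ^ 12) ^ 2) ≤ Real.log (2 ^ 93) :=
      Real.log_le_log (by norm_num) (by norm_num)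
    rw [Real.log_pow] at h1
    push_cast at h1
    linarith [Real.log_two_lt_d9]
  have e : Real.log (32 * u * Q ^ 2) = Real.log (32 * (16 * 10 ^ 12) ^ 2) + Real.log u +
      2 * Real.log d + 16 * Real.log m + 10 * Real.log L + 2 * Real.log Λ := by
    rw [hQ, show 32 * u * (16 * 10 ^ 12 * (d * m ^ 8 * L ^ 5 * Λ)) ^ 2 =
      (32 * (16 * 10 ^ 12) ^ 2) * u * d ^ 2 * m ^ 16 * L ^ 10 * Λ ^ 2 by ring,
      Real.log_mul (by positivity) (by positivity), Real.log_mul (by positivity) (by positivity),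
      Real.log_mul (by positivity) (by positivity), Real.log_mul (by positivity) (by positivity),
      Real.log_mul (by positivity) (by positivity), Real.log_pow, Real.log_pow, Real.log_pow,
      Real.log_pow]
    push_cast; ring
  have h1 : Real.log (32 * u * Q ^ 2) ≤ 65 + 18 * Λ + 10 * L := by rw [e]; linarith
  have h2 : 66 + 18 * Λ + 10 * L ≤ 400 * (L * Λ) := by
    have a1 : 0.69 * Λ ≤ L * Λ := by gcongr
    have a2 : L * 0.69 ≤ L * Λ := by gcongr
    have a3 : 0.69 * 0.69 ≤ L * Λ := by gcongr
    norm_num at a1 a2 a3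
    linarith
  calc 1 + d * Real.log (32 * u * Q ^ 2) ≤ d * 1 + d * (65 + 18 * Λ + 10 * L) := by
        gcongr; linarith
    _ = d * (66 + 18 * Λ + 10 * L) := by ring
    _ ≤ d * (400 * (L * Λ)) := by gcongr
    _ = _ := by ring

section Budget

variable {m : ℕ} (hd : 1 ≤ d) (hm : 1 ≤ m) (hγ : 0 < γ) (hγ2 : γ < 1 / 2) (hε : 0 < ε)
  (hR : 2 * ε ≤ R₁ * R₂)
include hd hm hγ hγ2 hε hR

lemma one_le_budget : 1 ≤ budget d m R₁ R₂ γ ε := by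
  have hd' : (1 : ℝ) ≤ d := by exact_mod_cast hd
  have hm' : (1 : ℝ) ≤ m := by exact_mod_cast hm
  have hL := le_log_inv hγ hγ2
  have hΛ := le_log_size hd' hm' hε hR
  unfold budget
  have : (1 : ℝ) * 1 ^ 8 * 0.69 ^ 5 * 0.69 ≤
      d * m ^ 8 * Real.log (1 / γ) ^ 5 * Real.log (d * R₁ * R₂ * m / ε) := by gcongr
  norm_num at this ⊢
  linarith

/-- The argument needs only `m ^ 16` and the tenth power of `log (1/γ)`. The surplus factors `m ^ 4`
and `(2 log (1/γ)) ^ 16` are at least 1, whence the constant `2 ^ 16`. -/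
lemma ceil_budget_sq_le : 6 * (⌈budget d m R₁ R₂ γ ε⌉₊ : ℝ) * ⌈budget d m R₁ R₂ γ ε⌉₊ ≤
    24 * (16 * 10 ^ 12) ^ 2 * 2 ^ 16 * ((d : ℝ) ^ 2 * (m : ℝ) ^ 20 * Real.log (1 / γ) ^ 26 *
      Real.log (d * R₁ * R₂ * m / ε) ^ 2) := by
  have hm' : (1 : ℝ) ≤ m := by exact_mod_cast hm
  have hL := le_log_inv hγ hγ2
  have h1 := one_le_budget hd hm hγ hγ2 hε hR
  have h2 : (⌈budget d m R₁ R₂ γ ε⌉₊ : ℝ) ≤ 2 * budget d m R₁ R₂ γ ε := by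
    have := (Nat.ceil_lt_add_one (zero_le_one.trans h1)).le
    linarith
  have h3 : (1 : ℝ) ≤ (2 * Real.log (1 / γ)) ^ 16 := one_le_pow₀ (by linarith)
  have h4 : (1 : ℝ) ≤ (m : ℝ) ^ 4 := one_le_pow₀ hm'
  have h5 : (1 : ℝ) * 1 ≤ (2 * Real.log (1 / γ)) ^ 16 * (m : ℝ) ^ 4 := by gcongr
  set L := Real.log (1 / γ)
  set Λ := Real.log (d * R₁ * R₂ * m / ε)
  calc _ ≤ 6 * (2 * budget d m R₁ R₂ γ ε) * (2 * budget d m R₁ R₂ γ ε) := by gcongr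
    _ = 24 * (16 * 10 ^ 12) ^ 2 * (d ^ 2 * m ^ 16 * L ^ 10 * Λ ^ 2) * (1 * 1) := by
        unfold budget; ring
    _ ≤ 24 * (16 * 10 ^ 12) ^ 2 * (d ^ 2 * m ^ 16 * L ^ 10 * Λ ^ 2) *
        ((2 * L) ^ 16 * (m : ℝ) ^ 4) := by gcongr
    _ = _ := by ring

end Budget

lemma progress_eq {m : ℕ} (hm : 1 ≤ m) {γ : ℝ} (hγ : 0 < γ) (hγ2 : γ < 1 / 2) :
    progress γ (0.24 / (m : ℝ) ^ 2) =
      1 / (2 * 10 ^ 8 * ((m : ℝ) ^ 8 * Real.log (1 / γ) ^ 4)) := by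
  have := log_inv_pos hγ hγ2
  have : (0 : ℝ) < m := by exact_mod_cast hm
  unfold progress
  field_simp
  norm_num

lemma progress_pos {τ γ : ℝ} (hτ : 0 < τ) (hγ : 0 < γ) (hγ2 : γ < 1 / 2) : 0 < progress γ τ := by
  have := log_inv_pos hγ hγ2
  unfold progress
  positivity

lemma progress_le_one {m : ℕ} (hm : 1 ≤ m) {γ : ℝ} (hγ : 0 < γ) (hγ2 : γ < 1 / 2) :
    progress γ (0.24 / (m : ℝ) ^ 2) ≤ 1 := by
  have hL := le_log_inv hγ hγ2
  have hm' : (1 : ℝ) ≤ m := by exact_mod_cast hm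
  rw [progress_eq hm hγ hγ2, div_le_one (by positivity)]
  have : (2 * 10 ^ 8 * (1 ^ 8 * 0.69 ^ 4) : ℝ) ≤
    2 * 10 ^ 8 * ((m : ℝ) ^ 8 * Real.log (1 / γ) ^ 4) := by gcongr
  norm_num at this ⊢
  linarith

namespace IsSetting

variable (hs : IsSetting X Θ R₁ R₂ γ) (hε : 0 < ε)
include hs hε

lemma hasMassBound (hε1 : ε ≤ 1) (hθs : θs ∈ Θ) {n : ℕ} (hn : 1 ≤ n) {B : ℝ}
    (hB : 1 + d * Real.log (2 * (R₁ * R₂ / ε) * n) ≤ B) : HasMassBound D Θ γ ε θs n B := by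
  have h1 := hs.one_le_left
  have h2 := hs.one_le_right
  have hn' : (1 : ℝ) ≤ n := by exact_mod_cast hn
  have hRR : 1 ≤ R₁ * R₂ := one_le_mul_of_one_le_of_one_le h1 h2
  intro S A hS hA
  -- Then `2R₁R₂ηn = ε ≤ 1`: the likelihood ratio loses at most a factor `e` on the ball, which also
  -- lies in the `ε`-neighbourhood of the truth.
  set η := ε / (2 * (R₁ * R₂) * n) with hη
  have hη0 : 0 < η := by positivity
  have hRη : R₁ * R₂ * η * n = ε / 2 := by rw [hη]; field_simp
  have hη1 : R₁ * R₂ * η ≤ ε := by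
    have : R₁ * R₂ * η * 1 ≤ R₁ * R₂ * η * n := by gcongr
    linarith
  have hη2 : η ≤ 1 := by
    have : 1 * η ≤ R₁ * R₂ * η := by gcongr
    linarith
  refine le_trans ?_ (hs.exp_mul_pow_le_mass hθs hη0 hη2 (n := n) (by linarith) hS
    (hs.closedBall_subset (D := D) hη1 hA hε))
  have e : η = Real.exp (-Real.log (2 * (R₁ * R₂ / ε) * n)) := by
    rw [Real.exp_neg, Real.exp_log (by positivity), hη]; field_simp
  rw [e, ← Real.exp_nat_mul, ← Real.exp_add]
  exact Real.exp_le_exp.2 (by linarith)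

lemma expect_failure_le_of_separated (hε1 : ε ≤ 1) (hsp : IsSpread D Θ γ ε) (hd : 1 ≤ d) {m : ℕ}
    (hm : 1 ≤ m) (hR : 2 * ε ≤ R₁ * R₂)
    (hargmax : ∀ (r : X → ℝ) (x : X), r x ≤ r (argmax r)) (hθs : θs ∈ Θ)
    (hsep : ∀ S P : Sample X, ∃ x₀ : X, 0.24 / (m : ℝ) ^ 2 ≤
      ∫ θ, (clippedHyp X γ θ x₀ - ∫ θ', clippedHyp X γ θ' x₀
      ∂(samplingLaw D γ (posterior Θ γ S) (posterior Θ γ P) (2 * ε))) ^ 2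
      ∂(samplingLaw D γ (posterior Θ γ S) (posterior Θ γ P) (2 * ε))) :
    (phases D Θ γ ε argmax ⌈budget d m R₁ R₂ γ ε⌉₊ ⌈budget d m R₁ R₂ γ ε⌉₊).expect
      (clippedHyp X γ θs) (fun p => (p.2.map (failure D Θ γ ε θs)).sum) ≤
      (⌈budget d m R₁ R₂ γ ε⌉₊ : ℝ) * 0.01 := by
  have hγ := hs.pos
  have hγ2 := hs.lt_half
  have hd' : (1 : ℝ) ≤ d := by exact_mod_cast hd
  have hm' : (1 : ℝ) ≤ m := by exact_mod_cast hm
  have hL := le_log_inv hγ hγ2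
  have hΛ := le_log_size hd' hm' hε hR
  have hQ1 := one_le_budget hd hm hγ hγ2 hε hR
  set Q := budget d m R₁ R₂ γ ε with hQ
  set N := ⌈Q⌉₊ with hN
  have hQN : Q ≤ N := Nat.le_ceil Q
  have hN2 : (N : ℝ) ≤ 2 * Q := by
    have := (Nat.ceil_lt_add_one (zero_le_one.trans hQ1)).le
    linarith
  have hN1 : 1 ≤ N := by exact_mod_cast hQ1.trans hQN
  have hτ : (0 : ℝ) < 0.24 / (m : ℝ) ^ 2 := by positivity
  have hκ0 := progress_pos hτ hγ hγ2
  have hκ1 := progress_le_one hm hγ hγ2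
  have hκe := progress_eq hm hγ hγ2
  have hprog : HasProgress D Θ γ ε argmax θs (progress γ (0.24 / (m : ℝ) ^ 2)) := fun S P => by
    obtain ⟨x₀, hx₀⟩ := hsep S P
    exact hs.affinity_le_or hε hsp hargmax θs S P hτ hx₀
  set κ := progress γ (0.24 / (m : ℝ) ^ 2)
  set L := Real.log (1 / γ)
  set Λ := Real.log (d * R₁ * R₂ * m / ε) with hΛdef
  set B := 400 * d * L * Λ with hBdef
  have hB : 180 ≤ B := by
    have : 400 * 1 * 0.69 * 0.69 ≤ 400 * d * L * Λ := by gcongr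
    norm_num at this
    linarith
  -- The constant of the budget is `2·10⁸` from `κ` times `400` from `B` times `200`. The last
  -- factor makes `exp B (1-κ)^N` negligible and turns `B/(2κ)` into `Q/400`, so the three costs
  -- stay below `0.01 N`.
  have hQκ : Q * κ = 200 * B := by
    have hQ' : Q = 16 * 10 ^ 12 * (d * m ^ 8 * L ^ 5 * Λ) := rfl
    rw [hκe, hBdef, hQ']
    field_simp
    norm_num
  have hu : 2 ≤ R₁ * R₂ / ε := by rwa [le_div_iff₀ hε]
  have hmass : HasMassBound D Θ γ ε θs (4 * N * N) B := by
    have h4 : 2 * (R₁ * R₂ / ε) * ((4 * N * N : ℕ) : ℝ) ≤ 32 * (R₁ * R₂ / ε) * Q ^ 2 := by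
      push_cast
      calc 2 * (R₁ * R₂ / ε) * (4 * (N : ℝ) * N) ≤ 2 * (R₁ * R₂ / ε) * (4 * (2 * Q) * (2 * Q)) := by
            gcongr
        _ = _ := by ring
    refine hs.hasMassBound hε hε1 hθs (by nlinarith) (le_trans ?_ (log_mul_sq_le hd' hm' hu hL hΛ
      (by rw [hΛdef]; congr 1; ring) rfl))
    have h5 := Real.log_le_log (by positivity) h4
    have h6 := mul_le_mul_of_nonneg_left h5 (zero_le_one.trans hd')
    exact add_le_add_right h6 1
  refine (hs.expect_sum_failure_le hε hsp hκ0 hκ1 hprog hN1 (by linarith) hmass).trans ?_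
  have hN0 : (0 : ℝ) < N := by exact_mod_cast hN1
  have e1 : (1 - κ) ^ N ≤ Real.exp (-(200 * B)) := by
    calc (1 - κ) ^ N ≤ Real.exp (-κ) ^ N :=
          pow_le_pow_left₀ (by linarith) (Real.one_sub_le_exp_neg κ) _
      _ = Real.exp (-(N * κ)) := by rw [← Real.exp_nat_mul]; congr 1; ring
      _ ≤ _ := Real.exp_le_exp.2 (by
          rw [← hQκ]; exact neg_le_neg (mul_le_mul_of_nonneg_right hQN hκ0.le))
  have e2 : ∀ t : ℝ, 0 < t → Real.exp (-t) ≤ 1 / t := fun t ht => by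
    rw [Real.exp_neg, ← one_div]
    exact one_div_le_one_div_of_le ht (by linarith [Real.add_one_le_exp t])
  have e3 : Real.exp B * (1 - κ) ^ N ≤ 1 / 1000 := by
    calc _ ≤ Real.exp B * Real.exp (-(200 * B)) := by gcongr
      _ = Real.exp (-(199 * B)) := by rw [← Real.exp_add]; congr 1; ring
      _ ≤ 1 / (199 * B) := e2 _ (by linarith)
      _ ≤ 1 / 1000 := one_div_le_one_div_of_le (by norm_num) (by linarith)
  have e4 : Real.exp (-B) ≤ 1 / 180 :=
    (e2 B (by linarith)).trans (one_div_le_one_div_of_le (by norm_num) hB)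
  have e5 : B / (2 * κ) = Q / 400 := by
    rw [div_eq_div_iff (by positivity) (by norm_num)]; linarith
  rw [e5]
  have e6 : N * (Real.exp B * (1 - κ) ^ N + Real.exp (-B)) ≤ N * (1 / 1000 + 1 / 180) := by gcongr
  linarith

end IsSetting

end ActiveLogistic

end

/-! ### Separation of the sampled hypotheses, and solvability. -/

noncomputable section

namespace ActiveLogistic

variable {d : ℕ} {X : Finset (Vec d)} {D : PMF X} {Θ : Set (Vec d)} {R₁ R₂ γ ε : ℝ} {θs : Vec d}
  {argmax : (X → ℝ) → X}

namespace IsSetting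

variable (hs : IsSetting X Θ R₁ R₂ γ)
include hs

/-- The frontier of a convex set is null. Passing to the interior replaces `Θ`, which need not be
Borel, by an open set. -/
lemma posterior_compl_interior (S : Sample X) : posterior Θ γ S (interior Θ)ᶜ = 0 := by
  have h1 : ProbabilityTheory.cond volume Θ (interior Θ)ᶜ = 0 := by
    rw [cond_apply' isOpen_interior.measurableSet.compl, mul_eq_zero]
    right
    refine measure_mono_null ?_ (hs.convex.addHaar_frontier volume)
    exact fun θ hθ => ⟨subset_closure hθ.1, hθ.2⟩
  rw [posterior, Measure.smul_apply, withDensity_absolutelyContinuous _ _ h1, smul_zero]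

lemma ae_mem_samplingLaw (S P : Sample X) :
    ∀ᵐ θ ∂(samplingLaw D γ (posterior Θ γ S) (posterior Θ γ P) (2 * ε)), θ ∈ Θ := by
  have := hs.isProbabilityMeasure_posterior P
  have hm : MeasurableSet (interior Θ)ᶜ := isOpen_interior.measurableSet.compl
  have hb : (posterior Θ γ S).bind (fun θ' => ProbabilityTheory.cond (posterior Θ γ P)
      (farFrom D γ (2 * ε) θ')) (interior Θ)ᶜ = 0 := by
    rw [Measure.bind_apply hm (measurable_cond_farFrom D γ _ _).aemeasurable]
    have : ∀ θ', ProbabilityTheory.cond (posterior Θ γ P) (farFrom D γ (2 * ε) θ')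
        (interior Θ)ᶜ = 0 := fun θ' =>
      cond_absolutelyContinuous (hs.posterior_compl_interior P)
    simp [this]
  have h0 : samplingLaw D γ (posterior Θ γ S) (posterior Θ γ P) (2 * ε) (interior Θ)ᶜ = 0 := by
    rw [samplingLaw, Measure.add_apply, Measure.smul_apply, Measure.smul_apply, hb,
      hs.posterior_compl_interior S]
    simp
  filter_upwards [compl_mem_ae_iff.2 h0] with θ hθ
  exact interior_subset (not_not.1 hθ)

/-- An algorithm that solves the problem needs queries that separate the sampled hypotheses. -/
lemma le_numQueries_mul (hε : 0 < ε) (hsp : IsSpread D Θ γ ε) (S P : Sample X)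
    {A : QueryAlg X (Measure (X → ℝ))} (hA : Solves A D (clippedClass X Θ γ) ε 0.01) {t : ℝ}
    (ht0 : 0 ≤ t) (ht : ∀ x, ∫ θ, |clippedHyp X γ θ x - ∫ θ', clippedHyp X γ θ' x
      ∂(samplingLaw D γ (posterior Θ γ S) (posterior Θ γ P) (2 * ε))|
      ∂(samplingLaw D γ (posterior Θ γ S) (posterior Θ γ P) (2 * ε)) ≤ t) :
    0.49 ≤ A.numQueries * t := by
  set lam := samplingLaw D γ (posterior Θ γ S) (posterior Θ γ P) (2 * ε) with hlam
  have : IsProbabilityMeasure lam := hs.isProbabilityMeasure_samplingLaw hε hsp S P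
  set h' : X → ℝ := fun x => ∫ θ', clippedHyp X γ θ' x ∂lam with hh'
  have hmem : ∀ x, h' x ∈ Set.Icc γ (1 - γ) := fun x =>
    integral_mem_Icc (measurable_clippedHyp x) fun θ => hs.hyp_mem_Icc θ x
  have hγ := hs.pos
  have h0' : ∀ x, 0 ≤ h' x := fun x => hγ.le.trans (hmem x).1
  have h1' : ∀ x, h' x ≤ 1 := fun x => by linarith [(hmem x).2]
  have hAp : A.AllResults fun ν => IsProbabilityMeasure ν :=
    QueryAlg.allResults_mono (fun _ h => h.1) hA.1
  set ν := A.outputLaw h' with hν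
  have : IsProbabilityMeasure ν := QueryAlg.outputLaw_isProbabilityMeasure h0' h1' hAp
  obtain ⟨i1, i2⟩ := QueryAlg.integrable_integral_discrepancy_le (ν := lam) h0' h1'
    (f := clippedHyp X γ) ht0 (fun x => by
      refine (Integrable.sub ?_ (integrable_const _)).abs
      exact integrable_of_bounds (measurable_clippedHyp x) (fun θ => (hs.hyp_mem_Icc θ x).1)
        fun θ => (hs.hyp_mem_Icc θ x).2) ht A
  set s : Set (Vec d × (X → ℝ)) := {p | l2Dist D p.2 (clippedHyp X γ p.1) < ε} with hsdef
  have hsm : MeasurableSet s := by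
    refine measurableSet_lt (Continuous.measurable ?_) measurable_const
    exact (continuous_l2Dist D).comp
      (continuous_snd.prodMk (continuous_clippedHyp_pi.comp continuous_fst))
  have hmν : Measurable fun θ => ν.real (Prod.mk θ ⁻¹' s) :=
    (measurable_measure_prodMk_left hsm).ennreal_toReal
  have i3 : Integrable (fun θ => ν.real (Prod.mk θ ⁻¹' s)) lam :=
    integrable_of_bounds hmν (fun _ => measureReal_nonneg) fun _ => measureReal_le_one
  -- For almost every sampled `θ` the algorithm succeeds with probability at least 0.99 on true
  -- labels; using the labels of the mean hypothesis costs the discrepancy.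
  have h1 : (0.99 : ℝ) ≤ ∫ θ, (ν.real (Prod.mk θ ⁻¹' s) +
      QueryAlg.discrepancy h' (clippedHyp X γ θ) A) ∂lam := by
    have : ∫ _, (0.99 : ℝ) ∂lam ≤ ∫ θ, (ν.real (Prod.mk θ ⁻¹' s) +
        QueryAlg.discrepancy h' (clippedHyp X γ θ) A) ∂lam := by
      refine integral_mono_ae (integrable_const _) (i3.add i1) ?_
      filter_upwards [hs.ae_mem_samplingLaw S P] with θ hθ
      have e1 := hA.2 (clippedHyp X γ θ) ⟨θ, hθ, rfl⟩
      have e2 := QueryAlg.outputLaw_le_add_discrepancy (fun x => (hs.hyp_pos θ x).le)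
        (fun x => (hs.hyp_lt_one θ x).le) h0' h1' hAp (Prod.mk θ ⁻¹' s)
      have : IsProbabilityMeasure (A.outputLaw (clippedHyp X γ θ)) :=
        QueryAlg.outputLaw_isProbabilityMeasure (fun x => (hs.hyp_pos θ x).le)
          (fun x => (hs.hyp_lt_one θ x).le) hAp
      have e3 := (ENNReal.ofReal_le_iff_le_toReal (measure_ne_top _ _)).1 e1
      refine le_trans ?_ e2
      refine le_trans ?_ e3
      norm_num
    simpa using this
  rw [integral_add i3 i1] at h1
  have h2 : ∫ θ, ν.real (Prod.mk θ ⁻¹' s) ∂lam ≤ 1 / 2 := by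
    simp only [Measure.real]
    -- The output law `ν` no longer depends on `θ`, so Fubini allows fixing the output `g` first;
    -- the sampling law gives its `ε`-ball probability at most 1/2.
    rw [integral_toReal (measurable_measure_prodMk_left hsm).aemeasurable
      (Filter.Eventually.of_forall fun θ => measure_lt_top _ _), ← Measure.prod_apply hsm,
      Measure.prod_apply_symm hsm]
    refine ENNReal.toReal_le_of_le_ofReal (by norm_num) ?_
    calc ∫⁻ g, lam ((fun θ => (θ, g)) ⁻¹' s) ∂ν ≤ ∫⁻ _, ENNReal.ofReal (1 / 2) ∂ν := by
          refine lintegral_mono fun g => ?_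
          rw [← ENNReal.ofReal_toReal (measure_ne_top lam _)]
          exact ENNReal.ofReal_le_ofReal (hs.samplingLaw_real_le hε hsp S P g)
      _ = _ := by simp
  linarith

lemma integrable_sq_sub {ν : Measure (Vec d)} [IsProbabilityMeasure ν] (x : X) :
    Integrable (fun θ => (clippedHyp X γ θ x - ∫ θ', clippedHyp X γ θ' x ∂ν) ^ 2) ν := by
  have hI := integral_mem_Icc (ν := ν) (measurable_clippedHyp x) fun θ => hs.hyp_mem_Icc θ x
  have hγ := hs.pos
  refine integrable_of_bounds (((measurable_clippedHyp x).sub_const _).pow_const 2) (b := 1)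
    (fun _ => sq_nonneg _) fun θ => ?_
  rw [sq_le_one_iff_abs_le_one, abs_le]
  have := hs.hyp_mem_Icc θ x
  constructor <;> linarith [hI.1, hI.2, this.1, this.2]

/-- The optimal algorithm yields a point that separates the sampled hypotheses. -/
lemma exists_separating_of_solves (hε : 0 < ε) (hsp : IsSpread D Θ γ ε)
    {A : QueryAlg X (Measure (X → ℝ))} (hA : Solves A D (clippedClass X Θ γ) ε 0.01) {m : ℕ}
    (hm : A.numQueries ≤ m) (S P : Sample X) : ∃ x₀ : X, 0.24 / (m : ℝ) ^ 2 ≤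
      ∫ θ, (clippedHyp X γ θ x₀ - ∫ θ', clippedHyp X γ θ' x₀
      ∂(samplingLaw D γ (posterior Θ γ S) (posterior Θ γ P) (2 * ε))) ^ 2
      ∂(samplingLaw D γ (posterior Θ γ S) (posterior Θ γ P) (2 * ε)) := by
  set lam := samplingLaw D γ (posterior Θ γ S) (posterior Θ γ P) (2 * ε) with hlam
  have : IsProbabilityMeasure lam := hs.isProbabilityMeasure_samplingLaw hε hsp S P
  by_contra! hcon
  obtain ⟨x₁, -⟩ := D.support_nonempty
  have hm0 : (0 : ℝ) < m := by
    rcases Nat.eq_zero_or_pos m with rfl | h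
    · have := (integral_nonneg fun θ => sq_nonneg _).trans_lt (hcon x₁)
      simp at this
    · exact_mod_cast h
  have h := hs.le_numQueries_mul (t := √(0.24 / (m : ℝ) ^ 2)) hε hsp S P hA (Real.sqrt_nonneg _)
    fun x => by
      have i : Integrable (fun θ => clippedHyp X γ θ x - ∫ θ', clippedHyp X γ θ' x ∂lam) lam :=
        Integrable.sub (integrable_of_bounds (measurable_clippedHyp x)
          (fun θ => (hs.hyp_mem_Icc θ x).1) fun θ => (hs.hyp_mem_Icc θ x).2) (integrable_const _)
      refine Real.le_sqrt_of_sq_le ?_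
      refine (sq_integral_le_integral_sq i.abs ?_).trans ?_
      · simpa only [sq_abs] using hs.integrable_sq_sub x
      · simp only [sq_abs]
        exact (hcon x).le
  have h1 : (A.numQueries : ℝ) * √(0.24 / (m : ℝ) ^ 2) ≤ m * √(0.24 / (m : ℝ) ^ 2) := by gcongr
  rw [Real.sqrt_div' _ (by positivity), Real.sqrt_sq hm0.le, mul_div_cancel₀ _ hm0.ne'] at h1
  -- The constant 0.24 is just below `0.49² = 0.2401`, with `0.49 = 0.99 - 1/2`.
  have h2 : √(0.24 : ℝ) < 0.49 := by
    rw [Real.sqrt_lt' (by norm_num)]; norm_num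
  rw [Real.sqrt_div' _ (by positivity), Real.sqrt_sq hm0.le] at h
  linarith

/-- Some point separates the sampled hypotheses because they are far from each other. -/
lemma exists_separating_of_spread (hε : 0 < ε) (hsp : IsSpread D Θ γ ε) (S P : Sample X) :
    ∃ x₀ : X, ε ^ 2 / 2 ≤
      ∫ θ, (clippedHyp X γ θ x₀ - ∫ θ', clippedHyp X γ θ' x₀
      ∂(samplingLaw D γ (posterior Θ γ S) (posterior Θ γ P) (2 * ε))) ^ 2
      ∂(samplingLaw D γ (posterior Θ γ S) (posterior Θ γ P) (2 * ε)) := by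
  set lam := samplingLaw D γ (posterior Θ γ S) (posterior Θ γ P) (2 * ε) with hlam
  have : IsProbabilityMeasure lam := hs.isProbabilityMeasure_samplingLaw hε hsp S P
  set g : X → ℝ := fun x => ∫ θ', clippedHyp X γ θ' x ∂lam with hg
  have hball := hs.samplingLaw_real_le hε hsp S P g
  set F := {θ | l2Dist D g (clippedHyp X γ θ) < ε} with hF
  have hFm : MeasurableSet F := by
    refine measurableSet_lt (Continuous.measurable ?_) measurable_const
    exact (continuous_l2Dist D).comp (continuous_const.prodMk continuous_clippedHyp_pi)
  by_contra! hcon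
  have hi := fun x => hs.integrable_sq_sub (ν := lam) x
  -- The mean squared distance to the mean hypothesis is the `D`-average of the pointwise variances,
  -- and it is at least `ε²/2` because the `ε`-ball has probability at most 1/2.
  have e1 : ∫ θ, l2Dist D (clippedHyp X γ θ) g ^ 2 ∂lam =
      ∑ x, (D x).toReal * ∫ θ, (clippedHyp X γ θ x - g x) ^ 2 ∂lam := by
    simp only [sq_l2Dist]
    rw [integral_finsetSum _ fun x _ => (hi x).const_mul _]
    simp only [integral_const_mul]
    rfl
  have e2 : ∑ x, (D x).toReal * ∫ θ, (clippedHyp X γ θ x - g x) ^ 2 ∂lam < ε ^ 2 / 2 := by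
    obtain ⟨x₁, hx₁⟩ := D.support_nonempty
    calc _ < ∑ x, (D x).toReal * (ε ^ 2 / 2) := by
          refine Finset.sum_lt_sum (fun x _ => mul_le_mul_of_nonneg_left (hcon x).le
            ENNReal.toReal_nonneg) ⟨x₁, Finset.mem_univ _, mul_lt_mul_of_pos_left (hcon x₁) ?_⟩
          exact ENNReal.toReal_pos ((D.mem_support_iff _).1 hx₁) (D.apply_ne_top _)
      _ = _ := by rw [← Finset.sum_mul, sum_toReal_pmf, one_mul]
  have e3 : ∫ θ, Fᶜ.indicator (fun _ => ε ^ 2) θ ∂lam ≤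
      ∫ θ, l2Dist D (clippedHyp X γ θ) g ^ 2 ∂lam := by
    refine integral_mono ((integrable_const _).indicator hFm.compl) ?_ fun θ => ?_
    · simp only [sq_l2Dist]
      exact integrable_finsetSum _ fun x _ => (hi x).const_mul _
    · by_cases h : θ ∈ F
      · simp [h, sq_nonneg]
      · simp only [Set.mem_compl_iff, h, not_false_eq_true, Set.indicator_of_mem]
        rw [l2Dist_comm]
        exact pow_le_pow_left₀ hε.le (not_lt.1 h) 2
  rw [integral_indicator_const _ hFm.compl, probReal_compl_eq_one_sub hFm, smul_eq_mul] at e3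
  have : (1 / 2) * ε ^ 2 ≤ (1 - lam.real F) * ε ^ 2 := by gcongr; linarith
  linarith

/-- If the problem is not trivial, then the parameters are in the range of the estimates. -/
lemma bounds_of_le_l2Dist (hε : 0 < ε) {a b : Vec d} (ha : a ∈ Θ) (hb : b ∈ Θ)
    (hab : ε ≤ l2Dist D (clippedHyp X γ a) (clippedHyp X γ b)) :
    1 ≤ d ∧ ε ≤ 1 ∧ 2 * ε ≤ R₁ * R₂ := by
  have hγ := hs.pos
  refine ⟨?_, ?_, ?_⟩
  · by_contra! h
    obtain rfl : d = 0 := by omega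
    have := hs.l2Dist_hyp_le D a b
    rw [Subsingleton.elim a b, sub_self, norm_zero, mul_zero, zero_div] at this
    rw [Subsingleton.elim a b] at hab
    linarith
  · refine hab.trans (l2Dist_le_of_forall_abs_le D zero_le_one fun x => abs_le.2 ?_)
    have h1 := hs.hyp_mem_Icc a x
    have h2 := hs.hyp_mem_Icc b x
    constructor <;> linarith [h1.1, h1.2, h2.1, h2.2]
  · have h1 := hs.l2Dist_hyp_le D a b
    have h2 : ‖a - b‖ ≤ 2 * R₁ := (norm_sub_le _ _).trans (by
      linarith [hs.norm_param_le a ha, hs.norm_param_le b hb])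
    have h3 := mul_le_mul_of_nonneg_left h2 (zero_le_one.trans hs.one_le_right)
    linarith

lemma solves_ret
    (h : ∀ a ∈ Θ, ∀ b ∈ Θ, l2Dist D (clippedHyp X γ a) (clippedHyp X γ b) < ε) :
    ∃ A : QueryAlg X (Measure (X → ℝ)), Solves A D (clippedClass X Θ γ) ε 0.01 ∧
      A.numQueries ≤ 0 := by
  obtain ⟨a, ha⟩ := hs.nonempty
  refine ⟨.ret (Measure.dirac (clippedHyp X γ a)), ⟨⟨inferInstance, ?_⟩, ?_⟩, le_rfl⟩
  · rw [ae_dirac_eq]; exact ⟨a, ha, rfl⟩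
  · rintro _ ⟨θ, hθ, rfl⟩
    have hm : clippedHyp X γ a ∈ {h | err D (clippedHyp X γ θ) h < ε} := h a ha θ hθ
    simp only [QueryAlg.outputLaw]
    rw [Measure.dirac_apply_of_mem hm]
    exact ENNReal.ofReal_le_one.2 (by norm_num)

lemma clippedActive_allResults {K M : ℕ} (hK : 1 ≤ K) :
    (clippedActive D Θ γ ε argmax K M).AllResults fun ν =>
      IsProbabilityMeasure ν ∧ ∀ᵐ h ∂ν, h ∈ clippedClass X Θ γ := by
  refine (phases_length M K).bind fun p hp => ?_
  obtain ⟨S, Ps⟩ := p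
  have hlen : Ps.length = K := hp.2
  have hm : Measurable (clippedHyp X γ) := continuous_clippedHyp_pi.measurable
  have hsum : ∀ Ps : List (Sample X), (Ps.map (posterior Θ γ)).sum Set.univ = Ps.length ∧
      (Ps.map (posterior Θ γ)).sum (interior Θ)ᶜ = 0 := by
    intro Ps
    induction Ps with
    | nil => simp
    | cons P Ps ih =>
      have := hs.isProbabilityMeasure_posterior P
      simp only [List.map_cons, List.sum_cons, Measure.add_apply, ih.1, ih.2, measure_univ,
        hs.posterior_compl_interior P, List.length_cons]
      refine ⟨by push_cast; ring, by simp⟩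
  change IsProbabilityMeasure (((K : ℝ≥0∞)⁻¹ • (Ps.map (posterior Θ γ)).sum).map
    (clippedHyp X γ)) ∧ ∀ᵐ h ∂(((K : ℝ≥0∞)⁻¹ • (Ps.map (posterior Θ γ)).sum).map
    (clippedHyp X γ)), h ∈ clippedClass X Θ γ
  constructor
  · constructor
    rw [Measure.map_apply hm MeasurableSet.univ, Set.preimage_univ, Measure.smul_apply,
      (hsum Ps).1, hlen, smul_eq_mul]
    exact ENNReal.inv_mul_cancel (by exact_mod_cast (by omega : K ≠ 0)) (by simp)
  -- An open set is a countable union of closed sets, here bounded and hence compact, so its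
  -- continuous image is a countable union of compact sets.
  · have hG : MeasurableSet (clippedHyp X γ '' interior Θ) := by
      obtain ⟨F, hF, hFΘ, hU, -⟩ := (isOpen_interior (s := Θ)).exists_iUnion_isClosed
      rw [← hU, Set.image_iUnion]
      refine MeasurableSet.iUnion fun i => ?_
      have hb : Bornology.IsBounded (F i) := Metric.isBounded_closedBall.subset
        fun θ hθ => mem_closedBall_zero_iff.2 (hs.norm_param_le θ (interior_subset (hFΘ i hθ)))
      exact ((Metric.isCompact_of_isClosed_isBounded (hF i) hb).image
        continuous_clippedHyp_pi).isClosed.measurableSet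
    have h0 : ((K : ℝ≥0∞)⁻¹ • (Ps.map (posterior Θ γ)).sum).map (clippedHyp X γ)
        (clippedHyp X γ '' interior Θ)ᶜ = 0 := by
      rw [Measure.map_apply hm hG.compl, Measure.smul_apply]
      rw [measure_mono_null (fun θ hθ hθ' => hθ ⟨θ, hθ', rfl⟩ :
        clippedHyp X γ ⁻¹' (clippedHyp X γ '' interior Θ)ᶜ ⊆ (interior Θ)ᶜ) (hsum Ps).2, smul_zero]
    filter_upwards [compl_mem_ae_iff.2 h0] with h hh
    exact Set.image_mono interior_subset (not_not.1 hh)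

/-- Some algorithm solves the problem. -/
lemma exists_solves (hε : 0 < ε) (hargmax : ∀ (r : X → ℝ) (x : X), r x ≤ r (argmax r)) :
    ∃ A : QueryAlg X (Measure (X → ℝ)), Solves A D (clippedClass X Θ γ) ε 0.01 := by
  by_cases h : ∀ a ∈ Θ, ∀ b ∈ Θ, l2Dist D (clippedHyp X γ a) (clippedHyp X γ b) < ε
  · obtain ⟨A, hA, -⟩ := hs.solves_ret h
    exact ⟨A, hA⟩
  push Not at h
  obtain ⟨a, ha, b, hb, hab⟩ := h
  obtain ⟨hd, hε1, hR⟩ := hs.bounds_of_le_l2Dist hε ha hb hab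
  -- The guaranteed error `8ε'` is then strictly below `ε`, and two hypotheses at distance `ε`
  -- witness the spread at scale `ε'`.
  set ε' := ε / 9 with hε'
  have hε0 : 0 < ε' := by positivity
  have hsp : IsSpread D Θ γ ε' := ⟨a, ha, b, hb, by linarith⟩
  -- This `m` is not the label complexity, which would be circular, but is large enough for the
  -- variance `ε'²/2` to exceed `0.24/m²`.
  set m := ⌈1 / ε'⌉₊ with hm
  have hm1 : 1 ≤ m := Nat.one_le_ceil_iff.2 (by positivity)
  have hsep : 0.24 / (m : ℝ) ^ 2 ≤ ε' ^ 2 / 2 := by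
    have h1 : 1 ≤ m * ε' := by
      rw [← div_le_iff₀ hε0]; exact Nat.le_ceil _
    have hm0 : (0 : ℝ) < m := by exact_mod_cast hm1
    rw [div_le_iff₀ (by positivity)]
    have : (1 : ℝ) ≤ (m * ε') ^ 2 := one_le_pow₀ h1
    rw [mul_pow] at this
    linarith
  have hN := Nat.one_le_ceil_iff.2 (zero_lt_one.trans_le
    (one_le_budget hd hm1 hs.pos hs.lt_half hε0 (by linarith : 2 * ε' ≤ R₁ * R₂)))
  refine ⟨clippedActive D Θ γ ε' argmax ⌈budget d m R₁ R₂ γ ε'⌉₊ ⌈budget d m R₁ R₂ γ ε'⌉₊, hs.clippedActive_allResults hN, ?_⟩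
  rintro _ ⟨θs, hθs, rfl⟩
  have h2 := hs.expect_failure_le_of_separated (θs := θs) hε0 (by linarith) hsp hd hm1
    (by linarith) hargmax hθs fun S P => by
      obtain ⟨x₀, hx₀⟩ := hs.exists_separating_of_spread hε0 hsp S P
      exact ⟨x₀, hsep.trans hx₀⟩
  refine (hs.le_outputLaw_clippedActive hN h2).trans (measure_mono fun h hh => ?_)
  have := hh.2
  simp only [Set.mem_ofPred_eq]
  linarith

lemma exists_solves_mStar (hε : 0 < ε) (hargmax : ∀ (r : X → ℝ) (x : X), r x ≤ r (argmax r)) :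
    ∃ A : QueryAlg X (Measure (X → ℝ)), Solves A D (clippedClass X Θ γ) ε 0.01 ∧
      A.numQueries ≤ mStar D (clippedClass X Θ γ) ε 0.01 := by
  obtain ⟨A, hA⟩ := hs.exists_solves (D := D) hε hargmax
  exact Nat.sInf_mem (s := {n | ∃ A : QueryAlg X (Measure (X → ℝ)),
    Solves A D (clippedClass X Θ γ) ε 0.01 ∧ A.numQueries ≤ n}) ⟨_, A, hA, le_rfl⟩

lemma failure_eq_zero (hsp : ¬ IsSpread D Θ γ ε) (hθs : θs ∈ Θ) (P : Sample X) :
    failure D Θ γ ε θs P = 0 := by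
  have := hs.isProbabilityMeasure_posterior P
  rw [failure, measureReal_eq_zero_iff]
  refine measure_mono_null (fun θ hθ hΘ => hsp ⟨θs, hθs, θ, interior_subset hΘ, hθ⟩)
    (hs.posterior_compl_interior P)

lemma expect_sum_failure_eq_zero (hsp : ¬ IsSpread D Θ γ ε) (hθs : θs ∈ Θ) (K M : ℕ) :
    (phases D Θ γ ε argmax M K).expect (clippedHyp X γ θs) (fun p =>
      (p.2.map (failure D Θ γ ε θs)).sum) = 0 := by
  have : ∀ Ps : List (Sample X), (Ps.map (failure D Θ γ ε θs)).sum = 0 := fun Ps => by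
    induction Ps with
    | nil => rfl
    | cons P Ps ih => simp [ih, hs.failure_eq_zero hsp hθs]
  simp only [this, QueryAlg.expect_const]

end IsSetting

end ActiveLogistic

end

/-! ### Assembly and degenerate cases. -/

theorem mainTheorem3 :
    ∃ C : ℝ, 0 < C ∧ ∃ K M : (d m : ℕ) → (R₁ R₂ γ ε : ℝ) → ℕ,
      ∀ (d : ℕ) (X : Finset (Vec d)) (D : PMF X) (Θ : Set (Vec d)) (R₁ R₂ γ ε : ℝ)
        (argmax : (X → ℝ) → X) (m : ℕ) (A : QueryAlg X (Measure (X → ℝ))),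
        Convex ℝ Θ → volume Θ ≠ 0 →
        1 ≤ R₁ → (∀ θ ∈ Θ, ‖θ‖ ≤ R₁) →
        1 ≤ R₂ → (∀ x ∈ X, ‖x‖ ≤ R₂) →
        0 < γ → γ < 1 / 2 → 0 < ε →
        (∀ (r : X → ℝ) (x : X), r x ≤ r (argmax r)) →
        m = mStar D (clippedClass X Θ γ) ε 0.01 →
        A = clippedActive D Θ γ ε argmax (K d m R₁ R₂ γ ε) (M d m R₁ R₂ γ ε) →
        (A.numQueries : ℝ) ≤ C * ((d : ℝ) ^ 2 * (m : ℝ) ^ 20 * Real.log (1 / γ) ^ 26 *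
            Real.log (d * R₁ * R₂ * m / ε) ^ 2) ∧
          ∀ hstar ∈ clippedClass X Θ γ,
            ENNReal.ofReal 0.8 < A.outputLaw hstar
              {h | h ∈ clippedClass X Θ γ ∧ err D hstar h ≤ 8 * ε} := by
  refine ⟨24 * (16 * 10 ^ 12) ^ 2 * 2 ^ 16, by positivity,
    -- One phase without iterations makes no queries but still returns a parameter drawn from the
    -- uniform distribution; with no phase the output would be the zero measure.
    fun d m R₁ R₂ γ ε => if d * m = 0 then 1 else ⌈budget d m R₁ R₂ γ ε⌉₊,
    fun d m R₁ R₂ γ ε => if d * m = 0 then 0 else ⌈budget d m R₁ R₂ γ ε⌉₊, ?_⟩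
  intro d X D Θ R₁ R₂ γ ε argmax m A hconv hvol hR₁ hΘ hR₂ hX hγ hγ2 hε hargmax hm hA
  have hs : IsSetting X Θ R₁ R₂ γ := ⟨hconv, hvol, hR₁, hΘ, hR₂, hX, hγ, hγ2⟩
  have hbounds : 1 ≤ m → 1 ≤ d ∧ ε ≤ 1 ∧ 2 * ε ≤ R₁ * R₂ := by
    intro hm1
    by_cases h : ∀ a ∈ Θ, ∀ b ∈ Θ, l2Dist D (clippedHyp X γ a) (clippedHyp X γ b) < ε
    · have : mStar D (clippedClass X Θ γ) ε 0.01 ≤ 0 := Nat.sInf_le (hs.solves_ret h)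
      omega
    · push Not at h
      obtain ⟨a, ha, b, hb, hab⟩ := h
      exact hs.bounds_of_le_l2Dist hε ha hb hab
  obtain ⟨A₀, hA₀, hA₀m⟩ := hs.exists_solves_mStar (D := D) hε hargmax
  rw [← hm] at hA₀m
  have hsep := fun hsp => hs.exists_separating_of_solves hε hsp hA₀ hA₀m
  have hspread : IsSpread D Θ γ ε → 1 ≤ m := by
    intro hsp
    by_contra! h0
    -- Deviations are at most 1, so an algorithm without queries would give `0.49 ≤ 0`: spread
    -- hypotheses force at least one query.
    have h := hs.le_numQueries_mul (t := 1) hε hsp [] [] hA₀ zero_le_one fun x => by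
      have := hs.isProbabilityMeasure_samplingLaw hε hsp [] []
      set lam := samplingLaw D γ (posterior Θ γ ([] : Sample X)) (posterior Θ γ []) (2 * ε)
      have hI := integral_mem_Icc (ν := lam) (measurable_clippedHyp x)
        fun θ => hs.hyp_mem_Icc θ x
      refine (integral_mem_Icc (a := 0) ((measurable_clippedHyp x).sub_const _).abs
        fun θ => ⟨abs_nonneg _, abs_le.2 ?_⟩).2
      have := hs.hyp_mem_Icc θ x
      constructor <;> linarith [hI.1, hI.2, this.1, this.2]
    obtain rfl : m = 0 := by omega
    obtain h0 : A₀.numQueries = 0 := by omega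
    rw [h0] at h
    norm_num at h
  subst hA
  refine ⟨?_, ?_⟩
  · have hq := clippedActive_numQueries (D := D) (Θ := Θ) (γ := γ) (ε := ε) (argmax := argmax)
    by_cases hdm : d * m = 0
    · simp only [hdm, if_true]
      have := hq 1 0
      rw [mul_zero, zero_mul, Nat.le_zero] at this
      rw [this, Nat.cast_zero]
      rcases mul_eq_zero.1 hdm with h | h <;> simp [h]
    · simp only [hdm, if_false]
      have hm1 : 1 ≤ m := Nat.one_le_iff_ne_zero.2 (right_ne_zero_of_mul hdm)
      obtain ⟨hd, -, hR⟩ := hbounds hm1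
      refine le_trans ?_ (ceil_budget_sq_le hd hm1 hγ hγ2 hε hR)
      exact_mod_cast hq _ _
  · rintro _ ⟨θs, hθs, rfl⟩
    refine lt_of_lt_of_le (ENNReal.ofReal_lt_ofReal_iff'.2 ⟨?_, ?_⟩ :
      ENNReal.ofReal 0.8 < ENNReal.ofReal (1 - 0.01))
      (hs.le_outputLaw_clippedActive ?_ ?_)
    · norm_num
    · norm_num
    · beta_reduce
      split_ifs with hdm
      · exact le_rfl
      · have hm1 : 1 ≤ m := Nat.one_le_iff_ne_zero.2 (right_ne_zero_of_mul hdm)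
        obtain ⟨hd, -, hR⟩ := hbounds hm1
        exact Nat.one_le_ceil_iff.2 (zero_lt_one.trans_le (one_le_budget hd hm1 hγ hγ2 hε hR))
    -- If `d * m = 0`, the hypotheses are not spread: a spread forces `m ≥ 1`, and `m ≥ 1` forces `d
    -- ≥ 1`.
    · by_cases hsp : IsSpread D Θ γ ε
      · have hm1 := hspread hsp
        obtain ⟨hd, hε1, hR⟩ := hbounds hm1
        have hdm : d * m ≠ 0 := by positivity
        simp only [hdm, if_false]
        exact hs.expect_failure_le_of_separated hε hε1 hsp hd hm1 hR hargmax hθs (hsep hsp)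
      · rw [hs.expect_sum_failure_eq_zero hsp hθs]
        positivity
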